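/- Let $\mathfrak g$ be a real three-dimensional Lie algebra of Bianchi type I–VIII (i.e. not isomorphic to $\mathfrak{so}(3)$, which is type IX), let $(e_1,e_2,e_3)$ be any basis of $\mathfrak g$ (a left invariant frame of the simply connected Lie group with Lie algebra $\mathfrak g$) and $[e_i,e_j]=C^k_{ij}e_k$. Latin indices run over $1,2,3$ and repeated indices are summed. Let $\Lambda\in\mathbb R$ and $m>0$. The unknowns are functions of $t$: $g=(g_{ij})$ (symmetric positive definite), $k=(k_{ij})$ (symmetric), $E=(E^i)$, $F=(F_{ij})$ (antisymmetric), $u=(u^i)$, $\Phi$, $U\ge 0$, $\rho>0$, $e\ge 0$. Indices are moved with $g_{ij}$ and its inverse $g^{ij}$. Put $H=g^{ij}k_{ij}$, $u^0=-u_0=\sqrt{1+g_{ij}u^iu^j}$, $$\gamma^l_{ij}=\tfrac12 g^{lk}\big(-C^p_{jk}g_{ip}+C^p_{ki}g_{jp}+C^p_{ij}g_{kp}\big),\quad R_{ij}=\gamma^l_{lp}\gamma^p_{ji}-\gamma^p_{jl}\gamma^l_{pi}-C^l_{pj}\gamma^p_{li},\quad R=g^{ij}R_{ij},$$ $$\nabla_l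 k_{ij}=-\gamma^p_{li}k_{pj}-\gamma^p_{lj}k_{ip},\quad T_{00}=U+\tfrac12m^2\Phi^2,\quad T_{0i}=0,\quad T_{ij}=\tfrac12g_{ij}(2U-m^2\Phi^2),$$ $$\tau_{00}=\tfrac12g_{ij}E^iE^j+\tfrac14F_{ij}F^{ij},\quad \tau_{0j}=-E^kF_{jk},\quad \tau_{ij}=\tfrac12g_{ij}g_{kl}E^kE^l-E_iE_j-\tfrac14g_{ij}F_{kl}F^{kl}+g^{kl}F_{ik}F_{jl}.$$ The Einstein–Maxwell–massive scalar field system with charged pure matter in $3+1$ form is the evolution system $$\dot g_{ij}=-2k_{ij},$$ $$\dot k_{ij}=R_{ij}+Hk_{ij}-2k^l_jk_{il}-8\pi(T_{ij}+\tau_{ij}+\rho u_iu_j)+4\pi\big[-T_{00}-\rho u_0^2+g^{lp}(T_{lp}+\rho u_lu_p)\big]g_{ij}-\Lambda g_{ij},$$ $$\dot E^i=HE^i-\big(C^j_{jk}g^{kl}g^{ip}+\tfrac12C^i_{jk}g^{jl}g^{kp}\big)F_{lp}+4\pi e\,u^i,\qquad \dot F_{ij}=C^k_{ij}g_{kl}E^l,$$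 $$\dot u^i=2k^i_ju^j-\gamma^i_{jk}\frac{u^ju^k}{u^0}-4\pi\frac e\rho E^i+4\pi\frac e\rho\,\frac{g^{il}F_{jl}u^j}{u^0},$$ $$\dot\Phi=\sqrt{2U},\qquad \dot U=2HU-m^2\Phi\sqrt{2U},$$ $$\dot\rho=-\Theta\rho+4\pi e\,\frac{g_{ij}E^ju^i}{(u^0)^2},\qquad \dot e=-\Theta e+4\pi\,\frac{g_{ij}E^ju^i}{(u^0)^2}\,\frac{e^2}{\rho},\qquad \Theta=\frac{k_{ij}u^iu^j}{(u^0)^2}+\frac{C^i_{ij}u^j}{u^0}-k^i_i,$$ together with the constraints $$R-k_{ij}k^{ij}+H^2=16\pi(T_{00}+\tau_{00}+\rho u_0^2)+2\Lambda,\qquad \nabla^ik_{ij}=-8\pi(T_{0j}+\tau_{0j}+\rho u_0u_j),$$ $$C^l_{ij}F_{kl}+C^l_{ki}F_{jl}+C^l_{jk}F_{il}=0,\qquad C^i_{ik}E^k+4\pi e\,u^0=0.$$ Let initial data $(g^0,k^0,E^0,F^0,u^{(0)},\Phi^0,U^0,\rho^0,e^0)$ be given with $g^0$ symmetric positive definite,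 $k^0$ symmetric, $F^0$ antisymmetric, $\Phi^0>0$, $U^0>0$, $\rho^0>0$, $e^0\ge0$, satisfying the constraints. Suppose $$\Lambda>-4\pi m^2(\Phi^0)^2\qquad\text{and}\qquad H^0:=(g^0)^{ij}k^0_{ij}<0 .$$ Then there is a unique solution of the evolution system on the whole of $[0,+\infty)$ with these initial data, and it satisfies the constraints for all $t\ge0$. -/

import Mathlib

noncomputable section

namespace EinsteinMaxwellScalar

/-- The structure constants of a three-dimensional real Lie algebra in a frame `b`:
`[b i, b j] = ∑ k, C^k_{ij} b k`, where `C^k_{ij}` is written `structConst b k i j`. -/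
def structConst {L : Type*} [LieRing L] [LieAlgebra ℝ L] (b : Module.Basis (Fin 3) ℝ L)
    (k i j : Fin 3) : ℝ :=
  b.repr ⁅b i, b j⁆ k

/-- In Bianchi's list of the real three-dimensional Lie algebras, type IX is the algebra `so(3)`;
the types I to VIII are all the others. -/
def IsBianchiIToVIII (L : Type*) [LieRing L] [LieAlgebra ℝ L] : Prop :=
  Module.finrank ℝ L = 3 ∧ IsEmpty (L ≃ₗ⁅ℝ⁆ LieAlgebra.Orthogonal.so (Fin 3) ℝ)

/-- The unknowns at one instant, as components in the left invariant frame: the metric `g_{ij}`,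
the second fundamental form `k_{ij}`, the electric field `E^i = F^{0i}`, the magnetic part
`F_{ij}`, the spatial velocity `u^i`, the scalar field `Φ`, `U = (dΦ/dt)² / 2`, the proper matter
density `ρ` and the proper charge density `e`. -/
@[ext]
structure State where
  g : Matrix (Fin 3) (Fin 3) ℝ
  k : Matrix (Fin 3) (Fin 3) ℝ
  E : Fin 3 → ℝ
  F : Matrix (Fin 3) (Fin 3) ℝ
  u : Fin 3 → ℝ
  Φ : ℝ
  U : ℝ
  ρ : ℝ
  e : ℝ

namespace State

/-- The algebraic conditions under which a state is meaningful. -/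
structure Admissible (v : State) : Prop where
  g_posDef : v.g.PosDef
  k_symm : ∀ i j, v.k i j = v.k j i
  F_antisymm : ∀ i j, v.F i j = -v.F j i
  U_nonneg : 0 ≤ v.U
  ρ_pos : 0 < v.ρ
  e_nonneg : 0 ≤ v.e

variable (v : State)

/-- `g^{ij}` -/
def gInv : Matrix (Fin 3) (Fin 3) ℝ := v.g⁻¹

/-- `k^i_j = g^{il} k_{lj}` -/
def kMixed (i j : Fin 3) : ℝ := ∑ l, v.gInv i l * v.k l j

/-- The mean curvature `H = g^{ij} k_{ij}`. -/
def H : ℝ := ∑ i, ∑ j, v.gInv i j * v.k i j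

/-- `k_{ij} k^{ij}` -/
def kSq : ℝ := ∑ i, ∑ j, ∑ l, ∑ p, v.gInv i l * v.gInv j p * v.k i j * v.k l p

/-- `u^0 = √(1 + g_{ij} u^i u^j)`; the covariant component is `u_0 = -u^0`. -/
def uZero : ℝ := √(1 + ∑ i, ∑ j, v.g i j * v.u i * v.u j)

/-- `u_i = g_{ij} u^j` -/
def uLow (i : Fin 3) : ℝ := ∑ j, v.g i j * v.u j

/-- `g_{ij} E^i E^j` -/
def ESq : ℝ := ∑ i, ∑ j, v.g i j * v.E i * v.E j

/-- `g^{ik} g^{jl} F_{ij} F_{kl}` -/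
def FSq : ℝ := ∑ i, ∑ j, ∑ k, ∑ l, v.gInv i k * v.gInv j l * v.F i j * v.F k l

/-- `T_{00}` for the scalar field of mass `m`, with `(dΦ/dt)² = 2 U`. -/
def T00 (m : ℝ) : ℝ := v.U + m ^ 2 * v.Φ ^ 2 / 2

/-- `T_{ij}` for the scalar field of mass `m`, with `(dΦ/dt)² = 2 U`; also `T_{0i} = 0`. -/
def T (m : ℝ) (i j : Fin 3) : ℝ := v.g i j * (2 * v.U - m ^ 2 * v.Φ ^ 2) / 2

/-- `τ_{00}` for the Maxwell field. -/
def τ00 : ℝ := v.ESq / 2 + v.FSq / 4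

/-- `τ_{0j}` for the Maxwell field. -/
def τ0 (j : Fin 3) : ℝ := -∑ k, v.E k * v.F j k

/-- `τ_{ij}` for the Maxwell field. -/
def τ (i j : Fin 3) : ℝ :=
  v.g i j * v.ESq / 2 - (∑ k, v.g i k * v.E k) * (∑ l, v.g j l * v.E l)
    - v.g i j * v.FSq / 4 + ∑ k, ∑ l, v.gInv k l * v.F i k * v.F j l

variable (C : Fin 3 → Fin 3 → Fin 3 → ℝ)

/-- The connection coefficients `γ^l_{ij}` of the left invariant metric `g`:
`∇_{e_i} e_j = γ^l_{ij} e_l`. -/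
def γ (l i j : Fin 3) : ℝ :=
  (1 / 2) * ∑ k, v.gInv l k *
    ∑ p, (-C p j k * v.g i p + C p k i * v.g j p + C p i j * v.g k p)

/-- The Ricci tensor `R_{ij}` of the left invariant metric `g`. -/
def Ric (i j : Fin 3) : ℝ :=
  ∑ l, ∑ p, (v.γ C l l p * v.γ C p j i - v.γ C p j l * v.γ C l p i - C l p j * v.γ C p l i)

/-- The scalar curvature `R = g^{ij} R_{ij}`. -/
def R : ℝ := ∑ i, ∑ j, v.gInv i j * v.Ric C i j

/-- `∇_l k_{ij}`, the covariant derivative of a left invariant tensor. -/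
def nablaK (l i j : Fin 3) : ℝ := ∑ p, (-v.γ C p l i * v.k p j - v.γ C p l j * v.k i p)

/-- The constraint equations: the Hamiltonian and momentum constraints and the two Maxwell
constraints. -/
structure Constraints (Λ m : ℝ) : Prop where
  hamiltonian :
    v.R C - v.kSq + v.H ^ 2 =
      16 * Real.pi * (v.T00 m + v.τ00 + v.ρ * v.uZero ^ 2) + 2 * Λ
  momentum : ∀ j,
    ∑ i, ∑ l, v.gInv i l * v.nablaK C l i j =
      -8 * Real.pi * (v.τ0 j + v.ρ * (-v.uZero) * v.uLow j)
  magnetic : ∀ i j k,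
    ∑ l, (C l i j * v.F k l + C l k i * v.F j l + C l j k * v.F i l) = 0
  gauss :
    (∑ i, ∑ k, C i i k * v.E k) + 4 * Real.pi * v.e * v.uZero = 0

/-! The right-hand sides of the evolution equations. -/

/-- Right-hand side for `k_{ij}`. -/
def kRhs (Λ m : ℝ) (i j : Fin 3) : ℝ :=
  v.Ric C i j + v.H * v.k i j - 2 * ∑ l, v.kMixed l j * v.k i l
    - 8 * Real.pi * (v.T m i j + v.τ i j + v.ρ * v.uLow i * v.uLow j)
    + 4 * Real.pi * (-v.T00 m - v.ρ * v.uZero ^ 2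
        + ∑ l, ∑ p, v.gInv l p * (v.T m l p + v.ρ * v.uLow l * v.uLow p)) * v.g i j
    - Λ * v.g i j

/-- Right-hand side for `E^i`. -/
def ERhs (i : Fin 3) : ℝ :=
  v.H * v.E i
    - ∑ j, ∑ k, ∑ l, ∑ p, (C j j k * v.gInv k l * v.gInv i p
        + (1 / 2) * C i j k * v.gInv j l * v.gInv k p) * v.F l p
    + 4 * Real.pi * v.e * v.u i

/-- Right-hand side for `F_{ij}`. -/
def FRhs (i j : Fin 3) : ℝ := ∑ k, ∑ l, C k i j * v.g k l * v.E l

/-- Right-hand side for `u^i`. -/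
def uRhs (i : Fin 3) : ℝ :=
  2 * (∑ j, v.kMixed i j * v.u j)
    - (∑ j, ∑ k, v.γ C i j k * v.u j * v.u k) / v.uZero
    - 4 * Real.pi * (v.e / v.ρ) * v.E i
    + 4 * Real.pi * (v.e / v.ρ) * (∑ j, ∑ l, v.gInv i l * v.F j l * v.u j) / v.uZero

/-- `k_{ij} u^i u^j / (u^0)² + C^i_{ij} u^j / u^0 - k^i_i` -/
def expansion : ℝ :=
  (∑ i, ∑ j, v.k i j * v.u i * v.u j) / v.uZero ^ 2
    + (∑ i, ∑ j, C i i j * v.u j) / v.uZero - v.H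

/-- `g_{ij} E^j u^i / (u^0)²` -/
def work : ℝ := (∑ i, ∑ j, v.g i j * v.E j * v.u i) / v.uZero ^ 2

end State

/-- `v` is a solution on `[0, +∞)` of the evolution system with initial value `v₀`.
Derivatives are one-sided at `0`. -/
structure IsGlobalSolution (C : Fin 3 → Fin 3 → Fin 3 → ℝ) (Λ m : ℝ) (v₀ : State)
    (v : ℝ → State) : Prop where
  init : v 0 = v₀
  admissible : ∀ t, 0 ≤ t → (v t).Admissible
  g_eq : ∀ t, 0 ≤ t → ∀ i j,
    HasDerivWithinAt (fun s => (v s).g i j) (-2 * (v t).k i j) (Set.Ici 0) t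
  k_eq : ∀ t, 0 ≤ t → ∀ i j,
    HasDerivWithinAt (fun s => (v s).k i j) ((v t).kRhs C Λ m i j) (Set.Ici 0) t
  E_eq : ∀ t, 0 ≤ t → ∀ i,
    HasDerivWithinAt (fun s => (v s).E i) ((v t).ERhs C i) (Set.Ici 0) t
  F_eq : ∀ t, 0 ≤ t → ∀ i j,
    HasDerivWithinAt (fun s => (v s).F i j) ((v t).FRhs C i j) (Set.Ici 0) t
  u_eq : ∀ t, 0 ≤ t → ∀ i,
    HasDerivWithinAt (fun s => (v s).u i) ((v t).uRhs C i) (Set.Ici 0) t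
  Φ_eq : ∀ t, 0 ≤ t →
    HasDerivWithinAt (fun s => (v s).Φ) (√(2 * (v t).U)) (Set.Ici 0) t
  U_eq : ∀ t, 0 ≤ t →
    HasDerivWithinAt (fun s => (v s).U)
      (2 * (v t).H * (v t).U - m ^ 2 * (v t).Φ * √(2 * (v t).U)) (Set.Ici 0) t
  ρ_eq : ∀ t, 0 ≤ t →
    HasDerivWithinAt (fun s => (v s).ρ)
      (-(v t).expansion C * (v t).ρ + 4 * Real.pi * (v t).e * (v t).work) (Set.Ici 0) t
  e_eq : ∀ t, 0 ≤ t →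
    HasDerivWithinAt (fun s => (v s).e)
      (-(v t).expansion C * (v t).e + 4 * Real.pi * (v t).work * ((v t).e ^ 2 / (v t).ρ))
      (Set.Ici 0) t

end EinsteinMaxwellScalar

end

open EinsteinMaxwellScalar

/-! The equations form an ordinary differential system, so global existence reduces to showing that
on every bounded time interval a solution stays in a compact part of the set where `g` is positive
definite and `ρ > 0`. The bounds come from the Hamiltonian constraint. Three facts feed it.

Constraints propagate. The magnetic defect is constant and the Gauss defect `d` satisfies `d' = H
d`. Once both vanish, so does the source in `p' = H p` for the momentum defect, and then the
Hamiltonian defect satisfies `h' = 2 H h`. Every such identity is tensorial, so at each instant it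
is computed in a frame orthonormal at that instant (`EvolvesAt.frame`); the Jacobi identity supplies
symmetry of the Ricci tensor and the contracted Bianchi identity.

The scalar curvature is nonpositive outside type IX (`State.R_nonpos`). In an orthonormal frame the
bracket splits into a symmetric matrix `n` and a covector `a`, with `R = (tr n)²/2 - |n|² -
(3/2)|a|²`. If `R > 0`, then `n` is definite; Jacobi gives `n a = 0`, hence `a = 0`, and the algebra
is `so(3)`.

The mean curvature is trapped. Since `R ≤ 0` and `H² ≤ 3 kSq`, one gets `H² ≥ 3 (Λ + 4π m² Φ²)`. The
right side stays positive because `Φ' = √(2U) ≥ 0`, so `H` cannot vanish and remains negative.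
Eliminating `R` from the equation for `H` shows `H' ≥ 0`. Thus `H² ≤ (H⁰)²`, and the constraint
bounds `kSq` and all energy densities. Gronwall then controls `g` from both sides, `u⁰` (using that
`e/ρ` is constant) and `ρ` from below through `ρ u⁰`; this is `IsExpandingData.exists_isBounded`.

The remaining difficulty is that `√(2U)` is not Lipschitz at `U = 0`. The variable `U` is replaced
by a signed root `ψ` with `ψ' = H ψ - m² Φ` and `U = max(ψ,0)²/2`. The vector field becomes locally
Lipschitz, so Picard–Lindelöf and uniqueness apply. Conversely every solution of the original system
arises in this way: because `Φ > 0`, the term `-m² Φ √(2U)` is decreasing in `U`, and a one-sided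
Gronwall argument (`IsSolutionOn.U_eq_half_max_sq`) identifies `U` with `max(ψ,0)²/2`. -/

noncomputable section

namespace EinsteinMaxwellScalar

open Matrix

/-! ### Change of frame for algebraic tensors -/

/-- The components in the frame `f_i = D^a_i e_a` of the structure constants `C`,
where `B` is the inverse of `D`. -/
def frameConst (D B : Matrix (Fin 3) (Fin 3) ℝ) (C : Fin 3 → Fin 3 → Fin 3 → ℝ)
    (k i j : Fin 3) : ℝ :=
  ∑ c, ∑ a, ∑ b, B k c * C c a b * D a i * D b j

/-- The components of a state in the frame `f_i = D^a_i e_a`, where `B` is the inverse of `D`. -/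
def State.frame (D B : Matrix (Fin 3) (Fin 3) ℝ) (v : State) : State where
  g := Dᵀ * v.g * D
  k := Dᵀ * v.k * D
  E := B *ᵥ v.E
  F := Dᵀ * v.F * D
  u := B *ᵥ v.u
  Φ := v.Φ
  U := v.U
  ρ := v.ρ
  e := v.e

/-- `(adMat C i) k j = C^k_{ij}` -/
def adMat (C : Fin 3 → Fin 3 → Fin 3 → ℝ) (i : Fin 3) : Matrix (Fin 3) (Fin 3) ℝ :=
  of fun k j => C k i j

/-- `(brMat C k) i j = C^k_{ij}` -/
def brMat (C : Fin 3 → Fin 3 → Fin 3 → ℝ) (k : Fin 3) : Matrix (Fin 3) (Fin 3) ℝ :=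
  of fun i j => C k i j

/-- `C^i_{ij}` -/
def trConst (C : Fin 3 → Fin 3 → Fin 3 → ℝ) (j : Fin 3) : ℝ := ∑ i, C i i j

/-- `∑ p, (X Γ_p)_{pi}` for a matrix `X` and a family of matrices `Γ`. -/
def mixedTrace (X : Matrix (Fin 3) (Fin 3) ℝ) (Γ : Fin 3 → Matrix (Fin 3) (Fin 3) ℝ)
    (i : Fin 3) : ℝ := ∑ p, (X * Γ p) p i

section Frame

variable {D B : Matrix (Fin 3) (Fin 3) ℝ}

lemma adMat_frameConst (C : Fin 3 → Fin 3 → Fin 3 → ℝ) (i : Fin 3) :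
    adMat (frameConst D B C) i = ∑ a, D a i • (B * adMat C a * D) := by
  ext k j
  simp only [adMat, frameConst, of_apply, Matrix.sum_apply, Matrix.smul_apply, Matrix.mul_apply,
    smul_eq_mul, Finset.mul_sum, Finset.sum_mul]
  rw [Finset.sum_comm]
  refine Finset.sum_congr rfl fun a _ => ?_
  rw [Finset.sum_comm]
  exact Finset.sum_congr rfl fun b _ => Finset.sum_congr rfl fun c _ => by ring

lemma brMat_frameConst (C : Fin 3 → Fin 3 → Fin 3 → ℝ) (k : Fin 3) :
    brMat (frameConst D B C) k = ∑ c, B k c • (Dᵀ * brMat C c * D) := by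
  ext i j
  simp only [brMat, frameConst, of_apply, Matrix.sum_apply, Matrix.smul_apply, Matrix.mul_apply,
    smul_eq_mul, Finset.mul_sum, Finset.sum_mul, transpose_apply]
  refine Finset.sum_congr rfl fun c _ => ?_
  rw [Finset.sum_comm]
  exact Finset.sum_congr rfl fun b _ => Finset.sum_congr rfl fun a _ => by ring

/-- Contraction of a lower index of a family with an upper index. -/
lemma sum_mul_sum_of_inverse {M : Type*} [AddCommGroup M] [Module ℝ M] (h : D * B = 1)
    (x : Fin 3 → ℝ) (y : Fin 3 → M) :
    ∑ i, (∑ c, B i c * x c) • (∑ a, D a i • y a) = ∑ a, x a • y a := by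
  have h1 : ∀ a c, ∑ i, D a i * B i c = if a = c then 1 else 0 := fun a c => by
    rw [← Matrix.mul_apply, h, Matrix.one_apply]
  calc ∑ i, (∑ c, B i c * x c) • (∑ a, D a i • y a)
      = ∑ i, ∑ a, ∑ c, (D a i * B i c) • (x c • y a) := by
        simp only [Finset.smul_sum, Finset.sum_smul]
        refine Finset.sum_congr rfl fun i _ => Finset.sum_congr rfl fun a _ =>
          Finset.sum_congr rfl fun c _ => ?_
        simp only [smul_smul]; congr 1; ring
    _ = ∑ a, ∑ c, ∑ i, (D a i * B i c) • (x c • y a) := by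
        rw [Finset.sum_comm]
        exact Finset.sum_congr rfl fun a _ => Finset.sum_comm
    _ = ∑ a, x a • y a := by
        refine Finset.sum_congr rfl fun a _ => ?_
        simp only [← Finset.sum_smul, h1, ite_smul, one_smul, zero_smul]
        simp

/-- Contraction of a lower index of a vector with an upper index of a family. -/
lemma sum_mul_sum_of_inverse' {M : Type*} [AddCommGroup M] [Module ℝ M] (h : D * B = 1)
    (x : Fin 3 → ℝ) (y : Fin 3 → M) :
    ∑ i, (∑ a, x a * D a i) • (∑ c, B i c • y c) = ∑ a, x a • y a := by
  have h1 : ∀ a c, ∑ i, D a i * B i c = if a = c then 1 else 0 := fun a c => by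
    rw [← Matrix.mul_apply, h, Matrix.one_apply]
  calc ∑ i, (∑ a, x a * D a i) • (∑ c, B i c • y c)
      = ∑ i, ∑ c, ∑ a, (D a i * B i c) • (x a • y c) := by
        simp only [Finset.smul_sum, Finset.sum_smul]
        refine Finset.sum_congr rfl fun i _ => Finset.sum_congr rfl fun a _ =>
          Finset.sum_congr rfl fun c _ => ?_
        simp only [smul_smul]; congr 1; ring
    _ = ∑ c, ∑ a, ∑ i, (D a i * B i c) • (x a • y c) := by
        rw [Finset.sum_comm]
        exact Finset.sum_congr rfl fun a _ => Finset.sum_comm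
    _ = ∑ a, x a • y a := by
        refine Finset.sum_congr rfl fun a _ => ?_
        simp only [← Finset.sum_smul, h1, ite_smul, one_smul, zero_smul]
        simp

/-- Each of the two contractions pairs an upper with a lower index, so a covector remains. The trace
of the bracket, the terms of the Ricci tensor and the divergence of `k` are all built from
contractions of this shape, so this one rule yields their covariance. -/
lemma mixedTrace_frame (h : D * B = 1) (X : Matrix (Fin 3) (Fin 3) ℝ)
    (Γ : Fin 3 → Matrix (Fin 3) (Fin 3) ℝ) :
    mixedTrace (B * X * D) (fun p => ∑ a, D a p • (B * Γ a * D)) = mixedTrace X Γ ᵥ* D := by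
  have key : ∀ p, B * X * D * (∑ a, D a p • (B * Γ a * D)) = ∑ a, D a p • (B * (X * Γ a * D)) := by
    intro p
    rw [Finset.mul_sum]
    refine Finset.sum_congr rfl fun a _ => ?_
    rw [Matrix.mul_smul]
    congr 1
    calc B * X * D * (B * Γ a * D) = B * X * (D * B) * Γ a * D := by simp only [Matrix.mul_assoc]
      _ = B * (X * Γ a * D) := by rw [h, Matrix.mul_one]; simp only [Matrix.mul_assoc]
  ext i
  simp only [mixedTrace, key, Matrix.sum_apply, Matrix.smul_apply, smul_eq_mul]
  rw [Finset.sum_comm]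
  have : ∀ a, ∑ p, D a p * (B * (X * Γ a * D)) p i = (X * Γ a * D) a i := fun a => by
    rw [← Matrix.mul_apply, ← Matrix.mul_assoc, h, Matrix.one_mul]
  simp only [this, vecMul, dotProduct, Matrix.mul_apply (M := X * Γ _), mixedTrace, Finset.sum_mul]
  rw [Finset.sum_comm]

lemma trConst_eq (C : Fin 3 → Fin 3 → Fin 3 → ℝ) : trConst C = mixedTrace 1 (adMat C) := by
  ext j; simp [trConst, mixedTrace, adMat]

lemma trConst_frameConst (h : D * B = 1) (C : Fin 3 → Fin 3 → Fin 3 → ℝ) :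
    trConst (frameConst D B C) = trConst C ᵥ* D := by
  have h' : B * D = 1 := mul_eq_one_comm.mp h
  rw [trConst_eq, trConst_eq, ← mixedTrace_frame h, Matrix.mul_one, h']
  congr 1
  ext1 i
  exact adMat_frameConst C i

end Frame

namespace State

variable (v : State) (C : Fin 3 → Fin 3 → Fin 3 → ℝ)

lemma kMixed_eq (i j : Fin 3) : v.kMixed i j = (v.gInv * v.k) i j := by
  simp [kMixed, Matrix.mul_apply]

lemma H_eq : v.H = trace (v.gInv * v.kᵀ) := by
  simp [H, trace, Matrix.mul_apply]

/-- The common shape of `kSq` and `FSq`. The transpose of `G` appears because no symmetry is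
assumed. -/
lemma contractSq_eq (G X : Matrix (Fin 3) (Fin 3) ℝ) :
    ∑ i, ∑ j, ∑ l, ∑ p, G i l * G j p * X i j * X l p = trace (Gᵀ * X * G * Xᵀ) := by
  simp only [trace, diag_apply, Matrix.mul_apply, transpose_apply, Finset.sum_mul]
  rw [Finset.sum_comm' (t' := Finset.univ) (s' := fun _ => Finset.univ) (by simp)]
  calc ∑ y, ∑ x, ∑ l, ∑ p, G x l * G y p * X x y * X l p
      = ∑ y, ∑ l, ∑ x, ∑ p, G x l * G y p * X x y * X l p :=
        Finset.sum_congr rfl fun _ _ => Finset.sum_comm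
    _ = ∑ l, ∑ y, ∑ x, ∑ p, G x l * G y p * X x y * X l p := Finset.sum_comm
    _ = ∑ l, ∑ y, ∑ p, ∑ x, G x l * G y p * X x y * X l p :=
        Finset.sum_congr rfl fun _ _ => Finset.sum_congr rfl fun _ _ => Finset.sum_comm
    _ = ∑ l, ∑ p, ∑ y, ∑ x, G x l * G y p * X x y * X l p :=
        Finset.sum_congr rfl fun _ _ => Finset.sum_comm
    _ = _ := Finset.sum_congr rfl fun _ _ => Finset.sum_congr rfl fun _ _ =>
        Finset.sum_congr rfl fun _ _ => Finset.sum_congr rfl fun _ _ => by ring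

lemma quad_eq (G : Matrix (Fin 3) (Fin 3) ℝ) (x y : Fin 3 → ℝ) :
    ∑ i, ∑ j, G i j * x i * y j = x ⬝ᵥ G *ᵥ y := by
  simp only [dotProduct, mulVec, Finset.mul_sum]
  exact Finset.sum_congr rfl fun _ _ => Finset.sum_congr rfl fun _ _ => by ring

lemma uLow_eq : v.uLow = v.g *ᵥ v.u := by
  ext i; simp [uLow, mulVec, dotProduct]

lemma τ0_eq : v.τ0 = -(v.F *ᵥ v.E) := by
  ext i
  simp only [τ0, mulVec, dotProduct, Pi.neg_apply, mul_comm]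

section Frame

variable {D B : Matrix (Fin 3) (Fin 3) ℝ}

@[simp] lemma frame_g : (v.frame D B).g = Dᵀ * v.g * D := rfl
@[simp] lemma frame_k : (v.frame D B).k = Dᵀ * v.k * D := rfl
@[simp] lemma frame_E : (v.frame D B).E = B *ᵥ v.E := rfl
@[simp] lemma frame_F : (v.frame D B).F = Dᵀ * v.F * D := rfl
@[simp] lemma frame_u : (v.frame D B).u = B *ᵥ v.u := rfl
@[simp] lemma frame_Φ : (v.frame D B).Φ = v.Φ := rfl
@[simp] lemma frame_U : (v.frame D B).U = v.U := rfl
@[simp] lemma frame_ρ : (v.frame D B).ρ = v.ρ := rfl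
@[simp] lemma frame_e : (v.frame D B).e = v.e := rfl

lemma transpose_mul_transpose_of_inverse (h : D * B = 1) : Bᵀ * Dᵀ = 1 := by
  rw [← Matrix.transpose_mul, h, Matrix.transpose_one]

lemma frame_gInv (h : D * B = 1) : (v.frame D B).gInv = B * v.gInv * Bᵀ := by
  have hD : D⁻¹ = B := Matrix.inv_eq_right_inv h
  simp only [gInv, frame_g, Matrix.mul_inv_rev, ← Matrix.transpose_nonsing_inv, hD,
    Matrix.mul_assoc]

lemma gInv_mul_frame (h : D * B = 1) (X : Matrix (Fin 3) (Fin 3) ℝ) :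
    (v.frame D B).gInv * (Dᵀ * X * D) = B * (v.gInv * X) * D := by
  rw [frame_gInv v h]
  calc B * v.gInv * Bᵀ * (Dᵀ * X * D) = B * v.gInv * (Bᵀ * Dᵀ) * X * D := by
        simp only [Matrix.mul_assoc]
    _ = _ := by
        rw [transpose_mul_transpose_of_inverse h, Matrix.mul_one]; simp only [Matrix.mul_assoc]

lemma trace_frame (h : D * B = 1) (X : Matrix (Fin 3) (Fin 3) ℝ) :
    trace (B * X * D) = trace X := by
  rw [Matrix.mul_assoc, trace_mul_comm, Matrix.mul_assoc, h, Matrix.mul_one]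

lemma trace_gInv_frame (h : D * B = 1) (X : Matrix (Fin 3) (Fin 3) ℝ) :
    trace ((v.frame D B).gInv * (Dᵀ * X * D)) = trace (v.gInv * X) := by
  rw [gInv_mul_frame v h, trace_frame h]

lemma frame_H (h : D * B = 1) : (v.frame D B).H = v.H := by
  rw [H_eq, H_eq, frame_k, ← trace_gInv_frame v h]
  simp only [Matrix.transpose_mul, Matrix.transpose_transpose, Matrix.mul_assoc]

lemma frame_contractSq (h : D * B = 1) (G X : Matrix (Fin 3) (Fin 3) ℝ) :
    trace ((B * G * Bᵀ)ᵀ * (Dᵀ * X * D) * (B * G * Bᵀ) * (Dᵀ * X * D)ᵀ)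
      = trace (Gᵀ * X * G * Xᵀ) := by
  have h2 := transpose_mul_transpose_of_inverse h
  calc trace ((B * G * Bᵀ)ᵀ * (Dᵀ * X * D) * (B * G * Bᵀ) * (Dᵀ * X * D)ᵀ)
      = trace (B * (Gᵀ * (Bᵀ * Dᵀ) * X * (D * B) * G * (Bᵀ * Dᵀ) * Xᵀ) * D) := by
        simp only [Matrix.transpose_mul, Matrix.transpose_transpose, Matrix.mul_assoc]
    _ = _ := by
        rw [h, h2, trace_frame h]; simp only [Matrix.mul_one, Matrix.mul_assoc]

lemma frame_kSq (h : D * B = 1) : (v.frame D B).kSq = v.kSq := by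
  rw [kSq, kSq, contractSq_eq, contractSq_eq, frame_gInv v h, frame_k, frame_contractSq h]

lemma frame_FSq (h : D * B = 1) : (v.frame D B).FSq = v.FSq := by
  rw [FSq, FSq, contractSq_eq, contractSq_eq, frame_gInv v h, frame_F, frame_contractSq h]

lemma mulVec_frame (h : D * B = 1) (X : Matrix (Fin 3) (Fin 3) ℝ) (x : Fin 3 → ℝ) :
    (Dᵀ * X * D) *ᵥ (B *ᵥ x) = (X *ᵥ x) ᵥ* D := by
  rw [mulVec_mulVec, Matrix.mul_assoc (Dᵀ * X), h, Matrix.mul_one, ← mulVec_mulVec, mulVec_transpose]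

lemma dotProduct_frame (h : D * B = 1) (x y : Fin 3 → ℝ) : (B *ᵥ x) ⬝ᵥ (y ᵥ* D) = x ⬝ᵥ y := by
  rw [dotProduct_comm, ← dotProduct_mulVec, mulVec_mulVec, h, one_mulVec, dotProduct_comm]

lemma quad_frame (h : D * B = 1) (X : Matrix (Fin 3) (Fin 3) ℝ) (x y : Fin 3 → ℝ) :
    (B *ᵥ x) ⬝ᵥ (Dᵀ * X * D) *ᵥ (B *ᵥ y) = x ⬝ᵥ X *ᵥ y := by
  rw [mulVec_frame h, dotProduct_frame h]

lemma frame_uZero (h : D * B = 1) : (v.frame D B).uZero = v.uZero := by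
  rw [uZero, uZero, quad_eq, quad_eq, frame_u, frame_g, quad_frame h]

lemma frame_uLow (h : D * B = 1) : (v.frame D B).uLow = v.uLow ᵥ* D := by
  rw [uLow_eq, uLow_eq, frame_u, frame_g, mulVec_frame h]

lemma frame_ESq (h : D * B = 1) : (v.frame D B).ESq = v.ESq := by
  rw [ESq, ESq, quad_eq, quad_eq, frame_E, frame_g, quad_frame h]

lemma frame_τ00 (h : D * B = 1) : (v.frame D B).τ00 = v.τ00 := by
  rw [τ00, τ00, frame_ESq v h, frame_FSq v h]

lemma frame_τ0 (h : D * B = 1) : (v.frame D B).τ0 = v.τ0 ᵥ* D := by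
  rw [τ0_eq, τ0_eq, frame_F, frame_E, mulVec_frame h, neg_vecMul]

lemma frame_T00 (m : ℝ) : (v.frame D B).T00 m = v.T00 m := rfl

/-- Two matrices are the components of one covariant 2-tensor in the two frames. -/
lemma frame_T (m : ℝ) : of ((v.frame D B).T m) = Dᵀ * of (v.T m) * D := by
  have : ∀ w : State, of (w.T m) = ((2 * w.U - m ^ 2 * w.Φ ^ 2) / 2) • w.g := by
    intro w; ext i j; simp only [T, of_apply, Matrix.smul_apply, smul_eq_mul]; ring
  rw [this, this]
  simp

lemma vecMulVec_frame (x y : Fin 3 → ℝ) :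
    vecMulVec (x ᵥ* D) (y ᵥ* D) = Dᵀ * vecMulVec x y * D := by
  rw [mul_vecMulVec, vecMulVec_mul, mulVec_transpose]

lemma τ_eq : of v.τ = (v.ESq / 2 - v.FSq / 4) • v.g - vecMulVec (v.g *ᵥ v.E) (v.g *ᵥ v.E)
    + v.F * v.gInv * v.Fᵀ := by
  ext i j
  simp only [τ, of_apply, Matrix.add_apply, Matrix.sub_apply, Matrix.smul_apply, smul_eq_mul,
    vecMulVec_apply, mulVec, dotProduct, Matrix.mul_apply, transpose_apply, Finset.sum_mul]
  rw [Finset.sum_comm (f := fun k l => v.gInv k l * v.F i k * v.F j l)]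
  have : ∀ k l, v.gInv l k * v.F i l * v.F j k = v.F i l * v.gInv l k * v.F j k :=
    fun k l => by ring
  simp only [this]
  ring

lemma frame_τ (h : D * B = 1) : of (v.frame D B).τ = Dᵀ * of v.τ * D := by
  rw [τ_eq, τ_eq, frame_ESq v h, frame_FSq v h, frame_g, frame_E, frame_F, mulVec_frame h,
    vecMulVec_frame, frame_gInv v h]
  simp only [Matrix.mul_add, Matrix.mul_sub, Matrix.add_mul, Matrix.sub_mul, Matrix.mul_smul,
    Matrix.smul_mul]
  congr 1
  calc Dᵀ * v.F * D * (B * v.gInv * Bᵀ) * (Dᵀ * v.F * D)ᵀ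
      = Dᵀ * v.F * (D * B) * v.gInv * (Bᵀ * Dᵀ) * v.Fᵀ * D := by
        simp only [Matrix.transpose_mul, Matrix.transpose_transpose, Matrix.mul_assoc]
    _ = _ := by
        rw [h, transpose_mul_transpose_of_inverse h]
        simp only [Matrix.mul_one, Matrix.mul_assoc]

end Frame

end State


/-! ### Covariance of the connection, the curvature and the constraint defects -/

/-- Antisymmetry of structure constants in their lower indices. -/
def IsAntisymm (C : Fin 3 → Fin 3 → Fin 3 → ℝ) : Prop := ∀ k i j, C k i j = -C k j i

lemma IsAntisymm.frameConst {C : Fin 3 → Fin 3 → Fin 3 → ℝ} (hC : IsAntisymm C)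
    (D B : Matrix (Fin 3) (Fin 3) ℝ) : IsAntisymm (frameConst D B C) := by
  intro k i j
  simp only [EinsteinMaxwellScalar.frameConst, ← Finset.sum_neg_distrib]
  refine Finset.sum_congr rfl fun c _ => ?_
  rw [Finset.sum_comm]
  refine Finset.sum_congr rfl fun b _ => Finset.sum_congr rfl fun a _ => ?_
  rw [hC c a b]; ring

lemma sum_sum_trConst (C : Fin 3 → Fin 3 → Fin 3 → ℝ) (x : Fin 3 → ℝ) :
    ∑ i, ∑ j, C i i j * x j = trConst C ⬝ᵥ x := by
  simp only [trConst, dotProduct, Finset.sum_mul]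
  exact Finset.sum_comm

lemma mixedTrace_sum_smul (c : Fin 3 → ℝ) (X Γ : Fin 3 → Matrix (Fin 3) (Fin 3) ℝ) :
    mixedTrace (∑ a, c a • X a) Γ = ∑ a, c a • mixedTrace (X a) Γ := by
  ext i
  simp only [mixedTrace, Finset.sum_mul, Matrix.sum_apply, Matrix.smul_mul, Matrix.smul_apply,
    Finset.sum_apply, Pi.smul_apply, smul_eq_mul, Finset.mul_sum]
  exact Finset.sum_comm

namespace State

variable (v : State) (C : Fin 3 → Fin 3 → Fin 3 → ℝ)

/-- `(γMat C i) l j = γ^l_{ij}` -/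
def γMat (i : Fin 3) : Matrix (Fin 3) (Fin 3) ℝ := of fun l j => v.γ C l i j

/-- The first-kind version of `γMat`, without the factor `1/2`. -/
def koszulMat (i : Fin 3) : Matrix (Fin 3) (Fin 3) ℝ :=
  v.g * adMat C i - (adMat C i)ᵀ * v.gᵀ - ∑ p, v.g i p • (brMat C p)ᵀ

/-- `∇^i k_{ij}` -/
def divK (j : Fin 3) : ℝ := ∑ i, ∑ l, v.gInv i l * v.nablaK C l i j

/-- `(nablaKMat C l) i j = ∇_l k_{ij}` -/
def nablaKMat (l : Fin 3) : Matrix (Fin 3) (Fin 3) ℝ := of fun i j => v.nablaK C l i j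

/-- `C^l_{ij} F_{kl}`, as a matrix in `i j`. -/
def bianchiMat (k : Fin 3) : Matrix (Fin 3) (Fin 3) ℝ := ∑ l, v.F k l • brMat C l

/-- The defect in the magnetic constraint. -/
def magneticDefect (i j k : Fin 3) : ℝ :=
  ∑ l, (C l i j * v.F k l + C l k i * v.F j l + C l j k * v.F i l)

/-- The defect in the Gauss constraint. -/
def gaussDefect : ℝ := (∑ i, ∑ k, C i i k * v.E k) + 4 * Real.pi * v.e * v.uZero

/-- The defect in the momentum constraint. -/
def momentumDefect (j : Fin 3) : ℝ :=
  v.divK C j + 8 * Real.pi * (v.τ0 j + v.ρ * (-v.uZero) * v.uLow j)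

/-- The defect in the Hamiltonian constraint. -/
def hamiltonianDefect (Λ m : ℝ) : ℝ :=
  v.R C - v.kSq + v.H ^ 2 - 16 * Real.pi * (v.T00 m + v.τ00 + v.ρ * v.uZero ^ 2) - 2 * Λ

lemma constraints_iff (Λ m : ℝ) : v.Constraints C Λ m ↔ v.hamiltonianDefect C Λ m = 0 ∧
    (∀ j, v.momentumDefect C j = 0) ∧ (∀ i j k, v.magneticDefect C i j k = 0) ∧
    v.gaussDefect C = 0 := by
  constructor
  · rintro ⟨h1, h2, h3, h4⟩
    refine ⟨?_, fun j => ?_, h3, h4⟩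
    · rw [hamiltonianDefect, h1]; ring
    · rw [momentumDefect, divK, h2]; ring
  · rintro ⟨h1, h2, h3, h4⟩
    refine ⟨?_, fun j => ?_, h3, h4⟩
    · rw [hamiltonianDefect] at h1; linarith
    · have := h2 j
      rw [momentumDefect, divK] at this; linarith

variable {C}

/-- Antisymmetry turns `C^p_{ki}` into `-C^p_{ik}`, after which every term of the Koszul formula is
a product or combination of matrices whose frame change is known. -/
lemma γMat_eq (hC : IsAntisymm C) (i : Fin 3) :
    v.γMat C i = (1 / 2 : ℝ) • (v.gInv * v.koszulMat C i) := by
  ext l j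
  simp only [γMat, γ, of_apply, Matrix.smul_apply, smul_eq_mul, Matrix.mul_apply, koszulMat,
    Matrix.sub_apply, Matrix.sum_apply, transpose_apply, adMat, brMat]
  congr 1
  refine Finset.sum_congr rfl fun k _ => ?_
  congr 1
  rw [← Finset.sum_sub_distrib, ← Finset.sum_sub_distrib]
  refine Finset.sum_congr rfl fun p _ => ?_
  rw [hC p k i]
  ring

/-- The last term of the definition acquires a plus sign because `-C^l_{pj} = C^l_{jp}` is an entry
of `ad`. Each row of the Ricci tensor is thereby a sum of covectors of known behaviour. -/
lemma Ric_eq (hC : IsAntisymm C) (i j : Fin 3) :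
    v.Ric C i j = (mixedTrace 1 (v.γMat C) ᵥ* v.γMat C j - mixedTrace (v.γMat C j) (v.γMat C)
      + mixedTrace (adMat C j) (v.γMat C)) i := by
  simp only [Ric, Pi.add_apply, Pi.sub_apply, vecMul, dotProduct, mixedTrace, Matrix.one_mul]
  simp only [Matrix.mul_apply, γMat, adMat, of_apply, Finset.sum_mul]
  rw [Finset.sum_comm (f := fun x i_1 => v.γ C i_1 i_1 x * v.γ C x j i),
    Finset.sum_comm (f := fun x x_1 => v.γ C x j x_1 * v.γ C x_1 x i)]
  simp only [← Finset.sum_sub_distrib, ← Finset.sum_add_distrib]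
  refine Finset.sum_congr rfl fun l _ => Finset.sum_congr rfl fun p _ => ?_
  rw [hC l p j]
  ring

lemma R_eq : v.R C = trace (v.gInv * (of (v.Ric C))ᵀ) := by
  simp [R, trace, Matrix.mul_apply]

lemma nablaKMat_eq (l : Fin 3) :
    v.nablaKMat C l = -((v.γMat C l)ᵀ * v.k) - v.k * v.γMat C l := by
  ext i j
  simp only [nablaKMat, nablaK, of_apply, Matrix.sub_apply, Matrix.neg_apply, Matrix.mul_apply,
    transpose_apply, γMat, ← Finset.sum_neg_distrib, ← Finset.sum_sub_distrib]
  exact Finset.sum_congr rfl fun p _ => by ring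

lemma divK_eq : v.divK C = mixedTrace 1 (fun l => v.gInvᵀ * v.nablaKMat C l) := by
  ext j
  simp only [divK, mixedTrace, Matrix.one_mul]
  simp only [Matrix.mul_apply, transpose_apply, nablaKMat, of_apply]
  exact Finset.sum_comm

section Frame

variable {D B : Matrix (Fin 3) (Fin 3) ℝ}

lemma frame_koszulMat (h : D * B = 1) (i : Fin 3) :
    (v.frame D B).koszulMat (frameConst D B C) i = ∑ a, D a i • (Dᵀ * v.koszulMat C a * D) := by
  have h2 := transpose_mul_transpose_of_inverse h
  have e1 : (v.frame D B).g * adMat (frameConst D B C) i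
      = ∑ a, D a i • (Dᵀ * (v.g * adMat C a) * D) := by
    rw [adMat_frameConst, Finset.mul_sum]
    refine Finset.sum_congr rfl fun a _ => ?_
    rw [Matrix.mul_smul, frame_g]
    congr 1
    calc Dᵀ * v.g * D * (B * adMat C a * D) = Dᵀ * v.g * (D * B) * adMat C a * D := by
          simp only [Matrix.mul_assoc]
      _ = _ := by rw [h, Matrix.mul_one]; simp only [Matrix.mul_assoc]
  have e2 : (adMat (frameConst D B C) i)ᵀ * (v.frame D B).gᵀ
      = ∑ a, D a i • (Dᵀ * ((adMat C a)ᵀ * v.gᵀ) * D) := by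
    rw [← Matrix.transpose_mul, e1, Matrix.transpose_sum]
    simp only [Matrix.transpose_smul, Matrix.transpose_mul, Matrix.transpose_transpose,
      Matrix.mul_assoc]
  have e3 : ∑ p, (v.frame D B).g i p • (brMat (frameConst D B C) p)ᵀ
      = ∑ a, D a i • (Dᵀ * (∑ p, v.g a p • (brMat C p)ᵀ) * D) := by
    have : ∀ p, (brMat (frameConst D B C) p)ᵀ = ∑ c, B p c • (Dᵀ * (brMat C c)ᵀ * D) := by
      intro p
      rw [brMat_frameConst, Matrix.transpose_sum]
      simp only [Matrix.transpose_smul, Matrix.transpose_mul, Matrix.transpose_transpose,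
        Matrix.mul_assoc]
    simp only [this, frame_g, Matrix.mul_apply (M := Dᵀ * v.g)]
    rw [sum_mul_sum_of_inverse' h]
    simp only [Matrix.mul_apply, transpose_apply, Matrix.mul_sum, Matrix.sum_mul, Finset.smul_sum,
      Finset.sum_smul, Matrix.mul_smul, Matrix.smul_mul, smul_smul]
    exact Finset.sum_comm
  rw [koszulMat, e1, e2, e3, ← Finset.sum_sub_distrib, ← Finset.sum_sub_distrib]
  refine Finset.sum_congr rfl fun a _ => ?_
  rw [koszulMat, Matrix.mul_sub, Matrix.mul_sub, Matrix.sub_mul, Matrix.sub_mul, smul_sub,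
    smul_sub]

lemma frame_γMat (hC : IsAntisymm C) (h : D * B = 1) :
    (v.frame D B).γMat (frameConst D B C) = fun i => ∑ a, D a i • (B * v.γMat C a * D) := by
  ext1 i
  rw [γMat_eq _ (hC.frameConst D B), frame_koszulMat v h, Finset.mul_sum, Finset.smul_sum]
  refine Finset.sum_congr rfl fun a _ => ?_
  rw [Matrix.mul_smul, gInv_mul_frame v h, γMat_eq _ hC, smul_comm, Matrix.mul_smul,
    Matrix.smul_mul]

lemma frame_Ric (hC : IsAntisymm C) (h : D * B = 1) :
    of ((v.frame D B).Ric (frameConst D B C)) = Dᵀ * of (v.Ric C) * D := by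
  have h' : B * D = 1 := mul_eq_one_comm.mp h
  have hθ : mixedTrace 1 ((v.frame D B).γMat (frameConst D B C))
      = mixedTrace 1 (v.γMat C) ᵥ* D := by
    rw [frame_γMat v hC h, ← mixedTrace_frame h, Matrix.mul_one, h']
  have row : ∀ j, mixedTrace 1 ((v.frame D B).γMat (frameConst D B C)) ᵥ*
        (v.frame D B).γMat (frameConst D B C) j
      - mixedTrace ((v.frame D B).γMat (frameConst D B C) j)
        ((v.frame D B).γMat (frameConst D B C))
      + mixedTrace (adMat (frameConst D B C) j) ((v.frame D B).γMat (frameConst D B C))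
      = ∑ a, D a j • ((mixedTrace 1 (v.γMat C) ᵥ* v.γMat C a
        - mixedTrace (v.γMat C a) (v.γMat C) + mixedTrace (adMat C a) (v.γMat C)) ᵥ* D) := by
    intro j
    have e1 : mixedTrace 1 (v.γMat C) ᵥ* D ᵥ* (∑ a, D a j • (B * v.γMat C a * D))
        = ∑ a, D a j • (mixedTrace 1 (v.γMat C) ᵥ* v.γMat C a ᵥ* D) := by
      rw [vecMul_vecMul, Matrix.mul_sum, vecMul_sum]
      refine Finset.sum_congr rfl fun a _ => ?_
      rw [Matrix.mul_smul, vecMul_smul, ← Matrix.mul_assoc, ← Matrix.mul_assoc, h, Matrix.one_mul,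
        vecMul_vecMul]
    rw [hθ, adMat_frameConst]
    simp only [frame_γMat v hC h, e1, mixedTrace_sum_smul, mixedTrace_frame h]
    rw [← Finset.sum_sub_distrib, ← Finset.sum_add_distrib]
    refine Finset.sum_congr rfl fun a _ => ?_
    rw [add_vecMul, sub_vecMul, smul_add, smul_sub]
  ext i j
  rw [of_apply, Ric_eq _ (hC.frameConst D B), row]
  simp only [Finset.sum_apply, Pi.smul_apply, smul_eq_mul, vecMul, dotProduct, ← Ric_eq v hC,
    Matrix.mul_apply, transpose_apply, of_apply]
  refine Finset.sum_congr rfl fun a _ => ?_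
  rw [mul_comm]
  congr 1
  exact Finset.sum_congr rfl fun b _ => mul_comm _ _

lemma frame_R (hC : IsAntisymm C) (h : D * B = 1) :
    (v.frame D B).R (frameConst D B C) = v.R C := by
  rw [R_eq, R_eq, frame_Ric v hC h, ← trace_gInv_frame v h]
  simp only [Matrix.transpose_mul, Matrix.transpose_transpose, Matrix.mul_assoc]

lemma frame_nablaKMat (hC : IsAntisymm C) (h : D * B = 1) (l : Fin 3) :
    (v.frame D B).nablaKMat (frameConst D B C) l = ∑ a, D a l • (Dᵀ * v.nablaKMat C a * D) := by
  have h2 := transpose_mul_transpose_of_inverse h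
  rw [nablaKMat_eq, frame_γMat v hC h, frame_k, Matrix.transpose_sum, Finset.sum_mul,
    Finset.mul_sum, ← Finset.sum_neg_distrib, ← Finset.sum_sub_distrib]
  refine Finset.sum_congr rfl fun a _ => ?_
  rw [nablaKMat_eq, Matrix.transpose_smul, Matrix.smul_mul, Matrix.mul_smul, ← smul_neg, ← smul_sub]
  congr 1
  have e1 : (B * v.γMat C a * D)ᵀ * (Dᵀ * v.k * D) = Dᵀ * ((v.γMat C a)ᵀ * v.k) * D := by
    calc _ = Dᵀ * (v.γMat C a)ᵀ * (Bᵀ * Dᵀ) * v.k * D := by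
          simp only [Matrix.transpose_mul, Matrix.mul_assoc]
      _ = _ := by rw [h2, Matrix.mul_one]; simp only [Matrix.mul_assoc]
  have e2 : Dᵀ * v.k * D * (B * v.γMat C a * D) = Dᵀ * (v.k * v.γMat C a) * D := by
    calc _ = Dᵀ * v.k * (D * B) * v.γMat C a * D := by simp only [Matrix.mul_assoc]
      _ = _ := by rw [h, Matrix.mul_one]; simp only [Matrix.mul_assoc]
  rw [e1, e2, Matrix.mul_sub, Matrix.sub_mul, Matrix.mul_neg, Matrix.neg_mul]

lemma frame_divK (hC : IsAntisymm C) (h : D * B = 1) :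
    (v.frame D B).divK (frameConst D B C) = v.divK C ᵥ* D := by
  have h' : B * D = 1 := mul_eq_one_comm.mp h
  rw [divK_eq, divK_eq, ← mixedTrace_frame h, Matrix.mul_one, h']
  congr 1
  ext1 l
  rw [frame_nablaKMat v hC h, Finset.mul_sum]
  refine Finset.sum_congr rfl fun a _ => ?_
  rw [Matrix.mul_smul, frame_gInv v h]
  congr 1
  calc (B * v.gInv * Bᵀ)ᵀ * (Dᵀ * v.nablaKMat C a * D)
      = B * v.gInvᵀ * (Bᵀ * Dᵀ) * v.nablaKMat C a * D := by
        simp only [Matrix.transpose_mul, Matrix.transpose_transpose, Matrix.mul_assoc]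
    _ = _ := by
        rw [transpose_mul_transpose_of_inverse h, Matrix.mul_one]
        simp only [Matrix.mul_assoc]

lemma frame_trConst_dotProduct (h : D * B = 1) (x : Fin 3 → ℝ) :
    trConst (frameConst D B C) ⬝ᵥ (B *ᵥ x) = trConst C ⬝ᵥ x := by
  rw [trConst_frameConst h, dotProduct_comm, dotProduct_frame h, dotProduct_comm]

lemma frame_gaussDefect (h : D * B = 1) :
    (v.frame D B).gaussDefect (frameConst D B C) = v.gaussDefect C := by
  rw [gaussDefect, gaussDefect, sum_sum_trConst, sum_sum_trConst, frame_E,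
    frame_trConst_dotProduct h, frame_uZero v h, frame_e]

lemma frame_momentumDefect (hC : IsAntisymm C) (h : D * B = 1) :
    (v.frame D B).momentumDefect (frameConst D B C) = v.momentumDefect C ᵥ* D := by
  have : ∀ (w : State) (C' : Fin 3 → Fin 3 → Fin 3 → ℝ), w.momentumDefect C'
      = w.divK C' + (8 * Real.pi) • w.τ0 + (-8 * Real.pi * w.ρ * w.uZero) • w.uLow := by
    intro w C'; ext j
    simp only [momentumDefect, Pi.add_apply, Pi.smul_apply, smul_eq_mul]; ring
  rw [this, this, frame_divK v hC h, frame_τ0 v h, frame_uLow v h, frame_uZero v h, frame_ρ,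
    add_vecMul, add_vecMul, smul_vecMul, smul_vecMul]

lemma frame_hamiltonianDefect (hC : IsAntisymm C) (h : D * B = 1) (Λ m : ℝ) :
    (v.frame D B).hamiltonianDefect (frameConst D B C) Λ m = v.hamiltonianDefect C Λ m := by
  rw [hamiltonianDefect, hamiltonianDefect, frame_R v hC h, frame_kSq v h, frame_H v h,
    frame_T00, frame_τ00 v h, frame_uZero v h, frame_ρ]

lemma magneticDefect_eq (i j k : Fin 3) : v.magneticDefect C i j k =
    v.bianchiMat C k i j + v.bianchiMat C j k i + v.bianchiMat C i j k := by
  simp only [magneticDefect, bianchiMat, Matrix.sum_apply, Matrix.smul_apply, brMat, of_apply,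
    smul_eq_mul, ← Finset.sum_add_distrib]
  exact Finset.sum_congr rfl fun l _ => by ring

lemma frame_bianchiMat (h : D * B = 1) (k : Fin 3) :
    (v.frame D B).bianchiMat (frameConst D B C) k
      = ∑ c, D c k • (Dᵀ * v.bianchiMat C c * D) := by
  simp only [bianchiMat, frame_F, Matrix.mul_apply (M := Dᵀ * v.F), brMat_frameConst]
  rw [sum_mul_sum_of_inverse' h]
  simp only [Matrix.mul_apply, transpose_apply, Matrix.mul_sum, Matrix.sum_mul, Finset.smul_sum,
    Finset.sum_smul, Matrix.mul_smul, Matrix.smul_mul, smul_smul]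
  exact Finset.sum_comm

lemma frame_bianchiMat_apply (h : D * B = 1) (i j k : Fin 3) :
    (v.frame D B).bianchiMat (frameConst D B C) k i j
      = ∑ c, ∑ a, ∑ b, D c k * D a i * D b j * v.bianchiMat C c a b := by
  rw [frame_bianchiMat v h]
  simp only [Matrix.sum_apply, Matrix.smul_apply, smul_eq_mul, Matrix.mul_apply, transpose_apply,
    Finset.mul_sum, Finset.sum_mul]
  refine Finset.sum_congr rfl fun c _ => ?_
  rw [Finset.sum_comm]
  exact Finset.sum_congr rfl fun b _ => Finset.sum_congr rfl fun a _ => by ring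

/-- The three cyclic terms are relabellings of a single trilinear expression, so they pull back with
the same coefficient and the defect transforms as a tensor of rank three. -/
lemma frame_magneticDefect (h : D * B = 1) (hv : ∀ i j k, v.magneticDefect C i j k = 0)
    (i j k : Fin 3) : (v.frame D B).magneticDefect (frameConst D B C) i j k = 0 := by
  have e1 : ∀ X : Fin 3 → Fin 3 → Fin 3 → ℝ,
      ∑ c, ∑ a, ∑ b, X c a b = ∑ a, ∑ b, ∑ c, X c a b := fun X => by
    rw [Finset.sum_comm]
    exact Finset.sum_congr rfl fun _ _ => Finset.sum_comm
  have e2 : (v.frame D B).bianchiMat (frameConst D B C) j k i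
      = ∑ c, ∑ a, ∑ b, D c k * D a i * D b j * v.bianchiMat C b c a := by
    rw [frame_bianchiMat_apply v h, e1]
    exact Finset.sum_congr rfl fun _ _ => Finset.sum_congr rfl fun _ _ =>
      Finset.sum_congr rfl fun _ _ => by ring
  have e3 : (v.frame D B).bianchiMat (frameConst D B C) i j k
      = ∑ c, ∑ a, ∑ b, D c k * D a i * D b j * v.bianchiMat C a b c := by
    rw [frame_bianchiMat_apply v h, e1, e1]
    exact Finset.sum_congr rfl fun _ _ => Finset.sum_congr rfl fun _ _ =>
      Finset.sum_congr rfl fun _ _ => by ring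
  rw [magneticDefect_eq, frame_bianchiMat_apply v h, e2, e3]
  simp only [← Finset.sum_add_distrib, ← mul_add]
  refine Finset.sum_eq_zero fun c _ => Finset.sum_eq_zero fun a _ => Finset.sum_eq_zero fun b _ => ?_
  rw [← magneticDefect_eq, hv, mul_zero]

end Frame

end State


/-! ### The Jacobi identity in components -/

/-- The Jacobi identity: `ad [x, y] = ad x ad y - ad y ad x`. -/
def IsJacobi (C : Fin 3 → Fin 3 → Fin 3 → ℝ) : Prop :=
  ∀ i j, ∑ m, C m i j • adMat C m = adMat C i * adMat C j - adMat C j * adMat C i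

lemma IsJacobi.frameConst {C : Fin 3 → Fin 3 → Fin 3 → ℝ} (hC : IsJacobi C)
    {D B : Matrix (Fin 3) (Fin 3) ℝ} (h : D * B = 1) : IsJacobi (frameConst D B C) := by
  intro i j
  have e1 : ∀ m, EinsteinMaxwellScalar.frameConst D B C m i j
      = ∑ c, B m c * ∑ a, ∑ b, D a i * D b j * C c a b := by
    intro m
    simp only [EinsteinMaxwellScalar.frameConst, Finset.mul_sum]
    exact Finset.sum_congr rfl fun _ _ => Finset.sum_congr rfl fun _ _ =>
      Finset.sum_congr rfl fun _ _ => by ring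
  have e2 : ∀ a b, (B * adMat C a * D) * (B * adMat C b * D)
      = B * (adMat C a * adMat C b) * D := by
    intro a b
    calc _ = B * adMat C a * (D * B) * adMat C b * D := by simp only [Matrix.mul_assoc]
      _ = _ := by rw [h, Matrix.mul_one]; simp only [Matrix.mul_assoc]
  simp only [e1, adMat_frameConst]
  rw [sum_mul_sum_of_inverse h]
  simp only [Finset.sum_mul, Finset.mul_sum, Matrix.smul_mul, Matrix.mul_smul, e2, smul_smul]
  rw [Finset.sum_comm (f := fun b a => (D b j * D a i) • (B * (adMat C a * adMat C b) * D))]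
  have hC' : ∀ i j, adMat C i * adMat C j - adMat C j * adMat C i = ∑ m, C m i j • adMat C m :=
    fun i j => (hC i j).symm
  simp only [← Finset.sum_sub_distrib, mul_comm (D _ j), ← smul_sub, ← Matrix.sub_mul,
    ← Matrix.mul_sub, hC', Finset.sum_smul]
  calc ∑ c, ∑ a, ∑ b, (D a i * D b j * C c a b) • (B * adMat C c * D)
      = ∑ a, ∑ b, ∑ c, (D a i * D b j * C c a b) • (B * adMat C c * D) := by
        rw [Finset.sum_comm]
        exact Finset.sum_congr rfl fun _ _ => Finset.sum_comm
    _ = ∑ b, ∑ a, ∑ c, (D a i * D b j * C c a b) • (B * adMat C c * D) := Finset.sum_comm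
    _ = _ := by
        rw [Finset.sum_comm]
        refine Finset.sum_congr rfl fun a _ => Finset.sum_congr rfl fun b _ => ?_
        simp only [Matrix.mul_sum, Matrix.sum_mul, Finset.smul_sum, Matrix.mul_smul,
          Matrix.smul_mul, smul_smul]

lemma isAntisymm_structConst {L : Type*} [LieRing L] [LieAlgebra ℝ L]
    (b : Module.Basis (Fin 3) ℝ L) : IsAntisymm (structConst b) := by
  intro k i j
  rw [structConst, structConst, ← lie_skew, map_neg, Finsupp.neg_apply]

lemma isJacobi_structConst {L : Type*} [LieRing L] [LieAlgebra ℝ L]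
    (b : Module.Basis (Fin 3) ℝ L) : IsJacobi (structConst b) := by
  have key : ∀ (x : L) (j p : Fin 3), b.repr ⁅x, b j⁆ p = ∑ m, b.repr x m * structConst b p m j := by
    intro x j p
    conv_lhs => rw [← b.sum_repr x]
    simp only [structConst, sum_lie, smul_lie, map_sum, map_smul, Finsupp.finsetSum_apply,
      Finsupp.smul_apply, smul_eq_mul]
  have key' : ∀ (x : L) (j p : Fin 3), b.repr ⁅b j, x⁆ p = ∑ m, structConst b p j m * b.repr x m := by
    intro x j p
    conv_lhs => rw [← b.sum_repr x]
    simp only [structConst, lie_sum, lie_smul, map_sum, map_smul, Finsupp.finsetSum_apply,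
      Finsupp.smul_apply, smul_eq_mul, mul_comm]
  intro i j
  ext p q
  simp only [Matrix.sum_apply, Matrix.smul_apply, Matrix.sub_apply, Matrix.mul_apply, adMat,
    of_apply, smul_eq_mul]
  have h := congrArg (fun x => b.repr x p) (lie_lie (b i) (b j) (b q))
  rw [map_sub, Finsupp.sub_apply, key, key', key'] at h
  exact h

/-! ### Covariance of the evolution equations -/

namespace State

variable (v : State) (C : Fin 3 → Fin 3 → Fin 3 → ℝ)

lemma kRhs_eq (Λ m : ℝ) : of (v.kRhs C Λ m) = of (v.Ric C) + v.H • v.k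
    - (2 : ℝ) • (v.k * (v.gInv * v.k))
    - (8 * Real.pi) • (of (v.T m) + of v.τ + v.ρ • vecMulVec v.uLow v.uLow)
    + (4 * Real.pi * (-v.T00 m - v.ρ * v.uZero ^ 2
        + trace (v.gInv * (of (v.T m) + v.ρ • vecMulVec v.uLow v.uLow)ᵀ))) • v.g - Λ • v.g := by
  have h1 : ∑ l, ∑ p, v.gInv l p * (v.T m l p + v.ρ * v.uLow l * v.uLow p)
      = trace (v.gInv * (of (v.T m) + v.ρ • vecMulVec v.uLow v.uLow)ᵀ) := by
    simp only [trace, diag_apply, Matrix.mul_apply, transpose_apply, Matrix.add_apply, of_apply,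
      Matrix.smul_apply, vecMulVec_apply, smul_eq_mul, mul_assoc]
  have h2 : ∀ i j, ∑ l, v.kMixed l j * v.k i l = (v.k * (v.gInv * v.k)) i j := by
    intro i j
    simp only [kMixed_eq, Matrix.mul_apply (M := v.k)]
    exact Finset.sum_congr rfl fun _ _ => mul_comm _ _
  ext i j
  rw [of_apply, kRhs, h1, h2]
  simp only [of_apply, Matrix.add_apply, Matrix.sub_apply, Matrix.smul_apply,
    smul_eq_mul, vecMulVec_apply, mul_assoc]

lemma ERhs_eq : v.ERhs C = v.H • v.E
    - (v.gInv *ᵥ ((trConst C ᵥ* v.gInv) ᵥ* v.F)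
      + fun i => (1 / 2) * trace ((brMat C i)ᵀ * (v.gInv * v.F * v.gInvᵀ)))
    + (4 * Real.pi * v.e) • v.u := by
  ext i
  simp only [ERhs, Pi.add_apply, Pi.sub_apply, Pi.smul_apply, smul_eq_mul]
  congr 2
  simp only [trace, diag_apply, Matrix.mul_apply, transpose_apply, mulVec, vecMul, dotProduct,
    trConst, brMat, of_apply]
  simp only [Fin.sum_univ_three]
  ring

lemma FRhs_eq : of (v.FRhs C) = ∑ k, (v.g *ᵥ v.E) k • brMat C k := by
  ext i j
  simp only [FRhs, of_apply, Matrix.sum_apply, Matrix.smul_apply, brMat, mulVec, dotProduct,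
    smul_eq_mul, Finset.sum_mul]
  exact Finset.sum_congr rfl fun _ _ => Finset.sum_congr rfl fun _ _ => by ring

lemma uRhs_eq : v.uRhs C = (2 : ℝ) • ((v.gInv * v.k) *ᵥ v.u)
    - (v.uZero)⁻¹ • (∑ j, v.u j • (v.γMat C j *ᵥ v.u))
    - (4 * Real.pi * (v.e / v.ρ)) • v.E
    + (4 * Real.pi * (v.e / v.ρ) * (v.uZero)⁻¹) • (v.gInv *ᵥ (v.u ᵥ* v.F)) := by
  ext i
  have h1 : ∑ j, ∑ k, v.γ C i j k * v.u j * v.u k = ∑ j, v.u j * (v.γMat C j *ᵥ v.u) i := by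
    simp only [mulVec, dotProduct, γMat, of_apply, Finset.mul_sum]
    exact Finset.sum_congr rfl fun _ _ => Finset.sum_congr rfl fun _ _ => by ring
  have h2 : ∑ j, ∑ l, v.gInv i l * v.F j l * v.u j = (v.gInv *ᵥ (v.u ᵥ* v.F)) i := by
    simp only [mulVec, vecMul, dotProduct, Finset.mul_sum]
    rw [Finset.sum_comm]
    exact Finset.sum_congr rfl fun _ _ => Finset.sum_congr rfl fun _ _ => by ring
  have h3 : ∑ j, v.kMixed i j * v.u j = ((v.gInv * v.k) *ᵥ v.u) i := by
    simp only [kMixed_eq, mulVec, dotProduct]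
  simp only [uRhs, h1, h2, h3, Pi.add_apply, Pi.sub_apply, Pi.smul_apply, smul_eq_mul,
    Finset.sum_apply]
  ring

lemma expansion_eq : v.expansion C = (v.u ⬝ᵥ v.k *ᵥ v.u) / v.uZero ^ 2
    + (trConst C ⬝ᵥ v.u) / v.uZero - v.H := by
  rw [expansion, quad_eq, sum_sum_trConst]

lemma work_eq : v.work = (v.u ⬝ᵥ v.g *ᵥ v.E) / v.uZero ^ 2 := by
  rw [work, ← quad_eq]
  congr 1
  exact Finset.sum_congr rfl fun _ _ => Finset.sum_congr rfl fun _ _ => by ring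

section Frame

variable {C} {D B : Matrix (Fin 3) (Fin 3) ℝ}

lemma frame_kRhs (hC : IsAntisymm C) (h : D * B = 1) (Λ m : ℝ) :
    of ((v.frame D B).kRhs (frameConst D B C) Λ m) = Dᵀ * of (v.kRhs C Λ m) * D := by
  have e0 : of ((v.frame D B).T m) + (v.frame D B).ρ •
      vecMulVec (v.frame D B).uLow (v.frame D B).uLow
      = Dᵀ * (of (v.T m) + v.ρ • vecMulVec v.uLow v.uLow) * D := by
    rw [frame_T, frame_uLow v h, vecMulVec_frame, frame_ρ]
    simp only [Matrix.mul_add, Matrix.add_mul, Matrix.mul_smul, Matrix.smul_mul]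
  have e1 : trace ((v.frame D B).gInv * (of ((v.frame D B).T m) + (v.frame D B).ρ •
      vecMulVec (v.frame D B).uLow (v.frame D B).uLow)ᵀ)
      = trace (v.gInv * (of (v.T m) + v.ρ • vecMulVec v.uLow v.uLow)ᵀ) := by
    rw [e0, ← trace_gInv_frame v h]
    simp only [Matrix.transpose_mul, Matrix.transpose_transpose, Matrix.mul_assoc]
  have e2 : (v.frame D B).k * ((v.frame D B).gInv * (v.frame D B).k)
      = Dᵀ * (v.k * (v.gInv * v.k)) * D := by
    rw [frame_k, gInv_mul_frame v h]
    calc _ = Dᵀ * v.k * (D * B) * (v.gInv * v.k) * D := by simp only [Matrix.mul_assoc]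
      _ = _ := by rw [h, Matrix.mul_one]; simp only [Matrix.mul_assoc]
  rw [kRhs_eq, kRhs_eq, e1, e2, add_right_comm (of ((v.frame D B).T m)), e0,
    add_right_comm (of (v.T m)), frame_Ric v hC h, frame_H v h, frame_τ v h, frame_T00,
    frame_uZero v h, frame_k, frame_g, frame_ρ]
  simp only [Matrix.mul_add, Matrix.add_mul, Matrix.mul_sub, Matrix.sub_mul, Matrix.mul_smul,
    Matrix.smul_mul]

lemma frame_ERhs (h : D * B = 1) :
    (v.frame D B).ERhs (frameConst D B C) = B *ᵥ v.ERhs C := by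
  have h2 := transpose_mul_transpose_of_inverse h
  have e1 : (v.frame D B).gInv *ᵥ ((trConst (frameConst D B C) ᵥ* (v.frame D B).gInv) ᵥ*
      (v.frame D B).F) = B *ᵥ (v.gInv *ᵥ ((trConst C ᵥ* v.gInv) ᵥ* v.F)) := by
    rw [trConst_frameConst h, frame_gInv v h, frame_F]
    have : trConst C ᵥ* D ᵥ* (B * v.gInv * Bᵀ) ᵥ* (Dᵀ * v.F * D)
        = Dᵀ *ᵥ ((trConst C ᵥ* v.gInv) ᵥ* v.F) := by
      rw [mulVec_transpose]
      simp only [vecMul_vecMul]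
      congr 1
      calc _ = (D * B) * v.gInv * (Bᵀ * Dᵀ) * v.F * D := by simp only [Matrix.mul_assoc]
        _ = _ := by rw [h, h2, Matrix.one_mul, Matrix.mul_one]
    rw [this]
    simp only [mulVec_mulVec]
    congr 1
    rw [Matrix.mul_assoc, h2, Matrix.mul_one]
  have e2 : (fun i => (1 / 2) * trace ((brMat (frameConst D B C) i)ᵀ *
      ((v.frame D B).gInv * (v.frame D B).F * (v.frame D B).gInvᵀ)))
      = B *ᵥ fun i => (1 / 2) * trace ((brMat C i)ᵀ * (v.gInv * v.F * v.gInvᵀ)) := by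
    have e3 : (v.frame D B).gInv * (v.frame D B).F * (v.frame D B).gInvᵀ
        = B * (v.gInv * v.F * v.gInvᵀ) * Bᵀ := by
      rw [frame_F, gInv_mul_frame v h, frame_gInv v h]
      calc _ = B * (v.gInv * v.F) * (D * B) * v.gInvᵀ * Bᵀ := by
            simp only [Matrix.transpose_mul, Matrix.transpose_transpose, Matrix.mul_assoc]
        _ = _ := by rw [h, Matrix.mul_one]; simp only [Matrix.mul_assoc]
    ext i
    rw [e3, brMat_frameConst, Matrix.transpose_sum, Matrix.sum_mul, trace_sum]
    simp only [mulVec, dotProduct, Finset.mul_sum]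
    refine Finset.sum_congr rfl fun c _ => ?_
    rw [Matrix.transpose_smul, Matrix.smul_mul, trace_smul, smul_eq_mul]
    have e4 : trace ((Dᵀ * brMat C c * D)ᵀ * (B * (v.gInv * v.F * v.gInvᵀ) * Bᵀ))
        = trace ((brMat C c)ᵀ * (v.gInv * v.F * v.gInvᵀ)) := by
      calc _ = trace (Dᵀ * ((brMat C c)ᵀ * (D * B) * (v.gInv * v.F * v.gInvᵀ) * Bᵀ)) := by
            simp only [Matrix.transpose_mul, Matrix.transpose_transpose, Matrix.mul_assoc]
        _ = _ := by
            rw [trace_mul_comm, h, Matrix.mul_one, Matrix.mul_assoc, Matrix.mul_assoc, h2,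
              Matrix.mul_one]
    rw [e4]; ring
  rw [ERhs_eq, ERhs_eq, e1, e2, frame_H v h, frame_E, frame_u, frame_e]
  simp only [mulVec_add, mulVec_sub, mulVec_smul]

lemma frame_FRhs (h : D * B = 1) :
    of ((v.frame D B).FRhs (frameConst D B C)) = Dᵀ * of (v.FRhs C) * D := by
  simp only [FRhs_eq, frame_g, frame_E, mulVec_frame h, brMat_frameConst]
  simp only [vecMul, dotProduct]
  rw [sum_mul_sum_of_inverse' h]
  simp only [Matrix.mul_sum, Matrix.sum_mul, Matrix.mul_smul, Matrix.smul_mul]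

lemma frame_uRhs (hC : IsAntisymm C) (h : D * B = 1) :
    (v.frame D B).uRhs (frameConst D B C) = B *ᵥ v.uRhs C := by
  have h2 := transpose_mul_transpose_of_inverse h
  have e1 : ((v.frame D B).gInv * (v.frame D B).k) *ᵥ (B *ᵥ v.u)
      = B *ᵥ ((v.gInv * v.k) *ᵥ v.u) := by
    rw [frame_k, gInv_mul_frame v h]
    simp only [mulVec_mulVec]
    rw [Matrix.mul_assoc, h, Matrix.mul_one]
  have e2 : ∑ j, (B *ᵥ v.u) j • ((v.frame D B).γMat (frameConst D B C) j *ᵥ (B *ᵥ v.u))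
      = B *ᵥ ∑ j, v.u j • (v.γMat C j *ᵥ v.u) := by
    have : ∀ j, (v.frame D B).γMat (frameConst D B C) j *ᵥ (B *ᵥ v.u)
        = ∑ a, D a j • (B *ᵥ (v.γMat C a *ᵥ v.u)) := by
      intro j
      rw [frame_γMat v hC h, sum_mulVec]
      refine Finset.sum_congr rfl fun a _ => ?_
      rw [smul_mulVec]
      simp only [mulVec_mulVec]
      rw [Matrix.mul_assoc (B * _), h, Matrix.mul_one]
    simp only [this]
    have hu : ∀ j, (B *ᵥ v.u) j = ∑ c, B j c * v.u c := fun j => rfl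
    simp only [hu]
    rw [sum_mul_sum_of_inverse h, mulVec_sum]
    simp only [mulVec_smul]
  have e3 : (v.frame D B).gInv *ᵥ ((B *ᵥ v.u) ᵥ* (v.frame D B).F)
      = B *ᵥ (v.gInv *ᵥ (v.u ᵥ* v.F)) := by
    have : (B *ᵥ v.u) ᵥ* (Dᵀ * v.F * D) = Dᵀ *ᵥ (v.u ᵥ* v.F) := by
      rw [← vecMul_transpose, mulVec_transpose]
      simp only [vecMul_vecMul]
      rw [← Matrix.mul_assoc, ← Matrix.mul_assoc, h2, Matrix.one_mul]
    rw [frame_F, this, frame_gInv v h]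
    simp only [mulVec_mulVec]
    rw [Matrix.mul_assoc, h2, Matrix.mul_one]
  rw [uRhs_eq, uRhs_eq, frame_u, e1, e2, e3, frame_uZero v h, frame_e, frame_ρ, frame_E]
  simp only [mulVec_add, mulVec_sub, mulVec_smul]

lemma frame_expansion (h : D * B = 1) :
    (v.frame D B).expansion (frameConst D B C) = v.expansion C := by
  rw [expansion_eq, expansion_eq, frame_u, frame_k, quad_frame h, frame_trConst_dotProduct h,
    frame_uZero v h, frame_H v h]

lemma frame_work (h : D * B = 1) : (v.frame D B).work = v.work := by
  rw [work_eq, work_eq, frame_u, frame_g, frame_E, quad_frame h, frame_uZero v h]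

end Frame

end State

/-- The evolution equations hold for `v` at time `t`, with derivatives taken within `s`. -/
structure EvolvesAt (C : Fin 3 → Fin 3 → Fin 3 → ℝ) (Λ m : ℝ) (v : ℝ → State) (s : Set ℝ)
    (t : ℝ) : Prop where
  g_eq : ∀ i j, HasDerivWithinAt (fun s => (v s).g i j) (-2 * (v t).k i j) s t
  k_eq : ∀ i j, HasDerivWithinAt (fun s => (v s).k i j) ((v t).kRhs C Λ m i j) s t
  E_eq : ∀ i, HasDerivWithinAt (fun s => (v s).E i) ((v t).ERhs C i) s t
  F_eq : ∀ i j, HasDerivWithinAt (fun s => (v s).F i j) ((v t).FRhs C i j) s t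
  u_eq : ∀ i, HasDerivWithinAt (fun s => (v s).u i) ((v t).uRhs C i) s t
  Φ_eq : HasDerivWithinAt (fun s => (v s).Φ) (√(2 * (v t).U)) s t
  U_eq : HasDerivWithinAt (fun s => (v s).U)
    (2 * (v t).H * (v t).U - m ^ 2 * (v t).Φ * √(2 * (v t).U)) s t
  ρ_eq : HasDerivWithinAt (fun s => (v s).ρ)
    (-(v t).expansion C * (v t).ρ + 4 * Real.pi * (v t).e * (v t).work) s t
  e_eq : HasDerivWithinAt (fun s => (v s).e)
    (-(v t).expansion C * (v t).e + 4 * Real.pi * (v t).work * ((v t).e ^ 2 / (v t).ρ)) s t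

lemma hasDerivWithinAt_conj {X : ℝ → Matrix (Fin 3) (Fin 3) ℝ} {X' : Matrix (Fin 3) (Fin 3) ℝ}
    {s : Set ℝ} {t : ℝ} (hX : ∀ i j, HasDerivWithinAt (fun s => X s i j) (X' i j) s t)
    (D : Matrix (Fin 3) (Fin 3) ℝ) (i j : Fin 3) :
    HasDerivWithinAt (fun s => (Dᵀ * X s * D) i j) ((Dᵀ * X' * D) i j) s t := by
  simp only [Matrix.mul_apply]
  exact HasDerivWithinAt.fun_sum fun b _ => (HasDerivWithinAt.fun_sum fun a _ =>
    (hX a b).const_mul _).mul_const _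

lemma hasDerivWithinAt_mulVec {x : ℝ → Fin 3 → ℝ} {x' : Fin 3 → ℝ}
    {s : Set ℝ} {t : ℝ} (hx : ∀ i, HasDerivWithinAt (fun s => x s i) (x' i) s t)
    (B : Matrix (Fin 3) (Fin 3) ℝ) (i : Fin 3) :
    HasDerivWithinAt (fun s => (B *ᵥ x s) i) ((B *ᵥ x') i) s t := by
  simp only [mulVec, dotProduct]
  exact HasDerivWithinAt.fun_sum fun a _ => (hx a).const_mul _

/-- The frame change is constant in time, so it commutes with differentiation. Any tensorial
identity at time `t` may therefore be checked in a frame with `g = 1` at `t`, although `g` varies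
around `t`. -/
lemma EvolvesAt.frame {C : Fin 3 → Fin 3 → Fin 3 → ℝ} {Λ m : ℝ} {v : ℝ → State} {s : Set ℝ}
    {t : ℝ} (hv : EvolvesAt C Λ m v s t) (hC : IsAntisymm C) {D B : Matrix (Fin 3) (Fin 3) ℝ}
    (h : D * B = 1) :
    EvolvesAt (frameConst D B C) Λ m (fun s => (v s).frame D B) s t where
  g_eq i j := by
    have := hasDerivWithinAt_conj (X := fun s => (v s).g) (X' := (-2 : ℝ) • (v t).k)
      (by simpa using hv.g_eq) D i j
    simpa using this
  k_eq i j := by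
    have := hasDerivWithinAt_conj (X := fun s => (v s).k) (X' := of ((v t).kRhs C Λ m))
      (by simpa using hv.k_eq) D i j
    rw [← State.frame_kRhs _ hC h] at this
    simpa using this
  E_eq i := by
    have := hasDerivWithinAt_mulVec hv.E_eq B i
    rw [← State.frame_ERhs _ h] at this
    exact this
  F_eq i j := by
    have := hasDerivWithinAt_conj (X := fun s => (v s).F) (X' := of ((v t).FRhs C))
      (by simpa using hv.F_eq) D i j
    rw [← State.frame_FRhs _ h] at this
    simpa using this
  u_eq i := by
    have := hasDerivWithinAt_mulVec hv.u_eq B i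
    rw [← State.frame_uRhs _ hC h] at this
    exact this
  Φ_eq := hv.Φ_eq
  U_eq := by simpa [State.frame_H _ h] using hv.U_eq
  ρ_eq := by simpa [State.frame_expansion _ h, State.frame_work _ h] using hv.ρ_eq
  e_eq := by simpa [State.frame_expansion _ h, State.frame_work _ h] using hv.e_eq

/-- A positive definite form has an orthonormal frame. -/
lemma exists_orthonormal_frame {g : Matrix (Fin 3) (Fin 3) ℝ} (hg : g.PosDef) :
    ∃ D B : Matrix (Fin 3) (Fin 3) ℝ, D * B = 1 ∧ Dᵀ * g * D = 1 := by
  open scoped MatrixOrder Matrix.Norms.L2Operator in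
  -- A nonnegative matrix factors as `Bᵀ B`; the inverse of `B` is the required frame.
  obtain ⟨B, hB⟩ := CStarAlgebra.nonneg_iff_eq_star_mul_self.mp hg.posSemidef.nonneg
  have hB' : g = Bᵀ * B := by simpa [star_eq_conjTranspose] using hB
  have hdet : IsUnit B.det := by
    have := hg.det_pos
    rw [hB', det_mul, det_transpose] at this
    exact isUnit_iff_ne_zero.mpr fun h => by simp [h] at this
  refine ⟨B⁻¹, B, nonsing_inv_mul B hdet, ?_⟩
  rw [hB', ← Matrix.mul_assoc, ← Matrix.transpose_mul, mul_nonsing_inv B hdet, Matrix.transpose_one,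
    Matrix.one_mul, mul_nonsing_inv B hdet]


/-! ### Jacobi and divergence identities in an orthonormal frame -/

section Components

variable {C : Fin 3 → Fin 3 → Fin 3 → ℝ}

lemma IsAntisymm.diag (hC : IsAntisymm C) (k i : Fin 3) : C k i i = 0 := by
  have := hC k i i; linarith

lemma IsAntisymm.one_zero (hC : IsAntisymm C) (k : Fin 3) : C k 1 0 = -C k 0 1 := hC k 1 0
lemma IsAntisymm.two_one (hC : IsAntisymm C) (k : Fin 3) : C k 2 1 = -C k 1 2 := hC k 2 1
lemma IsAntisymm.zero_two (hC : IsAntisymm C) (k : Fin 3) : C k 0 2 = -C k 2 0 := hC k 0 2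

/-- The cyclic form of the Jacobi identity, in components. -/
lemma IsJacobi.cyclic (hJ : IsJacobi C) (hC : IsAntisymm C) (p : Fin 3) :
    (C 1 0 1 - C 2 2 0) * C p 1 2 + (C 2 1 2 - C 0 0 1) * C p 2 0
      + (C 0 2 0 - C 1 1 2) * C p 0 1 = 0 := by
  -- In dimension three the only Jacobi relation with distinct arguments is, up to order, that of
  -- the three basis vectors.
  have h := congrFun (congrFun (hJ 0 1) p) 2
  simp only [Matrix.sum_apply, Matrix.smul_apply, Matrix.sub_apply, Matrix.mul_apply, adMat,
    of_apply, smul_eq_mul, Fin.sum_univ_three, hC.diag, hC.one_zero, hC.zero_two] at h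
  linarith

/-- The trace form vanishes on brackets. -/
lemma sum_trConst_mul (hC : IsAntisymm C) (hJ : IsJacobi C) (j k : Fin 3) :
    ∑ i, trConst C i * C i j k = 0 := by
  have J := hJ.cyclic hC
  have J0 := J 0
  have J1 := J 1
  have J2 := J 2
  fin_cases j <;> fin_cases k <;>
    simp [trConst, Fin.sum_univ_three, hC.diag, hC.one_zero, hC.two_one, hC.zero_two] <;>
    linarith

end Components

/-- `a_p X_{pj} + C^q_{jl} X_{lq}`, the divergence of a symmetric left invariant tensor with mixed
components `X`. -/
def divOf (C : Fin 3 → Fin 3 → Fin 3 → ℝ) (X : Fin 3 → Fin 3 → ℝ) (j : Fin 3) : ℝ :=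
  ∑ p, trConst C p * X p j + ∑ q, ∑ l, C q j l * X l q

namespace State

variable {v : State} {C : Fin 3 → Fin 3 → Fin 3 → ℝ}

lemma gInv_of_g_eq_one (hg : v.g = 1) : v.gInv = 1 := by simp [gInv, hg]

lemma γ_of_g_eq_one (hg : v.g = 1) (l i j : Fin 3) :
    v.γ C l i j = (1 / 2) * (-C i j l + C j l i + C l i j) := by
  simp only [γ, gInv_of_g_eq_one hg, hg, Matrix.one_apply, ite_mul, one_mul, zero_mul, mul_ite,
    mul_one, mul_zero, Finset.sum_add_distrib, Finset.sum_ite_eq, Finset.mem_univ, if_true]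

/-- Symmetry is not visible in the formula: each off-diagonal difference is one component of the
cyclic Jacobi relation. -/
lemma Ric_symm_of_g_eq_one (hC : IsAntisymm C) (hJ : IsJacobi C) (hg : v.g = 1) (i j : Fin 3) :
    v.Ric C i j = v.Ric C j i := by
  have J := hJ.cyclic hC
  have J0 := J 0
  have J1 := J 1
  have J2 := J 2
  have key : v.Ric C 0 1 = v.Ric C 1 0 ∧ v.Ric C 1 2 = v.Ric C 2 1 ∧ v.Ric C 2 0 = v.Ric C 0 2 := by
    simp only [Ric, γ_of_g_eq_one hg, Fin.sum_univ_three, hC.diag, hC.one_zero, hC.two_one,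
      hC.zero_two]
    refine ⟨?_, ?_, ?_⟩
    · linear_combination J2
    · linear_combination J0
    · linear_combination J1
  obtain ⟨h1, h2, h3⟩ := key
  fin_cases i <;> fin_cases j <;> first | rfl | assumption | (symm; assumption)

/-- Against a symmetric `k` the term `C^j_{pl}` of `γ^p_{lj}` drops out by skewness in `p, l`, and
`γ^p_{ll}` sums to `-C^l_{lp}`. What survives has coefficients independent of the metric, which
makes it easy to differentiate in time. -/
lemma divK_of_g_eq_one (hC : IsAntisymm C) (hg : v.g = 1) (hk : ∀ i j, v.k i j = v.k j i)
    (j : Fin 3) : v.divK C j = divOf C v.k j := by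
  have h10 : v.k 1 0 = v.k 0 1 := hk 1 0
  have h20 : v.k 2 0 = v.k 0 2 := hk 2 0
  have h21 : v.k 2 1 = v.k 1 2 := hk 2 1
  simp only [divK, nablaK, γ_of_g_eq_one hg, gInv_of_g_eq_one hg, Matrix.one_apply, ite_mul,
    one_mul, zero_mul, Finset.sum_ite_eq, Finset.mem_univ, if_true, divOf, trConst]
  fin_cases j <;>
  · simp only [Fin.zero_eta, Fin.mk_one, Fin.reduceFinMk, Fin.sum_univ_three, hC.diag, hC.one_zero,
      hC.two_one, hC.zero_two, h10, h20, h21]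
    ring

/-- The contracted Bianchi identity for a left invariant metric. -/
lemma divOf_Ric_of_g_eq_one (hC : IsAntisymm C) (hJ : IsJacobi C) (hg : v.g = 1) (j : Fin 3) :
    divOf C (v.Ric C) j = 0 := by
  have J := hJ.cyclic hC
  have J0 := J 0
  have J1 := J 1
  have J2 := J 2
  simp only [divOf, trConst, Ric, γ_of_g_eq_one hg]
  fin_cases j <;>
    simp only [Fin.zero_eta, Fin.mk_one, Fin.reduceFinMk, Fin.sum_univ_three, hC.diag, hC.one_zero,
      hC.two_one, hC.zero_two]
  -- Each component is a cubic polynomial in the structure constants lying in the ideal of the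
  -- Jacobi relations; the multipliers are linear.
  · linear_combination -C 0 0 1 * J2 - C 0 1 2 * J0 - C 0 2 0 * J1 - C 1 1 2 * J1 + C 1 2 0 * J0
      + C 2 0 1 * J0 - C 2 1 2 * J2
  · linear_combination C 0 1 2 * J1 - C 0 2 0 * J0 - C 1 0 1 * J2 - C 1 1 2 * J0 - C 1 2 0 * J1
      + C 2 0 1 * J1 - C 2 2 0 * J2
  · linear_combination -C 0 0 1 * J0 + C 0 1 2 * J2 - C 1 0 1 * J1 + C 1 2 0 * J2 - C 2 0 1 * J2
      - C 2 1 2 * J0 - C 2 2 0 * J1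

/-- The source-free part of the divergence of the Maxwell stress tensor. -/
lemma divOf_τ_of_g_eq_one (hC : IsAntisymm C) (hg : v.g = 1) (hF : ∀ i j, v.F i j = -v.F j i)
    (hmag : ∀ i j k, v.magneticDefect C i j k = 0) (j : Fin 3) :
    divOf C v.τ j = ∑ k, (∑ l, trConst C l * v.F l k
        + (1 / 2) * ∑ p, ∑ q, C k p q * v.F p q) * v.F j k
      - ∑ k, ∑ l, v.E k * C l j k * v.E l - (∑ k, trConst C k * v.E k) * v.E j := by
  -- The defect is totally antisymmetric, so in dimension three this component is the whole magnetic
  -- constraint.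
  have M := hmag 0 1 2
  have F00 : v.F 0 0 = 0 := by have := hF 0 0; linarith
  have F11 : v.F 1 1 = 0 := by have := hF 1 1; linarith
  have F22 : v.F 2 2 = 0 := by have := hF 2 2; linarith
  have F10 : v.F 1 0 = -v.F 0 1 := hF 1 0
  have F21 : v.F 2 1 = -v.F 1 2 := hF 2 1
  have F02 : v.F 0 2 = -v.F 2 0 := hF 0 2
  simp only [magneticDefect, Fin.sum_univ_three, F00, F11, F22, F10, F21, F02] at M
  simp only [divOf, trConst, τ, ESq, FSq, hg, gInv_of_g_eq_one hg, Matrix.one_apply]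
  fin_cases j <;>
    simp [Fin.sum_univ_three, hC.diag, hC.one_zero, hC.two_one, hC.zero_two, F00, F11, F22, F10,
      F21, F02]
  · linear_combination -v.F 1 2 * M
  · linear_combination -v.F 2 0 * M
  · linear_combination -v.F 0 1 * M

end State


/-! ### Derivative of the inverse metric, and the divergence of mixed tensors -/

lemma adjugate_fin_three_apply (A : Matrix (Fin 3) (Fin 3) ℝ) (i j : Fin 3) :
    A.adjugate i j = A (j + 1) (i + 1) * A (j + 2) (i + 2) - A (j + 1) (i + 2) * A (j + 2) (i + 1) := by
  -- Addition in `Fin 3` is cyclic, which absorbs the cofactor signs.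
  rw [adjugate_fin_three]
  fin_cases i <;> fin_cases j <;> simp <;> ring

lemma inv_fin_three_apply (A : Matrix (Fin 3) (Fin 3) ℝ) (i j : Fin 3) :
    A⁻¹ i j = (A.det)⁻¹ * A.adjugate i j := by
  rw [Matrix.inv_def, Ring.inverse_eq_inv', Matrix.smul_apply, smul_eq_mul]

/-- The derivative of the inverse of a matrix at the identity. -/
lemma hasDerivWithinAt_inv_of_eq_one {A : ℝ → Matrix (Fin 3) (Fin 3) ℝ}
    {A' : Matrix (Fin 3) (Fin 3) ℝ} {s : Set ℝ} {t : ℝ}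
    (hA : ∀ i j, HasDerivWithinAt (fun s => A s i j) (A' i j) s t) (h1 : A t = 1) (i j : Fin 3) :
    HasDerivWithinAt (fun s => (A s)⁻¹ i j) (-A' i j) s t := by
  have hd : HasDerivWithinAt (fun s => (A s).det) (A' 0 0 + A' 1 1 + A' 2 2) s t := by
    simp only [det_fin_three]
    refine (((((((hA 0 0).fun_mul (hA 1 1)).fun_mul (hA 2 2)).fun_sub
      (((hA 0 0).fun_mul (hA 1 2)).fun_mul (hA 2 1))).fun_sub
      (((hA 0 1).fun_mul (hA 1 0)).fun_mul (hA 2 2))).fun_add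
      (((hA 0 1).fun_mul (hA 1 2)).fun_mul (hA 2 0))).fun_add
      (((hA 0 2).fun_mul (hA 1 0)).fun_mul (hA 2 1)) |>.fun_sub
      (((hA 0 2).fun_mul (hA 1 1)).fun_mul (hA 2 0))).congr_deriv ?_
    simp [h1]
  have hadj : HasDerivWithinAt (fun s => (A s).adjugate i j)
      ((if i = j then A' 0 0 + A' 1 1 + A' 2 2 else 0) - A' i j) s t := by
    simp only [adjugate_fin_three_apply]
    refine (((hA (j + 1) (i + 1)).fun_mul (hA (j + 2) (i + 2))).fun_sub
      ((hA (j + 1) (i + 2)).fun_mul (hA (j + 2) (i + 1)))).congr_deriv ?_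
    rw [h1]
    fin_cases i <;> fin_cases j <;> simp [Matrix.one_apply] <;> ring
  simp only [inv_fin_three_apply]
  have hdt : (A t).det = 1 := by rw [h1, det_one]
  refine ((hd.fun_inv (by rw [hdt]; exact one_ne_zero)).fun_mul hadj).congr_deriv ?_
  rw [hdt, h1, adjugate_one, Matrix.one_apply]
  split_ifs
  · simp only [one_pow, div_one, inv_one]; ring
  · simp

lemma divOf_eq (C : Fin 3 → Fin 3 → Fin 3 → ℝ) (X : Matrix (Fin 3) (Fin 3) ℝ) (j : Fin 3) :
    divOf C X j = (trConst C ᵥ* X) j + trace (adMat C j * X) := by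
  simp only [divOf, vecMul, dotProduct, trace, diag_apply, Matrix.mul_apply, adMat, of_apply]

/-- For mixed components both terms are natural: the trace covector applied to `X`, and the trace of
`ad` composed with `X`. -/
lemma divOf_frame {D B : Matrix (Fin 3) (Fin 3) ℝ} (h : D * B = 1)
    (C : Fin 3 → Fin 3 → Fin 3 → ℝ) (X : Matrix (Fin 3) (Fin 3) ℝ) :
    divOf (frameConst D B C) (B * X * D) = divOf C X ᵥ* D := by
  have h2 : divOf C X = trConst C ᵥ* X + fun j => trace (adMat C j * X) := by
    ext j; exact divOf_eq C X j
  ext j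
  rw [divOf_eq, h2, add_vecMul, trConst_frameConst h, vecMul_vecMul, adMat_frameConst, Pi.add_apply]
  congr 1
  · rw [← Matrix.mul_assoc, ← Matrix.mul_assoc, h, Matrix.one_mul, vecMul_vecMul]
  · rw [Matrix.sum_mul, trace_sum]
    simp only [vecMul, dotProduct]
    refine Finset.sum_congr rfl fun a _ => ?_
    rw [Matrix.smul_mul, trace_smul, smul_eq_mul, mul_comm]
    congr 1
    calc trace (B * adMat C a * D * (B * X * D)) = trace (B * (adMat C a * (D * B) * X) * D) := by
          simp only [Matrix.mul_assoc]
      _ = _ := by rw [h, State.trace_frame h, Matrix.mul_one]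

section Linear

variable (C : Fin 3 → Fin 3 → Fin 3 → ℝ) (X Y : Fin 3 → Fin 3 → ℝ)

lemma divOf_add (j : Fin 3) : divOf C (fun a b => X a b + Y a b) j = divOf C X j + divOf C Y j := by
  simp only [divOf, mul_add, Finset.sum_add_distrib]; ring

lemma divOf_smul (c : ℝ) (j : Fin 3) : divOf C (fun a b => c * X a b) j = c * divOf C X j := by
  simp only [divOf, mul_add, Finset.mul_sum]
  congr 1
  · exact Finset.sum_congr rfl fun _ _ => by ring
  · exact Finset.sum_congr rfl fun _ _ => Finset.sum_congr rfl fun _ _ => by ring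

/-- The two terms are `C^i_{ij}` and `C^q_{jq}`, which cancel by antisymmetry. Consequently the
multiples of the metric in the equation for `k` do not affect the momentum constraint. -/
lemma divOf_one {C : Fin 3 → Fin 3 → Fin 3 → ℝ} (hC : IsAntisymm C) (j : Fin 3) :
    divOf C (1 : Matrix (Fin 3) (Fin 3) ℝ) j = 0 := by
  simp only [divOf, Matrix.one_apply, mul_ite, mul_one, mul_zero, Finset.sum_ite_eq',
    Finset.mem_univ, if_true, trConst]
  rw [Finset.sum_congr rfl fun q _ => hC q j q]
  simp

end Linear

namespace State

lemma frame_of_posDef (v : State) (hg : v.g.PosDef) :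
    ∃ D B : Matrix (Fin 3) (Fin 3) ℝ, D * B = 1 ∧ (v.frame D B).g = 1 :=
  exists_orthonormal_frame hg

lemma frame_k_symm {v : State} (hk : ∀ i j, v.k i j = v.k j i) (D B : Matrix (Fin 3) (Fin 3) ℝ)
    (i j : Fin 3) : (v.frame D B).k i j = (v.frame D B).k j i := by
  have h : v.kᵀ = v.k := by ext i j; exact hk j i
  have : (v.frame D B).kᵀ = (v.frame D B).k := by
    simp only [frame_k, Matrix.transpose_mul, Matrix.transpose_transpose, h, Matrix.mul_assoc]
  exact (congrFun (congrFun this j) i)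

lemma frame_F_antisymm {v : State} (hF : ∀ i j, v.F i j = -v.F j i)
    (D B : Matrix (Fin 3) (Fin 3) ℝ) (i j : Fin 3) :
    (v.frame D B).F i j = -(v.frame D B).F j i := by
  have h : v.Fᵀ = -v.F := by ext i j; exact hF j i
  have : (v.frame D B).Fᵀ = -(v.frame D B).F := by
    simp only [frame_F, Matrix.transpose_mul, Matrix.transpose_transpose, h, Matrix.mul_assoc,
      Matrix.mul_neg, Matrix.neg_mul]
  exact (congrFun (congrFun this j) i)

lemma eq_zero_of_vecMul_eq_zero {D B : Matrix (Fin 3) (Fin 3) ℝ} (h : D * B = 1) {x : Fin 3 → ℝ}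
    (hx : x ᵥ* D = 0) : x = 0 := by
  have : (x ᵥ* D) ᵥ* B = x := by rw [vecMul_vecMul, h, vecMul_one]
  rw [← this, hx, zero_vecMul]

lemma vecMul_injective_of_inverse {D B : Matrix (Fin 3) (Fin 3) ℝ} (h : D * B = 1)
    {x y : Fin 3 → ℝ} (hxy : x ᵥ* D = y ᵥ* D) : x = y := by
  have := eq_zero_of_vecMul_eq_zero h (x := x - y) (by rw [sub_vecMul, hxy, sub_self])
  exact sub_eq_zero.mp this

/-- The divergence of the second fundamental form in terms of its mixed components. -/
lemma divK_eq_divOf {v : State} {C : Fin 3 → Fin 3 → Fin 3 → ℝ} (hC : IsAntisymm C)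
    (hg : v.g.PosDef) (hk : ∀ i j, v.k i j = v.k j i) : v.divK C = divOf C v.kMixed := by
  obtain ⟨D, B, h, h1⟩ := v.frame_of_posDef hg
  apply vecMul_injective_of_inverse h
  have e : (v.kMixed : Fin 3 → Fin 3 → ℝ) = (v.gInv * v.k : Matrix (Fin 3) (Fin 3) ℝ) := by
    ext i j; exact v.kMixed_eq i j
  rw [← frame_divK v hC h, e, ← divOf_frame h, ← gInv_mul_frame v h, ← frame_k,
    gInv_of_g_eq_one h1, Matrix.one_mul]
  ext j
  exact divK_of_g_eq_one (hC.frameConst D B) h1 (frame_k_symm hk D B) j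

lemma Ric_symm {v : State} {C : Fin 3 → Fin 3 → Fin 3 → ℝ} (hC : IsAntisymm C) (hJ : IsJacobi C)
    (hg : v.g.PosDef) (i j : Fin 3) : v.Ric C i j = v.Ric C j i := by
  obtain ⟨D, B, h, h1⟩ := v.frame_of_posDef hg
  have h' : B * D = 1 := mul_eq_one_comm.mp h
  have e : (of ((v.frame D B).Ric (frameConst D B C)))ᵀ
      = of ((v.frame D B).Ric (frameConst D B C)) := by
    ext a b
    exact Ric_symm_of_g_eq_one (hC.frameConst D B) (hJ.frameConst h) h1 b a
  rw [frame_Ric v hC h] at e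
  have e2 : Bᵀ * (Dᵀ * of (v.Ric C) * D)ᵀ * B = Bᵀ * (Dᵀ * of (v.Ric C) * D) * B := by rw [e]
  have e3 : (of (v.Ric C))ᵀ = of (v.Ric C) := by
    have h2 := transpose_mul_transpose_of_inverse h
    calc (of (v.Ric C))ᵀ = (Bᵀ * Dᵀ) * (of (v.Ric C))ᵀ * (D * B) := by simp [h, h2]
      _ = Bᵀ * (Dᵀ * of (v.Ric C) * D)ᵀ * B := by
          simp only [Matrix.transpose_mul, Matrix.transpose_transpose, Matrix.mul_assoc]
      _ = (Bᵀ * Dᵀ) * of (v.Ric C) * (D * B) := by rw [e2]; simp only [Matrix.mul_assoc]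
      _ = of (v.Ric C) := by simp [h, h2]
  exact congrFun (congrFun e3 j) i

/-- Symmetry of `k` is compatible with the flow; the identification of curves in unsymmetrized
coordinates with solutions rests on this. -/
lemma kRhs_symm {v : State} {C : Fin 3 → Fin 3 → Fin 3 → ℝ} (hC : IsAntisymm C) (hJ : IsJacobi C)
    (hg : v.g.PosDef) (hk : ∀ i j, v.k i j = v.k j i) (Λ m : ℝ) (i j : Fin 3) :
    v.kRhs C Λ m i j = v.kRhs C Λ m j i := by
  have hgs : v.gᵀ = v.g := by simpa using hg.isHermitian.eq
  have hGs : v.gInvᵀ = v.gInv := by rw [gInv, Matrix.transpose_nonsing_inv, hgs]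
  have hks : v.kᵀ = v.k := by ext i j; exact hk j i
  have hR : (of (v.Ric C))ᵀ = of (v.Ric C) := by ext i j; exact Ric_symm hC hJ hg j i
  have hT : (of (v.T m))ᵀ = of (v.T m) := by
    ext a b
    have : v.g b a = v.g a b := congrFun (congrFun hgs a) b
    simp [T, this]
  have hτ : (of v.τ)ᵀ = of v.τ := by
    rw [τ_eq]
    simp only [Matrix.transpose_add, Matrix.transpose_sub, Matrix.transpose_smul,
      Matrix.transpose_mul, Matrix.transpose_transpose, hgs, hGs, Matrix.mul_assoc,
      transpose_vecMulVec]
  have : (of (v.kRhs C Λ m))ᵀ = of (v.kRhs C Λ m) := by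
    rw [kRhs_eq]
    simp only [Matrix.transpose_add, Matrix.transpose_sub, Matrix.transpose_smul,
      Matrix.transpose_mul, hgs, hGs, hR, hks, hT, hτ,
      Matrix.mul_assoc, transpose_vecMulVec]
  exact congrFun (congrFun this j) i

end State


/-! ### The equations in an orthonormal frame; energy, particle and charge balance -/

namespace State

variable (v : State) {C : Fin 3 → Fin 3 → Fin 3 → ℝ}

lemma uZero_sq (hg : v.g.PosDef) : v.uZero ^ 2 = 1 + v.u ⬝ᵥ v.g *ᵥ v.u := by
  have h : 0 ≤ v.u ⬝ᵥ v.g *ᵥ v.u := by simpa using hg.posSemidef.dotProduct_mulVec_nonneg v.u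
  rw [uZero, quad_eq, Real.sq_sqrt (by linarith)]

lemma one_le_uZero (hg : v.g.PosDef) : 1 ≤ v.uZero := by
  have h : 0 ≤ v.u ⬝ᵥ v.g *ᵥ v.u := by simpa using hg.posSemidef.dotProduct_mulVec_nonneg v.u
  rw [uZero, quad_eq, Real.one_le_sqrt]
  linarith

lemma uZero_pos (hg : v.g.PosDef) : 0 < v.uZero := zero_lt_one.trans_le (v.one_le_uZero hg)

variable {v}

section Orthonormal

variable (hg : v.g = 1)
include hg

lemma H_of_g_eq_one : v.H = ∑ i, v.k i i := by
  simp [H, gInv_of_g_eq_one hg, Matrix.one_apply]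

lemma uLow_of_g_eq_one : v.uLow = v.u := by
  rw [uLow_eq, hg, one_mulVec]

lemma ESq_of_g_eq_one : v.ESq = ∑ i, v.E i ^ 2 := by
  simp [ESq, hg, Matrix.one_apply, pow_two]

lemma kSq_of_g_eq_one : v.kSq = ∑ i, ∑ j, v.k i j ^ 2 := by
  simp [kSq, gInv_of_g_eq_one hg, Matrix.one_apply, pow_two]

lemma FSq_of_g_eq_one : v.FSq = ∑ i, ∑ j, v.F i j ^ 2 := by
  simp [FSq, gInv_of_g_eq_one hg, Matrix.one_apply, pow_two]

lemma uZero_sq_of_g_eq_one : v.uZero ^ 2 = 1 + ∑ i, v.u i ^ 2 := by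
  rw [uZero_sq v (by rw [hg]; exact Matrix.PosDef.one), hg, one_mulVec]
  simp [dotProduct, pow_two]

/-- The kinetic energy `U` cancels between `T_{ij}` and the trace term, and the dust trace leaves
`-ρ` because `(u⁰)² - |u|² = 1`. Only the potential and `ρ` remain in front of the metric. -/
lemma kRhs_of_g_eq_one (Λ m : ℝ) (i j : Fin 3) : v.kRhs C Λ m i j =
    v.Ric C i j + v.H * v.k i j - 2 * ∑ l, v.k l j * v.k i l
      - 8 * Real.pi * (v.τ i j + v.ρ * v.u i * v.u j)
      - (4 * Real.pi * (m ^ 2 * v.Φ ^ 2 + v.ρ) + Λ) * (1 : Matrix (Fin 3) (Fin 3) ℝ) i j := by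
  have h1 : ∑ l, ∑ p, v.gInv l p * (v.T m l p + v.ρ * v.uLow l * v.uLow p)
      = 3 * (2 * v.U - m ^ 2 * v.Φ ^ 2) / 2 + v.ρ * (v.uZero ^ 2 - 1) := by
    rw [uZero_sq_of_g_eq_one hg]
    simp only [gInv_of_g_eq_one hg, Matrix.one_apply, T, hg, uLow_of_g_eq_one hg, ite_mul, one_mul,
      zero_mul, Finset.sum_ite_eq, Finset.mem_univ, if_true, Fin.sum_univ_three]
    ring
  rw [kRhs, h1]
  simp only [kMixed, gInv_of_g_eq_one hg, T, T00, hg, uLow_of_g_eq_one hg, Matrix.one_apply,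
    ite_mul, one_mul, zero_mul, Finset.sum_ite_eq, Finset.mem_univ, if_true]
  split_ifs <;> ring

lemma ERhs_of_g_eq_one (i : Fin 3) : v.ERhs C i = v.H * v.E i
    - (∑ l, trConst C l * v.F l i + (1 / 2) * ∑ p, ∑ q, C i p q * v.F p q)
    + 4 * Real.pi * v.e * v.u i := by
  rw [ERhs_eq, gInv_of_g_eq_one hg]
  simp only [one_mulVec, vecMul_one, Matrix.one_mul, Matrix.transpose_one, Matrix.mul_one,
    Pi.add_apply, Pi.sub_apply, Pi.smul_apply, smul_eq_mul, vecMul, dotProduct, trace, diag_apply,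
    Matrix.mul_apply, transpose_apply, brMat, of_apply]
  congr 4
  exact Finset.sum_comm

lemma FRhs_of_g_eq_one (i j : Fin 3) : v.FRhs C i j = ∑ k, C k i j * v.E k := by
  simp only [FRhs, hg, Matrix.one_apply, mul_ite, mul_one, mul_zero, ite_mul, zero_mul,
    Finset.sum_ite_eq, Finset.mem_univ, if_true]

/-- Contracting with the symmetric `u^j u^k` removes `C^i_{jk}` and makes the other two terms of `γ`
equal. -/
lemma sum_γ_of_g_eq_one (hC : IsAntisymm C) (i : Fin 3) :
    ∑ j, ∑ k, v.γ C i j k * v.u j * v.u k = ∑ j, ∑ k, C k i j * v.u j * v.u k := by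
  simp only [γ_of_g_eq_one hg]
  fin_cases i <;>
  · simp only [Fin.zero_eta, Fin.mk_one, Fin.reduceFinMk, Fin.sum_univ_three, hC.diag, hC.one_zero,
      hC.two_one, hC.zero_two]
    ring

lemma uRhs_of_g_eq_one (hC : IsAntisymm C) (i : Fin 3) : v.uRhs C i =
    2 * (∑ j, v.k i j * v.u j) - (∑ j, ∑ k, C k i j * v.u j * v.u k) / v.uZero
      - 4 * Real.pi * (v.e / v.ρ) * v.E i
      + 4 * Real.pi * (v.e / v.ρ) * (∑ j, v.F j i * v.u j) / v.uZero := by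
  rw [uRhs, sum_γ_of_g_eq_one hg hC]
  simp only [kMixed, gInv_of_g_eq_one hg, Matrix.one_apply, ite_mul, one_mul, zero_mul,
    Finset.sum_ite_eq, Finset.mem_univ, if_true]

/-- The Lorentz force and the connection do no work in the rest frame of the slicing. -/
lemma sum_u_mul_uRhs_of_g_eq_one (hC : IsAntisymm C) (hF : ∀ i j, v.F i j = -v.F j i) :
    ∑ i, v.u i * v.uRhs C i = 2 * (∑ i, ∑ j, v.k i j * v.u i * v.u j)
      - 4 * Real.pi * (v.e / v.ρ) * ∑ i, v.u i * v.E i := by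
  have F00 : v.F 0 0 = 0 := by have := hF 0 0; linarith
  have F11 : v.F 1 1 = 0 := by have := hF 1 1; linarith
  have F22 : v.F 2 2 = 0 := by have := hF 2 2; linarith
  have F10 : v.F 1 0 = -v.F 0 1 := hF 1 0
  have F21 : v.F 2 1 = -v.F 1 2 := hF 2 1
  have F02 : v.F 0 2 = -v.F 2 0 := hF 0 2
  simp only [uRhs_of_g_eq_one hg hC, Fin.sum_univ_three, F00, F11, F22, F10, F21, F02, hC.diag,
    hC.one_zero, hC.two_one, hC.zero_two]
  ring

end Orthonormal

end State

namespace EvolvesAt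

variable {C : Fin 3 → Fin 3 → Fin 3 → ℝ} {Λ m : ℝ} {v : ℝ → State} {s : Set ℝ} {t : ℝ}

/-- The velocity equation contributes `4 k(u,u)`, the metric takes back `2 k(u,u)`, and the
connection and magnetic forces do no work. Only `k` and the electric field change the energy of a
particle. -/
lemma uQuad (hv : EvolvesAt C Λ m v s t) (hC : IsAntisymm C) (hg : (v t).g.PosDef)
    (hF : ∀ i j, (v t).F i j = -(v t).F j i) :
    HasDerivWithinAt (fun s => 1 + (v s).u ⬝ᵥ (v s).g *ᵥ (v s).u)
      (2 * ((v t).u ⬝ᵥ (v t).k *ᵥ (v t).u)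
        - 8 * Real.pi * ((v t).e / (v t).ρ) * ((v t).u ⬝ᵥ (v t).g *ᵥ (v t).E)) s t := by
  obtain ⟨D, B, h, h1⟩ := (v t).frame_of_posDef hg
  have hw := hv.frame hC h
  have hC' := hC.frameConst D B
  have hF' := State.frame_F_antisymm hF D B
  have key := State.sum_u_mul_uRhs_of_g_eq_one h1 hC' hF'
  have e : ∀ s, (v s).u ⬝ᵥ (v s).g *ᵥ (v s).u
      = ∑ i, ∑ j, ((v s).frame D B).g i j * ((v s).frame D B).u i * ((v s).frame D B).u j := by
    intro s
    rw [State.quad_eq, State.frame_g, State.frame_u, State.quad_frame h]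
  simp only [e]
  refine ((HasDerivWithinAt.fun_sum fun i _ => HasDerivWithinAt.fun_sum fun j _ =>
    ((hw.g_eq i j).fun_mul (hw.u_eq i)).fun_mul (hw.u_eq j)).const_add 1).congr_deriv ?_
  rw [← State.quad_frame h (v t).k, ← State.quad_frame h (v t).g, ← State.frame_k (v t) (B := B),
    ← State.frame_g (v t) (B := B), h1, one_mulVec, ← State.frame_u (v t) (D := D),
    ← State.frame_E (v t) (D := D), ← State.quad_eq, dotProduct]
  rw [← State.frame_e (v t) (D := D) (B := B), ← State.frame_ρ (v t) (D := D) (B := B)]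
  -- The force enters only through its product with `u`, so its expression is kept opaque.
  generalize hr : ((v t).frame D B).uRhs (frameConst D B C) = r at key ⊢
  simp only [Matrix.one_apply, Fin.sum_univ_three] at key ⊢
  simp only [if_true, Fin.reduceEq, if_false, Fin.isValue]
  linear_combination 2 * key

lemma uZero (hv : EvolvesAt C Λ m v s t) (hC : IsAntisymm C) (hg : (v t).g.PosDef)
    (hF : ∀ i j, (v t).F i j = -(v t).F j i) :
    HasDerivWithinAt (fun s => (v s).uZero)
      (((v t).u ⬝ᵥ (v t).k *ᵥ (v t).u
        - 4 * Real.pi * ((v t).e / (v t).ρ) * ((v t).u ⬝ᵥ (v t).g *ᵥ (v t).E)) / (v t).uZero) s t := by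
  have h0 : 1 + (v t).u ⬝ᵥ (v t).g *ᵥ (v t).u ≠ 0 := by
    rw [← State.uZero_sq _ hg]
    exact pow_ne_zero 2 (State.uZero_pos _ hg).ne'
  have e : ∀ s, (v s).uZero = √(1 + (v s).u ⬝ᵥ (v s).g *ᵥ (v s).u) := fun s => by
    rw [State.uZero, State.quad_eq]
  simp only [e]
  refine ((hv.uQuad hC hg hF).sqrt h0).congr_deriv ?_
  ring

/-- Conservation of the number of particles. -/
lemma ρ_mul_uZero (hv : EvolvesAt C Λ m v s t) (hC : IsAntisymm C) (hg : (v t).g.PosDef)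
    (hF : ∀ i j, (v t).F i j = -(v t).F j i) (hρ : 0 < (v t).ρ) :
    HasDerivWithinAt (fun s => (v s).ρ * (v s).uZero)
      ((v t).H * ((v t).ρ * (v t).uZero) - (v t).ρ * (trConst C ⬝ᵥ (v t).u)) s t := by
  refine (hv.ρ_eq.fun_mul (hv.uZero hC hg hF)).congr_deriv ?_
  have h0 := (State.uZero_pos _ hg).ne'
  rw [State.expansion_eq, State.work_eq]
  field_simp
  ring

/-- Conservation of charge. -/
lemma e_mul_uZero (hv : EvolvesAt C Λ m v s t) (hC : IsAntisymm C) (hg : (v t).g.PosDef)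
    (hF : ∀ i j, (v t).F i j = -(v t).F j i) (hρ : 0 < (v t).ρ) :
    HasDerivWithinAt (fun s => (v s).e * (v s).uZero)
      ((v t).H * ((v t).e * (v t).uZero) - (v t).e * (trConst C ⬝ᵥ (v t).u)) s t := by
  refine (hv.e_eq.fun_mul (hv.uZero hC hg hF)).congr_deriv ?_
  have h0 := (State.uZero_pos _ hg).ne'
  rw [State.expansion_eq, State.work_eq]
  field_simp
  ring

/-- The ratio of charge to mass is constant. -/
lemma e_div_ρ (hv : EvolvesAt C Λ m v s t) (hρ : 0 < (v t).ρ) :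
    HasDerivWithinAt (fun s => (v s).e / (v s).ρ) 0 s t := by
  refine (hv.e_eq.fun_div hv.ρ_eq hρ.ne').congr_deriv ?_
  field_simp
  ring

/-- The field `F` changes by the differential of the covector dual to `E`, and the square of the
differential is zero: that is the Jacobi identity, stated as `key` below. -/
lemma magneticDefect (hv : EvolvesAt C Λ m v s t) (hC : IsAntisymm C) (hJ : IsJacobi C)
    (i j k : Fin 3) : HasDerivWithinAt (fun s => (v s).magneticDefect C i j k) 0 s t := by
  have h : ∀ a b c d : Fin 3, HasDerivWithinAt (fun s => C a b c * (v s).F d a)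
      (C a b c * ∑ l, C l d a * ((v t).g *ᵥ (v t).E) l) s t := by
    intro a b c d
    refine ((hv.F_eq d a).const_mul _).congr_deriv ?_
    have : (v t).FRhs C d a = of ((v t).FRhs C) d a := rfl
    rw [this, State.FRhs_eq]
    simp only [Matrix.sum_apply, Matrix.smul_apply, smul_eq_mul, brMat, of_apply, mul_comm]
  refine (HasDerivWithinAt.fun_sum fun l _ =>
    ((h l i j k).fun_add (h l k i j)).fun_add (h l j k i)).congr_deriv ?_
  generalize (v t).g *ᵥ (v t).E = x
  have J := hJ.cyclic hC
  have J0 := J 0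
  have J1 := J 1
  have J2 := J 2
  have key : ∀ l, ∑ a, (C a i j * C l k a + C a k i * C l j a + C a j k * C l i a) = 0 := by
    intro l
    have J := hJ.cyclic hC l
    fin_cases i <;> fin_cases j <;> fin_cases k <;>
      simp only [Fin.zero_eta, Fin.mk_one, Fin.reduceFinMk, Fin.sum_univ_three, hC.diag,
        hC.one_zero, hC.two_one, hC.zero_two] <;> linarith
  have k0 := key 0
  have k1 := key 1
  have k2 := key 2
  simp only [Fin.sum_univ_three] at k0 k1 k2 ⊢
  linear_combination x 0 * k0 + x 1 * k1 + x 2 * k2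

/-- The `2 kSq` coming from the derivative of the inverse metric cancels the quadratic term of the
`k` equation, and the Maxwell stress has trace `τ00`. The Hamiltonian constraint is not used here;
it serves later to eliminate `R`. -/
lemma H (hv : EvolvesAt C Λ m v s t) (hC : IsAntisymm C) (hg : (v t).g.PosDef)
    (hk : ∀ i j, (v t).k i j = (v t).k j i) :
    HasDerivWithinAt (fun s => (v s).H)
      ((v t).R C + (v t).H ^ 2 - 8 * Real.pi * ((v t).τ00 + (v t).ρ * ((v t).uZero ^ 2 - 1))
        - 3 * (4 * Real.pi * (m ^ 2 * (v t).Φ ^ 2 + (v t).ρ) + Λ)) s t := by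
  obtain ⟨D, B, h, h1⟩ := (v t).frame_of_posDef hg
  have hw := hv.frame hC h
  have hk' := State.frame_k_symm hk D B
  have e : ∀ s, (v s).H = ((v s).frame D B).H := fun s => (State.frame_H _ h).symm
  simp only [e, ← State.frame_R (v t) hC h, ← State.frame_τ00 (v t) h, ← State.frame_uZero (v t) h]
  rw [← State.frame_ρ (v t) (D := D) (B := B), ← State.frame_Φ (v t) (D := D) (B := B)]
  have hG := hasDerivWithinAt_inv_of_eq_one (A := fun s => ((v s).frame D B).g)
    (A' := (-2 : ℝ) • ((v t).frame D B).k) (by simpa using hw.g_eq) h1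
  unfold State.H
  refine (HasDerivWithinAt.fun_sum fun i _ => HasDerivWithinAt.fun_sum fun j _ =>
    (hG i j).fun_mul (hw.k_eq i j)).congr_deriv ?_
  generalize ((v t).frame D B) = w at *
  have hH : ∑ i, ∑ j, w.gInv i j * w.k i j = w.H := rfl
  rw [hH, h1]
  simp only [State.kRhs_of_g_eq_one h1, State.R, State.gInv_of_g_eq_one h1, State.τ00, State.τ,
    State.ESq_of_g_eq_one h1, State.FSq_of_g_eq_one h1, State.uZero_sq_of_g_eq_one h1, h1, inv_one,
    Matrix.one_apply, Matrix.smul_apply, smul_eq_mul]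
  rw [State.H_of_g_eq_one h1]
  have h10 : w.k 1 0 = w.k 0 1 := hk' 1 0
  have h20 : w.k 2 0 = w.k 0 2 := hk' 2 0
  have h21 : w.k 2 1 = w.k 1 2 := hk' 2 1
  simp only [ite_mul, one_mul, zero_mul, Finset.sum_ite_eq, Finset.mem_univ, if_true,
    Finset.sum_add_distrib]
  simp only [Fin.sum_univ_three, h10, h20, h21]
  ring

end EvolvesAt


/-! ### Propagation of the constraints -/

lemma State.frame_g_posDef {v : State} (hg : v.g.PosDef) {D B : Matrix (Fin 3) (Fin 3) ℝ}
    (h : D * B = 1) : (v.frame D B).g.PosDef := by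
  have h' : B * D = 1 := mul_eq_one_comm.mp h
  have hinj : Function.Injective D.mulVec := by
    intro x y hxy
    have := congrArg (B *ᵥ ·) hxy
    simpa [mulVec_mulVec, h'] using this
  simpa using hg.conjTranspose_mul_mul_same hinj

/-- The derivative of `γ^l_{ij}` in an orthonormal frame, when the metric changes at the
rate `-2 k`. -/
def γDot (C : Fin 3 → Fin 3 → Fin 3 → ℝ) (k : Fin 3 → Fin 3 → ℝ) (l i j : Fin 3) : ℝ :=
  ∑ b, k l b * (-C i j b + C j b i + C b i j)
    - ∑ p, (-C p j l * k i p + C p l i * k j p + C p i j * k l p)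

/-- The trace of the linearized Ricci tensor is a divergence. -/
lemma trace_Ric_dot {C : Fin 3 → Fin 3 → Fin 3 → ℝ} (hC : IsAntisymm C) {k : Fin 3 → Fin 3 → ℝ}
    (hk : ∀ i j, k i j = k j i) {γ : Fin 3 → Fin 3 → Fin 3 → ℝ}
    (hγ : ∀ l i j, γ l i j = (1 / 2) * (-C i j l + C j l i + C l i j)) :
    ∑ i, ∑ l, ∑ p, (γDot C k l l p * γ p i i + γ l l p * γDot C k p i i
      - (γDot C k p i l * γ l p i + γ p i l * γDot C k l p i) - C l p i * γDot C k p l i)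
      = -2 * ∑ j, trConst C j * divOf C k j := by
  have h10 : k 1 0 = k 0 1 := hk 1 0
  have h20 : k 2 0 = k 0 2 := hk 2 0
  have h21 : k 2 1 = k 1 2 := hk 2 1
  have e : ∀ l i j, γDot C k l i j = k l 0 * (-C i j 0 + C j 0 i + C 0 i j)
      + k l 1 * (-C i j 1 + C j 1 i + C 1 i j) + k l 2 * (-C i j 2 + C j 2 i + C 2 i j)
      - (-C 0 j l * k i 0 + C 0 l i * k j 0 + C 0 i j * k l 0)
      - (-C 1 j l * k i 1 + C 1 l i * k j 1 + C 1 i j * k l 1)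
      - (-C 2 j l * k i 2 + C 2 l i * k j 2 + C 2 i j * k l 2) := by
    intro l i j
    simp only [γDot, Fin.sum_univ_three]; ring
  simp only [e, hγ, divOf, trConst, Fin.sum_univ_three, hC.diag, hC.one_zero, hC.two_one,
    hC.zero_two, h10, h20, h21]
  ring

lemma hasDerivWithinAt_divOf (C : Fin 3 → Fin 3 → Fin 3 → ℝ) {X : ℝ → Fin 3 → Fin 3 → ℝ}
    {X' : Fin 3 → Fin 3 → ℝ} {s : Set ℝ} {t : ℝ}
    (hX : ∀ i j, HasDerivWithinAt (fun s => X s i j) (X' i j) s t) (j : Fin 3) :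
    HasDerivWithinAt (fun s => divOf C (X s) j) (divOf C X' j) s t :=
  (HasDerivWithinAt.fun_sum fun p _ => (hX p j).const_mul (trConst C p)).fun_add
    (HasDerivWithinAt.fun_sum fun q _ => HasDerivWithinAt.fun_sum fun l _ =>
      (hX l q).const_mul (C q j l))

namespace EvolvesAt

variable {C : Fin 3 → Fin 3 → Fin 3 → ℝ} {Λ m : ℝ} {v : ℝ → State} {s : Set ℝ} {t : ℝ}

/-- Contracting the `E` equation with the trace covector `a` kills `a_i a_l F_{li}` by skewness and
`a_i C^i_{pq}` by Jacobi. The current that is left cancels the one in the conservation of charge. -/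
lemma gaussDefect (hv : EvolvesAt C Λ m v s t) (hC : IsAntisymm C) (hJ : IsJacobi C)
    (hg : (v t).g.PosDef) (hF : ∀ i j, (v t).F i j = -(v t).F j i) (hρ : 0 < (v t).ρ) :
    HasDerivWithinAt (fun s => (v s).gaussDefect C) ((v t).H * (v t).gaussDefect C) s t := by
  obtain ⟨D, B, h, h1⟩ := (v t).frame_of_posDef hg
  have hw := hv.frame hC h
  have hC' := hC.frameConst D B
  have hJ' := hJ.frameConst h
  have hF' := State.frame_F_antisymm hF D B
  have hq := hw.e_mul_uZero hC' (State.frame_g_posDef hg h) hF' hρ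
  have e : ∀ s, (v s).gaussDefect C = ∑ k, trConst (frameConst D B C) k * ((v s).frame D B).E k
      + 4 * Real.pi * (((v s).frame D B).e * ((v s).frame D B).uZero) := by
    intro s
    rw [← State.frame_gaussDefect _ h, State.gaussDefect, sum_sum_trConst, dotProduct]
    ring
  simp only [e, ← State.frame_H (v t) h]
  refine ((HasDerivWithinAt.fun_sum fun k _ => (hw.E_eq k).const_mul _).fun_add
    (hq.const_mul (4 * Real.pi))).congr_deriv ?_
  generalize ((v t).frame D B) = w at *
  generalize frameConst D B C = C at *
  have k1 : ∑ i, trConst C i * (∑ l, trConst C l * w.F l i) = 0 := by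
    have F00 : w.F 0 0 = 0 := by have := hF' 0 0; linarith
    have F11 : w.F 1 1 = 0 := by have := hF' 1 1; linarith
    have F22 : w.F 2 2 = 0 := by have := hF' 2 2; linarith
    have F10 : w.F 1 0 = -w.F 0 1 := hF' 1 0
    have F21 : w.F 2 1 = -w.F 1 2 := hF' 2 1
    have F02 : w.F 0 2 = -w.F 2 0 := hF' 0 2
    simp only [Fin.sum_univ_three, F00, F11, F22, F10, F21, F02]
    ring
  have k2 : ∑ i, trConst C i * (∑ p, ∑ q, C i p q * w.F p q) = 0 := by
    simp only [Finset.mul_sum]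
    rw [Finset.sum_comm]
    refine Finset.sum_eq_zero fun p _ => ?_
    rw [Finset.sum_comm]
    refine Finset.sum_eq_zero fun q _ => ?_
    simp only [← mul_assoc, ← Finset.sum_mul, sum_trConst_mul hC' hJ', zero_mul]
  have k3 : ∑ i, trConst C i * w.ERhs C i = w.H * ∑ i, trConst C i * w.E i
      - ∑ i, trConst C i * (∑ l, trConst C l * w.F l i)
      - (1 / 2) * ∑ i, trConst C i * (∑ p, ∑ q, C i p q * w.F p q)
      + 4 * Real.pi * w.e * ∑ i, trConst C i * w.u i := by
    simp only [State.ERhs_of_g_eq_one h1]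
    rw [Finset.mul_sum, Finset.mul_sum, Finset.mul_sum, ← Finset.sum_sub_distrib,
      ← Finset.sum_sub_distrib, ← Finset.sum_add_distrib]
    exact Finset.sum_congr rfl fun i _ => by ring
  rw [k3, k1, k2, dotProduct]
  ring

/-- The evolution of the mixed components of the second fundamental form. -/
lemma kMixed_of_g_eq_one (hv : EvolvesAt C Λ m v s t) (hg : (v t).g = 1)
    (i j : Fin 3) :
    HasDerivWithinAt (fun s => (v s).kMixed i j)
      ((v t).Ric C i j + (v t).H * (v t).k i j
        + (-8 * Real.pi) * ((v t).τ i j + (v t).ρ * ((v t).u i * (v t).u j))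
        + (-(4 * Real.pi * (m ^ 2 * (v t).Φ ^ 2 + (v t).ρ) + Λ))
          * (1 : Matrix (Fin 3) (Fin 3) ℝ) i j) s t := by
  have hG := hasDerivWithinAt_inv_of_eq_one (A := fun s => (v s).g)
    (A' := (-2 : ℝ) • (v t).k) (by simpa using hv.g_eq) hg
  unfold State.kMixed
  refine (HasDerivWithinAt.fun_sum fun l _ => (hG i l).fun_mul (hv.k_eq l j)).congr_deriv ?_
  simp only [State.kRhs_of_g_eq_one hg, hg, inv_one, Matrix.smul_apply, smul_eq_mul,
    Finset.sum_add_distrib, Matrix.one_apply, ite_mul, one_mul, zero_mul, Finset.sum_ite_eq,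
    Finset.mem_univ, if_true, Finset.mul_sum]
  have : ∑ l, -(-2 * (v t).k i l) * (v t).k l j = ∑ l, 2 * ((v t).k l j * (v t).k i l) :=
    Finset.sum_congr rfl fun l _ => by ring
  rw [this]
  ring

/-- In the divergence of the `k` equation the Ricci tensor contributes nothing (contracted Bianchi
identity), nor do multiples of the metric. The divergence of `τ` balances the derivative of `τ0` up
to the Lorentz force once Gauss's law replaces `a·E` by the charge density, and that force is the
one acting on `ρ u⁰ u`. What is left is `H` times the defect. -/
lemma momentumDefect_of_g_eq_one (hv : EvolvesAt C Λ m v s t) (hC : IsAntisymm C)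
    (hJ : IsJacobi C) (hg : (v t).g = 1) (ht : t ∈ s)
    (hs : ∀ r ∈ s, (v r).g.PosDef ∧ ∀ i j, (v r).k i j = (v r).k j i)
    (hF : ∀ i j, (v t).F i j = -(v t).F j i) (hρ : 0 < (v t).ρ)
    (hmag : ∀ i j k, (v t).magneticDefect C i j k = 0) (hgauss : (v t).gaussDefect C = 0)
    (j : Fin 3) :
    HasDerivWithinAt (fun s => (v s).momentumDefect C j) ((v t).H * (v t).momentumDefect C j) s t := by
  have hgp := (hs t ht).1
  have hu0 := (State.uZero_pos _ hgp).ne'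
  -- The frame is orthonormal only at time `t`. To differentiate, the divergence at all times in `s`
  -- is expressed by mixed components, which needs positivity of `g` and symmetry of `k` throughout
  -- `s`.
  have e : ∀ r ∈ s, (v r).momentumDefect C j = divOf C (v r).kMixed j
      + 8 * Real.pi * ((v r).τ0 j - (v r).ρ * (v r).uZero * (v r).uLow j) := by
    intro r hr
    rw [State.momentumDefect, State.divK_eq_divOf hC (hs r hr).1 (hs r hr).2]
    ring
  have hκ := hv.kMixed_of_g_eq_one hg
  have hdiv := hasDerivWithinAt_divOf C hκ j
  have hτ0 : HasDerivWithinAt (fun s => (v s).τ0 j) _ s t :=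
    (HasDerivWithinAt.fun_sum fun k _ => (hv.E_eq k).fun_mul (hv.F_eq j k)).fun_neg
  have hlow : HasDerivWithinAt (fun s => (v s).uLow j) _ s t :=
    HasDerivWithinAt.fun_sum fun l _ => (hv.g_eq j l).fun_mul (hv.u_eq l)
  have hρu := hv.ρ_mul_uZero hC hgp hF hρ
  rw [e t ht]
  refine ((hdiv.fun_add ((hτ0.fun_sub (hρu.fun_mul hlow)).const_mul (8 * Real.pi))).congr e
    (e t ht)).congr_deriv ?_
  have hkM : (v t).kMixed = (v t).k := by
    ext a b
    simp [State.kMixed, State.gInv_of_g_eq_one hg, Matrix.one_apply]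
  have a1 : ∀ c, divOf C (fun i j => c * (v t).k i j) j = c * divOf C (v t).k j :=
    fun c => divOf_smul C (v t).k c j
  have a2 : ∀ c, divOf C (fun i j => c * (1 : Matrix (Fin 3) (Fin 3) ℝ) i j) j = c * 0 :=
    fun c => by rw [← divOf_one hC j]; exact divOf_smul C _ c j
  rw [divOf_add, divOf_add, divOf_add, divOf_smul, a1, a2, divOf_add, divOf_smul,
    State.divOf_Ric_of_g_eq_one hC hJ hg,
    State.divOf_τ_of_g_eq_one hC hg hF hmag, hkM]
  have hgs : ∑ k, trConst C k * (v t).E k = -4 * Real.pi * (v t).e * (v t).uZero := by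
    rw [State.gaussDefect, sum_sum_trConst, dotProduct] at hgauss
    linarith
  have hu := State.uRhs_of_g_eq_one hg hC j
  have hlowv : ∑ l, (-2 * (v t).k j l * (v t).u l + (v t).g j l * (v t).uRhs C l)
      = (v t).uRhs C j - 2 * ∑ l, (v t).k j l * (v t).u l := by
    simp only [hg, Matrix.one_apply, ite_mul, one_mul, zero_mul, Finset.sum_add_distrib,
      Finset.sum_ite_eq, Finset.mem_univ, if_true, Finset.mul_sum]
    rw [add_comm, sub_eq_add_neg, ← Finset.sum_neg_distrib]
    congr 1
    exact Finset.sum_congr rfl fun _ _ => by ring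
  have huu : divOf C (fun a b => (v t).u a * (v t).u b) j
      = (trConst C ⬝ᵥ (v t).u) * (v t).u j + ∑ l, ∑ k, C k j l * (v t).u l * (v t).u k := by
    simp only [divOf, dotProduct, Finset.sum_mul]
    rw [Finset.sum_comm]
    congr 1
    · exact Finset.sum_congr rfl fun _ _ => by ring
    · exact Finset.sum_congr rfl fun _ _ => Finset.sum_congr rfl fun _ _ => by ring
  rw [hlowv, huu, hgs, hu, State.uLow_of_g_eq_one hg, State.τ0]
  simp only [State.ERhs_of_g_eq_one hg, State.FRhs_of_g_eq_one hg]
  generalize (v t).uZero = u0 at *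
  generalize trConst C ⬝ᵥ (v t).u = au
  generalize (∑ l, ∑ k, C k j l * (v t).u l * (v t).u k) = cuu
  generalize divOf C (v t).k j = dk
  have hFj : ∑ l, (v t).F l j * (v t).u l = -∑ l, (v t).u l * (v t).F j l := by
    rw [← Finset.sum_neg_distrib]
    exact Finset.sum_congr rfl fun l _ => by rw [hF l j]; ring
  rw [hFj]
  have hEF : ∑ k, (((v t).H * (v t).E k - (∑ l, trConst C l * (v t).F l k
        + 1 / 2 * ∑ p, ∑ q, C k p q * (v t).F p q) + 4 * Real.pi * (v t).e * (v t).u k)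
        * (v t).F j k + (v t).E k * ∑ l, C l j k * (v t).E l)
      = (v t).H * ∑ k, (v t).E k * (v t).F j k
        - ∑ k, (∑ l, trConst C l * (v t).F l k + 1 / 2 * ∑ p, ∑ q, C k p q * (v t).F p q)
          * (v t).F j k
        + 4 * Real.pi * (v t).e * ∑ k, (v t).u k * (v t).F j k
        + ∑ k, ∑ l, (v t).E k * C l j k * (v t).E l := by
    simp only [Finset.mul_sum (a := (v t).H), Finset.mul_sum (a := 4 * Real.pi * (v t).e),
      ← Finset.sum_sub_distrib, ← Finset.sum_add_distrib]
    refine Finset.sum_congr rfl fun k _ => ?_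
    have : (v t).E k * ∑ l, C l j k * (v t).E l = ∑ l, (v t).E k * C l j k * (v t).E l := by
      rw [Finset.mul_sum]
      exact Finset.sum_congr rfl fun _ _ => by ring
    rw [this]; ring
  rw [hEF]
  generalize (∑ k, (∑ l, trConst C l * (v t).F l k + 1 / 2 * ∑ p, ∑ q, C k p q * (v t).F p q)
          * (v t).F j k) = cF
  generalize (∑ k, ∑ l, (v t).E k * C l j k * (v t).E l) = eE
  generalize (∑ k, (v t).u k * (v t).F j k) = uF
  generalize (∑ k, (v t).E k * (v t).F j k) = EF
  generalize (∑ l, (v t).k j l * (v t).u l) = ku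
  have hρ' := hρ.ne'
  field_simp
  ring

/-- The momentum constraint is propagated. -/
lemma momentumDefect (hv : EvolvesAt C Λ m v s t) (hC : IsAntisymm C)
    (hJ : IsJacobi C) (ht : t ∈ s)
    (hs : ∀ r ∈ s, (v r).g.PosDef ∧ ∀ i j, (v r).k i j = (v r).k j i)
    (hF : ∀ i j, (v t).F i j = -(v t).F j i) (hρ : 0 < (v t).ρ)
    (hmag : ∀ i j k, (v t).magneticDefect C i j k = 0) (hgauss : (v t).gaussDefect C = 0)
    (j : Fin 3) :
    HasDerivWithinAt (fun s => (v s).momentumDefect C j) ((v t).H * (v t).momentumDefect C j) s t := by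
  obtain ⟨D, B, h, h1⟩ := (v t).frame_of_posDef (hs t ht).1
  have hw := (hv.frame hC h).momentumDefect_of_g_eq_one (hC.frameConst D B) (hJ.frameConst h) h1 ht
    (fun r hr => ⟨State.frame_g_posDef (hs r hr).1 h, State.frame_k_symm (hs r hr).2 D B⟩)
    (State.frame_F_antisymm hF D B) hρ (State.frame_magneticDefect _ h hmag)
    (by rw [State.frame_gaussDefect _ h, hgauss])
  have e : ∀ r, (v r).momentumDefect C j
      = ∑ i, ((v r).frame D B).momentumDefect (frameConst D B C) i * B i j := by
    intro r
    have : (v r).momentumDefect C = ((v r).frame D B).momentumDefect (frameConst D B C) ᵥ* B := by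
      rw [State.frame_momentumDefect _ hC h, vecMul_vecMul, h, vecMul_one]
    rw [this]; rfl
  simp only [e, ← State.frame_H (v t) h]
  refine (HasDerivWithinAt.fun_sum fun i _ => (hw i).mul_const (B i j)).congr_deriv ?_
  rw [Finset.mul_sum]
  exact Finset.sum_congr rfl fun _ _ => by ring

end EvolvesAt


namespace EvolvesAt

variable {C : Fin 3 → Fin 3 → Fin 3 → ℝ} {Λ m : ℝ} {v : ℝ → State} {s : Set ℝ} {t : ℝ}

lemma gInv_of_g_eq_one (hv : EvolvesAt C Λ m v s t) (hg : (v t).g = 1) (i j : Fin 3) :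
    HasDerivWithinAt (fun s => (v s).gInv i j) (2 * (v t).k i j) s t :=
  (hasDerivWithinAt_inv_of_eq_one (A := fun s => (v s).g) (A' := (-2 : ℝ) • (v t).k)
    (by simpa using hv.g_eq) hg i j).congr_deriv (by simp)

lemma γ_of_g_eq_one (hv : EvolvesAt C Λ m v s t) (hg : (v t).g = 1) (l i j : Fin 3) :
    HasDerivWithinAt (fun s => (v s).γ C l i j) (γDot C (v t).k l i j) s t := by
  unfold State.γ
  refine ((HasDerivWithinAt.fun_sum fun k _ => (hv.gInv_of_g_eq_one hg l k).fun_mul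
    (HasDerivWithinAt.fun_sum fun p _ => (((hv.g_eq i p).const_mul (-C p j k)).fun_add
      ((hv.g_eq j p).const_mul (C p k i))).fun_add ((hv.g_eq k p).const_mul (C p i j)))).const_mul
      (1 / 2)).congr_deriv ?_
  simp only [γDot, State.gInv_of_g_eq_one hg, hg, Matrix.one_apply, ite_mul, one_mul, zero_mul,
    mul_ite, mul_one, mul_zero, Finset.sum_add_distrib, Finset.sum_ite_eq, Finset.mem_univ, if_true]
  simp only [Fin.sum_univ_three]
  ring

/-- Varying the inverse metric gives `2 k·Ric`; varying the Ricci tensor gives, after the trace,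
only the divergence term of `trace_Ric_dot`. -/
lemma R_of_g_eq_one (hv : EvolvesAt C Λ m v s t) (hC : IsAntisymm C) (hg : (v t).g = 1)
    (hk : ∀ i j, (v t).k i j = (v t).k j i) :
    HasDerivWithinAt (fun s => (v s).R C) (2 * ∑ i, ∑ j, (v t).k i j * (v t).Ric C i j
      - 2 * ∑ j, trConst C j * (v t).divK C j) s t := by
  have hγ := hv.γ_of_g_eq_one hg
  have hRic : ∀ i j, HasDerivWithinAt (fun s => (v s).Ric C i j)
      (∑ l, ∑ p, (γDot C (v t).k l l p * (v t).γ C p j i + (v t).γ C l l p * γDot C (v t).k p j i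
      - (γDot C (v t).k p j l * (v t).γ C l p i + (v t).γ C p j l * γDot C (v t).k l p i)
      - C l p j * γDot C (v t).k p l i)) s t := fun i j =>
    HasDerivWithinAt.fun_sum fun l _ => HasDerivWithinAt.fun_sum fun p _ =>
      (((hγ l l p).fun_mul (hγ p j i)).fun_sub ((hγ p j l).fun_mul (hγ l p i))).fun_sub
        ((hγ p l i).const_mul _)
  unfold State.R
  refine (HasDerivWithinAt.fun_sum fun i _ => HasDerivWithinAt.fun_sum fun j _ =>
    (hv.gInv_of_g_eq_one hg i j).fun_mul (hRic i j)).congr_deriv ?_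
  have key := trace_Ric_dot (k := (v t).k) hC hk (State.γ_of_g_eq_one (v := v t) (C := C) hg)
  simp only [State.divK_of_g_eq_one hC hg hk]
  simp only [State.gInv_of_g_eq_one hg, Matrix.one_apply, ite_mul, one_mul, zero_mul,
    Finset.sum_add_distrib (ι := Fin 3) (f := fun j => 2 * (v t).k _ j * (v t).Ric C _ j),
    Finset.sum_ite_eq, Finset.mem_univ, if_true]
  rw [Finset.sum_add_distrib, key, Finset.mul_sum]
  simp only [Finset.mul_sum, mul_assoc]
  rw [sub_eq_add_neg, ← Finset.sum_neg_distrib]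
  simp only [neg_mul]

/-- The cubic trace of `k` produced by the two inverse metrics cancels the one produced by the
quadratic term of the `k` equation. -/
lemma kSq_of_g_eq_one (hv : EvolvesAt C Λ m v s t) (hg : (v t).g = 1)
    (hk : ∀ i j, (v t).k i j = (v t).k j i) :
    HasDerivWithinAt (fun s => (v s).kSq) (2 * ∑ i, ∑ j, (v t).k i j * (v t).Ric C i j
      + 2 * (v t).H * (v t).kSq
      - 16 * Real.pi * (∑ i, ∑ j, (v t).k i j * (v t).τ i j
          + (v t).ρ * ((v t).u ⬝ᵥ (v t).k *ᵥ (v t).u))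
      - 2 * (4 * Real.pi * (m ^ 2 * (v t).Φ ^ 2 + (v t).ρ) + Λ) * (v t).H) s t := by
  unfold State.kSq
  have hG := hv.gInv_of_g_eq_one hg
  refine (HasDerivWithinAt.fun_sum fun i _ => HasDerivWithinAt.fun_sum fun j _ =>
    HasDerivWithinAt.fun_sum fun l _ => HasDerivWithinAt.fun_sum fun p _ =>
    (((hG i l).fun_mul (hG j p)).fun_mul (hv.k_eq i j)).fun_mul (hv.k_eq l p)).congr_deriv ?_
  have e : ∑ i, ∑ j, ∑ l, ∑ p, (v t).gInv i l * (v t).gInv j p * (v t).k i j * (v t).k l p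
      = (v t).kSq := rfl
  rw [e, ← State.quad_eq, State.H_of_g_eq_one hg, State.kSq_of_g_eq_one hg]
  have hkr := State.kRhs_of_g_eq_one (C := C) hg Λ m
  rw [State.H_of_g_eq_one hg] at hkr
  generalize (v t).kRhs C Λ m = K at *
  generalize (v t).Ric C = Q at *
  generalize (v t).τ = T at *
  simp only [State.gInv_of_g_eq_one hg, Matrix.one_apply]
  simp only [hkr, Matrix.one_apply]
  have h10 : (v t).k 1 0 = (v t).k 0 1 := hk 1 0
  have h20 : (v t).k 2 0 = (v t).k 0 2 := hk 2 0
  have h21 : (v t).k 2 1 = (v t).k 1 2 := hk 2 1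
  simp only [Fin.sum_univ_three, h10, h20, h21]
  simp
  ring

/-- Poynting's theorem: work of the expansion against the stresses, work on the current, and the
divergence of the flux `τ0`. -/
lemma τ00_of_g_eq_one (hv : EvolvesAt C Λ m v s t) (hg : (v t).g = 1)
    (hk : ∀ i j, (v t).k i j = (v t).k j i) (hF : ∀ i j, (v t).F i j = -(v t).F j i) :
    HasDerivWithinAt (fun s => (v s).τ00)
      (∑ i, ∑ j, (v t).k i j * (v t).τ i j + (v t).H * (v t).τ00
        + 4 * Real.pi * (v t).e * ((v t).u ⬝ᵥ (v t).g *ᵥ (v t).E)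
        + ∑ j, trConst C j * (v t).τ0 j) s t := by
  unfold State.τ00
  have hG := hv.gInv_of_g_eq_one hg
  have hE : HasDerivWithinAt (fun s => (v s).ESq) _ s t :=
    HasDerivWithinAt.fun_sum fun i _ => HasDerivWithinAt.fun_sum fun j _ =>
      ((hv.g_eq i j).fun_mul (hv.E_eq i)).fun_mul (hv.E_eq j)
  have hFS : HasDerivWithinAt (fun s => (v s).FSq) _ s t :=
    HasDerivWithinAt.fun_sum fun i _ => HasDerivWithinAt.fun_sum fun j _ =>
      HasDerivWithinAt.fun_sum fun l _ => HasDerivWithinAt.fun_sum fun p _ =>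
      (((hG i l).fun_mul (hG j p)).fun_mul (hv.F_eq i j)).fun_mul (hv.F_eq l p)
  refine ((hE.div_const 2).fun_add (hFS.div_const 4)).congr_deriv ?_
  have F00 : (v t).F 0 0 = 0 := by have := hF 0 0; linarith
  have F11 : (v t).F 1 1 = 0 := by have := hF 1 1; linarith
  have F22 : (v t).F 2 2 = 0 := by have := hF 2 2; linarith
  have F10 : (v t).F 1 0 = -(v t).F 0 1 := hF 1 0
  have F21 : (v t).F 2 1 = -(v t).F 1 2 := hF 2 1
  have F02 : (v t).F 0 2 = -(v t).F 2 0 := hF 0 2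
  have h10 : (v t).k 1 0 = (v t).k 0 1 := hk 1 0
  have h20 : (v t).k 2 0 = (v t).k 0 2 := hk 2 0
  have h21 : (v t).k 2 1 = (v t).k 1 2 := hk 2 1
  simp only [State.gInv_of_g_eq_one hg, Matrix.one_apply]
  simp only [State.τ, State.τ0, State.ESq_of_g_eq_one hg, State.FSq_of_g_eq_one hg,
    State.H_of_g_eq_one hg, State.ERhs_of_g_eq_one hg, State.FRhs_of_g_eq_one hg, hg, one_mulVec,
    dotProduct, Matrix.one_apply, State.gInv_of_g_eq_one hg]
  simp only [Fin.sum_univ_three, F00, F11, F22, F10, F21, F02, h10, h20, h21]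
  simp
  ring

lemma ρ_mul_uZero_sq (hv : EvolvesAt C Λ m v s t) (hC : IsAntisymm C) (hg : (v t).g.PosDef)
    (hF : ∀ i j, (v t).F i j = -(v t).F j i) (hρ : 0 < (v t).ρ) :
    HasDerivWithinAt (fun s => (v s).ρ * (v s).uZero ^ 2)
      ((v t).H * ((v t).ρ * (v t).uZero ^ 2) - (v t).ρ * (v t).uZero * (trConst C ⬝ᵥ (v t).u)
        + (v t).ρ * ((v t).u ⬝ᵥ (v t).k *ᵥ (v t).u)
        - 4 * Real.pi * (v t).e * ((v t).u ⬝ᵥ (v t).g *ᵥ (v t).E)) s t := by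
  have e : ∀ r, (v r).ρ * (v r).uZero ^ 2 = (v r).ρ * (v r).uZero * (v r).uZero := fun r => by ring
  simp only [e]
  refine ((hv.ρ_mul_uZero hC hg hF hρ).fun_mul (hv.uZero hC hg hF)).congr_deriv ?_
  have h0 := (State.uZero_pos _ hg).ne'
  field_simp
  ring

/-- The exchange between kinetic and potential energy cancels, so only the damping by `H` is left.
-/
lemma T00 (hv : EvolvesAt C Λ m v s t) :
    HasDerivWithinAt (fun s => (v s).T00 m) (2 * (v t).H * (v t).U) s t := by
  refine (hv.U_eq.fun_add (((hv.Φ_eq.fun_pow 2).const_mul (m ^ 2)).div_const 2)).congr_deriv ?_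
  norm_num
  ring

/-- The `k·Ric` terms of `R` and `kSq` cancel, as do the `k·τ` and `k(u,u)` terms of `kSq` and the
energies, and the work of the field on the charges against the work received. Besides `2 H` times
the defect only the fluxes contracted with the trace covector remain, and they assemble into the
momentum defect. -/
lemma hamiltonianDefect_of_g_eq_one (hv : EvolvesAt C Λ m v s t) (hC : IsAntisymm C)
    (hg : (v t).g = 1) (hk : ∀ i j, (v t).k i j = (v t).k j i)
    (hF : ∀ i j, (v t).F i j = -(v t).F j i) (hρ : 0 < (v t).ρ) :
    HasDerivWithinAt (fun s => (v s).hamiltonianDefect C Λ m)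
      (2 * (v t).H * (v t).hamiltonianDefect C Λ m
        - 2 * ∑ j, trConst C j * (v t).momentumDefect C j) s t := by
  have hgp : (v t).g.PosDef := by rw [hg]; exact Matrix.PosDef.one
  refine (((((hv.R_of_g_eq_one hC hg hk).fun_sub (hv.kSq_of_g_eq_one hg hk)).fun_add
    ((hv.H hC hgp hk).fun_pow 2)).fun_sub (((hv.T00.fun_add (hv.τ00_of_g_eq_one hg hk hF)).fun_add
      (hv.ρ_mul_uZero_sq hC hgp hF hρ)).const_mul (16 * Real.pi))).sub_const (2 * Λ)).congr_deriv ?_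
  have e : ∑ j, trConst C j * (v t).momentumDefect C j = ∑ j, trConst C j * (v t).divK C j
      + 8 * Real.pi * (∑ j, trConst C j * (v t).τ0 j
        - (v t).ρ * (v t).uZero * (trConst C ⬝ᵥ (v t).u)) := by
    simp only [State.momentumDefect, State.uLow_of_g_eq_one hg, dotProduct, Fin.sum_univ_three]
    ring
  rw [e, State.hamiltonianDefect, State.T00]
  norm_num
  ring

/-- The Hamiltonian constraint is propagated. -/
lemma hamiltonianDefect (hv : EvolvesAt C Λ m v s t) (hC : IsAntisymm C)
    (hg : (v t).g.PosDef) (hk : ∀ i j, (v t).k i j = (v t).k j i)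
    (hF : ∀ i j, (v t).F i j = -(v t).F j i) (hρ : 0 < (v t).ρ)
    (hmom : ∀ j, (v t).momentumDefect C j = 0) :
    HasDerivWithinAt (fun s => (v s).hamiltonianDefect C Λ m)
      (2 * (v t).H * (v t).hamiltonianDefect C Λ m) s t := by
  obtain ⟨D, B, h, h1⟩ := (v t).frame_of_posDef hg
  have hw := (hv.frame hC h).hamiltonianDefect_of_g_eq_one (hC.frameConst D B) h1
    (State.frame_k_symm hk D B) (State.frame_F_antisymm hF D B) hρ
  have hmom' : ((v t).frame D B).momentumDefect (frameConst D B C) = 0 := by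
    rw [State.frame_momentumDefect _ hC h, show (v t).momentumDefect C = 0 from funext hmom,
      zero_vecMul]
  simpa [State.frame_hamiltonianDefect _ hC h, State.frame_H _ h, hmom'] using hw

end EvolvesAt


/-! ### Positive scalar curvature characterizes Bianchi type IX -/

/-- The symmetric part of the matrix of the bracket, viewed as a map `Λ² → L` in dimension three. -/
def symBracket (C : Fin 3 → Fin 3 → Fin 3 → ℝ) : Matrix (Fin 3) (Fin 3) ℝ :=
  of fun i j => (1 / 2) * (C i (j + 1) (j + 2) + C j (i + 1) (i + 2))

/-- In dimension three the bracket is a matrix, whose antisymmetric part is dual to the trace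
covector. The quadratic form `R` has no cross term between the two parts and is negative in the
second. -/
lemma State.R_of_g_eq_one {v : State} {C : Fin 3 → Fin 3 → Fin 3 → ℝ} (hC : IsAntisymm C)
    (hg : v.g = 1) : v.R C = (1 / 2) * (∑ i, symBracket C i i) ^ 2
      - ∑ i, ∑ j, symBracket C i j ^ 2 - (3 / 2) * ∑ i, trConst C i ^ 2 := by
  simp only [R, Ric, γ_of_g_eq_one hg, gInv_of_g_eq_one hg, Matrix.one_apply, ite_mul, one_mul,
    zero_mul, Finset.sum_ite_eq, Finset.mem_univ, if_true, symBracket, of_apply, trConst]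
  simp only [Fin.sum_univ_three, Fin.reduceAdd, hC.diag, hC.one_zero, hC.two_one, hC.zero_two]
  ring

/-- A symmetric matrix close to a multiple of the identity is definite. -/
lemma trace_mul_quad_pos {n : Matrix (Fin 3) (Fin 3) ℝ}
    (hn : ∑ i, ∑ j, n i j ^ 2 < (1 / 2) * (∑ i, n i i) ^ 2) {x : Fin 3 → ℝ} (hx : x ≠ 0) :
    0 < (∑ i, n i i) * ∑ i, ∑ j, n i j * x i * x j := by
  set r := ∑ i, x i ^ 2 with hr
  have hr0 : 0 < r := by
    obtain ⟨i, hi⟩ := Function.ne_iff.mp hx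
    exact Finset.sum_pos' (fun _ _ => sq_nonneg _) ⟨i, Finset.mem_univ _, sq_pos_of_ne_zero hi⟩
  -- The comparison matrix is `|x|² 1 - x xᵀ`: its squared norm is `2|x|⁴`, which matches the factor
  -- `1/2` in `hn`, and its product with `n` is `(tr n)|x|² - n(x,x)`.
  have cs := Finset.sum_mul_sq_le_sq_mul_sq (Finset.univ : Finset (Fin 3 × Fin 3))
    (fun p => n p.1 p.2) (fun p => (if p.1 = p.2 then r else 0) - x p.1 * x p.2)
  simp only [Fintype.sum_prod_type] at cs
  have e1 : ∑ i, ∑ j, n i j * ((if i = j then r else 0) - x i * x j)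
      = (∑ i, n i i) * r - ∑ i, ∑ j, n i j * x i * x j := by
    simp only [Fin.sum_univ_three]; simp; ring
  have e2 : ∑ i, ∑ j, ((if i = j then r else 0) - x i * x j) ^ 2 = 2 * r ^ 2 := by
    rw [hr]; simp only [Fin.sum_univ_three]; simp; ring
  rw [e1, e2] at cs
  set t := ∑ i, n i i
  set q := ∑ i, ∑ j, n i j * x i * x j
  have h1 : (t * r - q) ^ 2 < t ^ 2 * r ^ 2 := by nlinarith [pow_pos hr0 2]
  have h2 : q ^ 2 < 2 * r * (t * q) := by nlinarith
  have h3 : 0 < 2 * r * (t * q) := lt_of_le_of_lt (sq_nonneg q) h2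
  by_contra hcon
  push Not at hcon
  nlinarith [mul_nonneg hr0.le (neg_nonneg.mpr hcon)]

/-- This is the Jacobi identity written in terms of the symmetric part and the trace covector. -/
lemma symBracket_mulVec_trConst {C : Fin 3 → Fin 3 → Fin 3 → ℝ} (hC : IsAntisymm C)
    (hJ : IsJacobi C) (i : Fin 3) : ∑ j, symBracket C i j * trConst C j = 0 := by
  have J := hJ.cyclic hC
  have J0 := J 0
  have J1 := J 1
  have J2 := J 2
  fin_cases i <;>
    simp only [Fin.zero_eta, Fin.mk_one, Fin.reduceFinMk, symBracket, of_apply, trConst,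
      Fin.sum_univ_three, Fin.reduceAdd, hC.diag, hC.one_zero, hC.two_one, hC.zero_two]
  · linear_combination -J0
  · linear_combination -J1
  · linear_combination -J2

/-- The skew matrix of the cross product with `z`. -/
def crossMat (z : Fin 3 → ℝ) : Matrix (Fin 3) (Fin 3) ℝ :=
  !![0, -z 2, z 1; z 2, 0, -z 0; -z 1, z 0, 0]

lemma crossMat_mem_so (z : Fin 3 → ℝ) : crossMat z ∈ LieAlgebra.Orthogonal.so (Fin 3) ℝ := by
  rw [LieAlgebra.Orthogonal.mem_so]
  ext i j
  fin_cases i <;> fin_cases j <;> simp [crossMat]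

lemma crossMat_of_transpose_eq_neg {A : Matrix (Fin 3) (Fin 3) ℝ} (hA : Aᵀ = -A) :
    crossMat ![A 2 1, A 0 2, A 1 0] = A := by
  have hA' : ∀ i j, A j i = -A i j := fun i j => congrFun (congrFun hA i) j
  have d : ∀ i, A i i = 0 := fun i => by have := hA' i i; linarith
  ext i j
  fin_cases i <;> fin_cases j <;> simp [crossMat, d]
  · exact (hA' 1 0).symm
  · exact (hA' 2 1).symm
  · exact (hA' 0 2).symm

lemma crossMat_cross (z w : Fin 3 → ℝ) :
    crossMat (crossProduct z w) = crossMat z * crossMat w - crossMat w * crossMat z := by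
  ext i j
  fin_cases i <;> fin_cases j <;>
    simp [crossMat, cross_apply] <;> ring

/-- The cofactor matrix is the action of `P` on bivectors, and the cross product identifies
bivectors with vectors. -/
lemma cross_mulVec (P : Matrix (Fin 3) (Fin 3) ℝ) (x y : Fin 3 → ℝ) :
    crossProduct (P *ᵥ x) (P *ᵥ y) = P.adjugateᵀ *ᵥ crossProduct x y := by
  ext i
  rw [adjugate_fin_three]
  fin_cases i <;> simp [cross_apply, mulVec, dotProduct, Fin.sum_univ_three] <;> ring

/-- A definite symmetric matrix `n` in dimension three can be written as a cofactor:
there is an invertible `P` with `P n = cof P`. -/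
lemma exists_mul_eq_cofactor {n : Matrix (Fin 3) (Fin 3) ℝ} (hn : n.PosDef ∨ (-n).PosDef) :
    ∃ P : Matrix (Fin 3) (Fin 3) ℝ, IsUnit P.det ∧ P * n = P.adjugateᵀ := by
  -- For size three the adjugate is quadratic, so it does not see the sign of `n`.
  have hadj : n.adjugate.PosDef := by
    have key : ∀ k : Matrix (Fin 3) (Fin 3) ℝ, k.PosDef → k.adjugate.PosDef := by
      intro k hk
      have : k.adjugate = k.det • k⁻¹ := by
        rw [Matrix.inv_def, Ring.inverse_eq_inv', smul_smul, mul_inv_cancel₀ hk.det_pos.ne', one_smul]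
      rw [this]
      exact hk.inv.smul hk.det_pos
    rcases hn with h | h
    · exact key n h
    · have : (-n).adjugate = n.adjugate := by
        ext i j; rw [adjugate_fin_three_apply, adjugate_fin_three_apply]; simp
      rw [← this]; exact key _ h
  obtain ⟨D, B, h, h1⟩ := exists_orthonormal_frame hadj
  have h2 := State.transpose_mul_transpose_of_inverse h
  have hB : Bᵀ * B = n.adjugate := by
    calc Bᵀ * B = Bᵀ * (Dᵀ * n.adjugate * D) * B := by rw [h1, Matrix.mul_one]
      _ = (Bᵀ * Dᵀ) * n.adjugate * (D * B) := by simp only [Matrix.mul_assoc]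
      _ = _ := by rw [h, h2, Matrix.one_mul, Matrix.mul_one]
  have hd : B.det ^ 2 = n.det ^ 2 := by
    have := congrArg det hB
    rw [det_mul, det_transpose, det_adjugate] at this
    simpa [pow_two] using this
  have hn0 : n.det ≠ 0 := by
    have := hadj.det_pos
    rw [det_adjugate] at this
    intro h0
    simp [h0] at this
  have main : ∀ P : Matrix (Fin 3) (Fin 3) ℝ, Pᵀ * P = n.adjugate → P.det = n.det →
      IsUnit P.det ∧ P * n = P.adjugateᵀ := by
    intro P hP hPd
    have hu : IsUnit P.det := by rw [hPd]; exact isUnit_iff_ne_zero.mpr hn0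
    refine ⟨hu, ?_⟩
    have hu' : IsUnit Pᵀ.det := by rwa [det_transpose]
    -- Both sides equal `det n` times the identity; `Pᵀ` is then cancelled.
    have e : Pᵀ * (P * n) = Pᵀ * P.adjugateᵀ := by
      rw [← Matrix.mul_assoc, hP, adjugate_mul, ← Matrix.transpose_mul, adjugate_mul, hPd]
      simp
    have := congrArg (Pᵀ⁻¹ * ·) e
    simpa [← Matrix.mul_assoc, nonsing_inv_mul _ hu'] using this
  -- Passing from `B` to `-B` keeps `Bᵀ B` and, in odd dimension, reverses the determinant, so the
  -- sign of the determinant can be matched with `n`.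
  rcases sq_eq_sq_iff_eq_or_eq_neg.mp hd with h3 | h3
  · exact ⟨B, main B hB h3⟩
  · exact ⟨-B, main (-B) (by simpa using hB) (by rw [det_neg, h3]; norm_num)⟩

/-- A three-dimensional Lie algebra whose bracket is given by a definite symmetric matrix
is `so(3)`. -/
lemma nonempty_lieEquiv_so {L : Type*} [LieRing L] [LieAlgebra ℝ L] (b : Module.Basis (Fin 3) ℝ L)
    {n : Matrix (Fin 3) (Fin 3) ℝ} (hn : n.PosDef ∨ (-n).PosDef)
    (hb : ∀ i j, structConst b i (j + 1) (j + 2) = n i j) :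
    Nonempty (L ≃ₗ⁅ℝ⁆ LieAlgebra.Orthogonal.so (Fin 3) ℝ) := by
  obtain ⟨P, hP, hPn⟩ := exists_mul_eq_cofactor hn
  have hC := isAntisymm_structConst b
  have hbr : ∀ x y : L, b.equivFun ⁅x, y⁆ = n *ᵥ crossProduct (b.equivFun x) (b.equivFun y) := by
    intro x y
    have e : ∀ k, b.equivFun ⁅x, y⁆ k
        = ∑ i, ∑ j, b.equivFun x i * b.equivFun y j * structConst b k i j := by
      intro k
      conv_lhs => rw [← b.sum_equivFun x, ← b.sum_equivFun y]
      simp only [sum_lie, lie_sum, smul_lie, lie_smul, map_sum, map_smul, Finset.sum_apply,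
        Pi.smul_apply, smul_eq_mul, structConst, Module.Basis.equivFun_apply, Finset.mul_sum]
      rw [Finset.sum_comm]
      exact Finset.sum_congr rfl fun _ _ => Finset.sum_congr rfl fun _ _ => by ring
    ext k
    have h0 := hb k 0
    have h1 := hb k 1
    have h2 := hb k 2
    simp only [zero_add, Fin.reduceAdd] at h0 h1 h2
    rw [e]
    simp only [mulVec, dotProduct, Fin.sum_univ_three, hC.diag, hC.one_zero, hC.two_one,
      hC.zero_two, cross_apply, h0, h1, h2]
    simp
    ring
  -- The bracket is `n (x × y)`, and `P n (x × y) = P x × P y` by the choice of `P`. Thus `P`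
  -- carries the bracket to the cross product, which is the commutator of skew matrices.
  let f : L →ₗ⁅ℝ⁆ LieAlgebra.Orthogonal.so (Fin 3) ℝ :=
    { toFun := fun x => ⟨crossMat (P *ᵥ b.equivFun x), crossMat_mem_so _⟩
      map_add' := fun x y => by
        ext i j
        fin_cases i <;> fin_cases j <;> simp [crossMat, mulVec_add] <;> ring
      map_smul' := fun c x => by
        ext i j
        fin_cases i <;> fin_cases j <;> simp [crossMat, mulVec_smul]
      map_lie' := fun {x y} => by
        apply Subtype.ext
        change crossMat (P *ᵥ b.equivFun ⁅x, y⁆) = _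
        rw [hbr, mulVec_mulVec, hPn, ← cross_mulVec, crossMat_cross]
        rfl }
  refine ⟨LieEquiv.ofBijective f ⟨?_, ?_⟩⟩
  · intro x y hxy
    have h1 : crossMat (P *ᵥ b.equivFun x) = crossMat (P *ᵥ b.equivFun y) :=
      congrArg Subtype.val hxy
    have h2 : P *ᵥ b.equivFun x = P *ᵥ b.equivFun y := by
      ext i
      have a0 := congrFun (congrFun h1 2) 1
      have a1 := congrFun (congrFun h1 0) 2
      have a2 := congrFun (congrFun h1 1) 0
      fin_cases i
      · simpa [crossMat] using a0
      · simpa [crossMat] using a1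
      · simpa [crossMat] using a2
    have h3 := congrArg (P⁻¹ *ᵥ ·) h2
    simp only [mulVec_mulVec, nonsing_inv_mul _ hP, one_mulVec] at h3
    exact b.equivFun.injective h3
  · rintro ⟨A, hA⟩
    rw [LieAlgebra.Orthogonal.mem_so] at hA
    refine ⟨b.equivFun.symm (P⁻¹ *ᵥ ![A 2 1, A 0 2, A 1 0]), Subtype.ext ?_⟩
    change crossMat (P *ᵥ b.equivFun _) = A
    rw [LinearEquiv.apply_symm_apply, mulVec_mulVec, mul_nonsing_inv _ hP, one_mulVec]
    exact crossMat_of_transpose_eq_neg hA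

/-- The structure constants in another frame are those of another basis. -/
lemma exists_basis_structConst {L : Type*} [LieRing L] [LieAlgebra ℝ L]
    (b : Module.Basis (Fin 3) ℝ L) {D B : Matrix (Fin 3) (Fin 3) ℝ} (h : D * B = 1) :
    ∃ b' : Module.Basis (Fin 3) ℝ L, structConst b' = frameConst D B (structConst b) := by
  have h' : B * D = 1 := mul_eq_one_comm.mp h
  have hD : IsUnit D.det := (Matrix.isUnit_iff_isUnit_det D).mp (IsUnit.of_mul_eq_one B h)
  let b' : Module.Basis (Fin 3) ℝ L := b.map (Matrix.toLinearEquiv b D hD)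
  have hb' : ∀ i, b' i = ∑ a, D a i • b a := fun i => by
    simp [b', Matrix.toLinearEquiv, Matrix.toLin_self]
  have hb : ∀ a, b a = ∑ k, B k a • b' k := by
    intro a
    simp only [hb', Finset.smul_sum, smul_smul]
    rw [Finset.sum_comm]
    have : ∀ c, ∑ k, (B k a * D c k) • b c = (if c = a then (1 : ℝ) else 0) • b c := by
      intro c
      rw [← Finset.sum_smul]
      congr 1
      rw [← Matrix.one_apply, ← h, Matrix.mul_apply]
      exact Finset.sum_congr rfl fun _ _ => mul_comm _ _
    simp [this]
  have hrepr : ∀ x k, b'.repr x k = ∑ c, B k c * b.repr x c := by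
    intro x k
    conv_lhs => rw [← b.sum_repr x]
    simp only [map_sum, map_smul, Finsupp.finsetSum_apply, Finsupp.smul_apply, smul_eq_mul]
    refine Finset.sum_congr rfl fun c _ => ?_
    rw [hb c]
    simp only [map_sum, map_smul, Finsupp.finsetSum_apply, Finsupp.smul_apply, smul_eq_mul,
      Module.Basis.repr_self, Finsupp.single_apply, mul_ite, mul_one, mul_zero, Finset.sum_ite_eq',
      Finset.mem_univ, if_true]
    rw [mul_comm]
  refine ⟨b', ?_⟩
  ext k i j
  rw [structConst, hrepr, frameConst]
  refine Finset.sum_congr rfl fun c _ => ?_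
  rw [hb' i, hb' j]
  simp only [sum_lie, lie_sum, smul_lie, lie_smul, map_sum, map_smul, Finsupp.finsetSum_apply,
    Finsupp.smul_apply, smul_eq_mul, Finset.mul_sum, structConst]
  rw [Finset.sum_comm]
  exact Finset.sum_congr rfl fun _ _ => Finset.sum_congr rfl fun _ _ => by ring

/-- The left invariant metrics on the groups of Bianchi type I to VIII have non-positive scalar
curvature. -/
lemma State.R_nonpos {L : Type*} [LieRing L] [LieAlgebra ℝ L] (hL : IsBianchiIToVIII L)
    (b : Module.Basis (Fin 3) ℝ L) {v : State} (hg : v.g.PosDef) : v.R (structConst b) ≤ 0 := by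
  by_contra hR
  push Not at hR
  obtain ⟨D, B, h, h1⟩ := v.frame_of_posDef hg
  have hC := isAntisymm_structConst b
  obtain ⟨b', hb'⟩ := exists_basis_structConst b h
  rw [← frame_R v hC h, ← hb', R_of_g_eq_one (isAntisymm_structConst b') h1] at hR
  have hC' := isAntisymm_structConst b'
  have hJ' := isJacobi_structConst b'
  have ha2 : 0 ≤ ∑ i, trConst (structConst b') i ^ 2 := Finset.sum_nonneg fun _ _ => sq_nonneg _
  -- Positivity of `R` survives dropping the nonpositive term in the trace covector.
  have hn : ∑ i, ∑ j, symBracket (structConst b') i j ^ 2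
      < (1 / 2) * (∑ i, symBracket (structConst b') i i) ^ 2 := by linarith
  -- The matrix `n` is definite by `hn`, yet annihilates the trace covector.
  have ha : trConst (structConst b') = 0 := by
    by_contra hne
    have := trace_mul_quad_pos hn hne
    have h0 : ∑ i, ∑ j, symBracket (structConst b') i j * trConst (structConst b') i
        * trConst (structConst b') j = 0 := by
      refine Finset.sum_eq_zero fun i _ => ?_
      rw [← mul_zero (trConst (structConst b') i), ← symBracket_mulVec_trConst hC' hJ' i,
        Finset.mul_sum]
      exact Finset.sum_congr rfl fun _ _ => by ring
    rw [h0, mul_zero] at this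
    exact lt_irrefl _ this
  have hsymm : (symBracket (structConst b')).IsHermitian := by
    ext i j; simp [symBracket, add_comm]
  have hdef : (symBracket (structConst b')).PosDef ∨ (-symBracket (structConst b')).PosDef := by
    rcases lt_trichotomy (∑ i, symBracket (structConst b') i i) 0 with ht | ht | ht
    · right
      refine .of_dotProduct_mulVec_pos hsymm.neg fun x hx => ?_
      have := trace_mul_quad_pos hn hx
      rw [quad_eq] at this
      have h2 := neg_of_mul_pos_right this ht.le
      rw [neg_mulVec, dotProduct_neg, star_trivial]
      linarith
    · rw [ht] at hn
      have : 0 ≤ ∑ i, ∑ j, symBracket (structConst b') i j ^ 2 :=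
        Finset.sum_nonneg fun _ _ => Finset.sum_nonneg fun _ _ => sq_nonneg _
      norm_num at hn
      linarith
    · left
      refine .of_dotProduct_mulVec_pos hsymm fun x hx => ?_
      have := trace_mul_quad_pos hn hx
      rw [quad_eq] at this
      rw [star_trivial]
      exact (pos_iff_pos_of_mul_pos this).mp ht
  -- With the trace covector zero the matrix of the bracket has no antisymmetric part and coincides
  -- with `symBracket`.
  refine hL.2.elim (nonempty_lieEquiv_so b' hdef fun i j => ?_).some
  have a0 := congrFun ha 0
  have a1 := congrFun ha 1
  have a2 := congrFun ha 2
  simp only [trConst, Fin.sum_univ_three, hC'.diag, hC'.one_zero, hC'.two_one, hC'.zero_two,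
    Pi.zero_apply] at a0 a1 a2
  fin_cases i <;> fin_cases j <;>
    simp only [Fin.zero_eta, Fin.mk_one, Fin.reduceFinMk, symBracket, of_apply,
      Fin.reduceAdd] <;> linarith


/-! ### Differential inequalities -/

section Gronwall

variable {y y' : ℝ → ℝ} {T K : ℝ}

/-- Gronwall's inequality on `[0, T]`, in differential form. -/
lemma le_mul_exp_of_deriv_le (hy : ∀ t ∈ Set.Icc 0 T, HasDerivWithinAt y (y' t) (Set.Icc 0 T) t)
    (h : ∀ t ∈ Set.Icc 0 T, y' t ≤ K * y t) : ∀ t ∈ Set.Icc 0 T, y t ≤ y 0 * Real.exp (K * t) := by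
  intro t ht
  have hz : ∀ r ∈ Set.Icc 0 T, HasDerivWithinAt (fun r => y r * Real.exp (-K * r))
      (y' r * Real.exp (-K * r) + y r * (Real.exp (-K * r) * -K)) (Set.Icc 0 T) r := by
    intro r hr
    have h2 : HasDerivAt (fun r => -K * r) (-K) r := by
      simpa using (hasDerivAt_id r).const_mul (-K)
    exact (hy r hr).fun_mul (h2.exp.hasDerivWithinAt)
  have hanti : AntitoneOn (fun r => y r * Real.exp (-K * r)) (Set.Icc 0 T) := by
    apply antitoneOn_of_hasDerivWithinAt_nonpos (convex_Icc 0 T)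
      (fun r hr => (hz r hr).continuousWithinAt)
      (fun r hr => (hz r (interior_subset hr)).mono interior_subset)
    intro r hr
    have := h r (interior_subset hr)
    have he := Real.exp_pos (-K * r)
    nlinarith
  have h0 := hanti (Set.left_mem_Icc.mpr (ht.1.trans ht.2)) ht ht.1
  simp only [mul_zero, Real.exp_zero, mul_one] at h0
  have : y t = y t * Real.exp (-K * t) * Real.exp (K * t) := by
    rw [mul_assoc, ← Real.exp_add]; simp
  rw [this]
  exact mul_le_mul_of_nonneg_right h0 (Real.exp_pos _).le

lemma mul_exp_le_of_le_deriv (hy : ∀ t ∈ Set.Icc 0 T, HasDerivWithinAt y (y' t) (Set.Icc 0 T) t)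
    (h : ∀ t ∈ Set.Icc 0 T, K * y t ≤ y' t) : ∀ t ∈ Set.Icc 0 T, y 0 * Real.exp (K * t) ≤ y t := by
  intro t ht
  have := le_mul_exp_of_deriv_le (K := K) (fun r hr => (hy r hr).fun_neg)
    (fun r hr => by have := h r hr; linarith) t ht
  linarith

lemma le_of_deriv_nonneg (hy : ∀ t ∈ Set.Icc 0 T, HasDerivWithinAt y (y' t) (Set.Icc 0 T) t)
    (h : ∀ t ∈ Set.Icc 0 T, 0 ≤ y' t) : ∀ t ∈ Set.Icc 0 T, y 0 ≤ y t := by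
  intro t ht
  simpa using mul_exp_le_of_le_deriv (K := 0) hy (by simpa using h) t ht

/-- A solution of a homogeneous linear equation that vanishes initially is zero. -/
lemma eq_zero_of_linear {c : ℝ → ℝ} (hc : ContinuousOn c (Set.Icc 0 T))
    (hy : ∀ t ∈ Set.Icc 0 T, HasDerivWithinAt y (c t * y t) (Set.Icc 0 T) t) (h0 : y 0 = 0) :
    ∀ t ∈ Set.Icc 0 T, y t = 0 := by
  obtain ⟨M, hM⟩ := isCompact_Icc.exists_bound_of_continuousOn hc
  intro t ht
  -- Squaring removes the unknown sign of `y`.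
  have := le_mul_exp_of_deriv_le (y := fun r => y r ^ 2) (K := 2 * M)
    (fun r hr => (hy r hr).fun_pow 2) (fun r hr => by
      have h1 := (le_abs_self _).trans (hM r hr)
      have : (2 : ℕ) * y r ^ (2 - 1) * (c r * y r) = 2 * c r * y r ^ 2 := by norm_num; ring
      rw [this]
      nlinarith [sq_nonneg (y r)]) t ht
  simp only [h0] at this
  have h2 : y t ^ 2 ≤ 0 := by simpa using this
  exact pow_eq_zero_iff (two_ne_zero) |>.mp (le_antisymm h2 (sq_nonneg _))

end Gronwall

/-! ### Inequalities for norms taken with respect to the metric -/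

namespace State

variable {v : State}

/-- The Cauchy-Schwarz inequality for a covariant tensor of rank two. -/
lemma quad_sq_le (hg : v.g.PosDef) (X : Matrix (Fin 3) (Fin 3) ℝ) (x y : Fin 3 → ℝ) :
    (x ⬝ᵥ X *ᵥ y) ^ 2 ≤ (∑ i, ∑ j, ∑ l, ∑ p, v.gInv i l * v.gInv j p * X i j * X l p)
      * ((x ⬝ᵥ v.g *ᵥ x) * (y ⬝ᵥ v.g *ᵥ y)) := by
  obtain ⟨D, B, h, h1⟩ := v.frame_of_posDef hg
  rw [contractSq_eq, ← frame_contractSq h, ← frame_gInv v h, gInv_of_g_eq_one h1,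
    ← quad_frame h X x y, ← quad_frame h v.g x x, ← quad_frame h v.g y y,
    ← frame_g v (B := B), h1]
  generalize Dᵀ * X * D = X
  generalize B *ᵥ x = x
  generalize B *ᵥ y = y
  have cs := Finset.sum_mul_sq_le_sq_mul_sq (Finset.univ : Finset (Fin 3 × Fin 3))
    (fun p => X p.1 p.2) (fun p => x p.1 * y p.2)
  simp only [Fintype.sum_prod_type] at cs
  have e1 : x ⬝ᵥ X *ᵥ y = ∑ i, ∑ j, X i j * (x i * y j) := by
    rw [← quad_eq]
    exact Finset.sum_congr rfl fun _ _ => Finset.sum_congr rfl fun _ _ => by ring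
  have e2 : trace (1ᵀ * X * 1 * Xᵀ) = ∑ i, ∑ j, X i j ^ 2 := by
    simp [trace, Matrix.mul_apply, pow_two]
  have e3 : (x ⬝ᵥ (1 : Matrix (Fin 3) (Fin 3) ℝ) *ᵥ x) * (y ⬝ᵥ (1 : Matrix (Fin 3) (Fin 3) ℝ) *ᵥ y)
      = ∑ i, ∑ j, (x i * y j) ^ 2 := by
    simp only [one_mulVec, dotProduct, Finset.sum_mul_sum]
    exact Finset.sum_congr rfl fun _ _ => Finset.sum_congr rfl fun _ _ => by ring
  rw [e1, e2, e3]
  exact cs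

lemma inner_sq_le (hg : v.g.PosDef) (x y : Fin 3 → ℝ) :
    (x ⬝ᵥ v.g *ᵥ y) ^ 2 ≤ (x ⬝ᵥ v.g *ᵥ x) * (y ⬝ᵥ v.g *ᵥ y) := by
  obtain ⟨D, B, h, h1⟩ := v.frame_of_posDef hg
  rw [← quad_frame h v.g x x, ← quad_frame h v.g y y, ← quad_frame h v.g x y,
    ← frame_g v (B := B), h1]
  simp only [one_mulVec, dotProduct, ← pow_two]
  exact Finset.sum_mul_sq_le_sq_mul_sq _ _ _

lemma quad_nonneg (hg : v.g.PosDef) (x : Fin 3 → ℝ) : 0 ≤ x ⬝ᵥ v.g *ᵥ x := by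
  simpa using hg.posSemidef.dotProduct_mulVec_nonneg x

lemma ESq_nonneg (hg : v.g.PosDef) : 0 ≤ v.ESq := by
  rw [ESq, quad_eq]; exact quad_nonneg hg _

lemma FSq_nonneg (hg : v.g.PosDef) : 0 ≤ v.FSq := by
  obtain ⟨D, B, h, h1⟩ := v.frame_of_posDef hg
  rw [← frame_FSq v h, FSq_of_g_eq_one h1]
  positivity

lemma kSq_nonneg (hg : v.g.PosDef) : 0 ≤ v.kSq := by
  obtain ⟨D, B, h, h1⟩ := v.frame_of_posDef hg
  rw [← frame_kSq v h, kSq_of_g_eq_one h1]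
  positivity

lemma τ00_nonneg (hg : v.g.PosDef) : 0 ≤ v.τ00 := by
  have := ESq_nonneg hg
  have := FSq_nonneg hg
  rw [τ00]; positivity

/-- Cauchy–Schwarz between `k` and the metric, whose squared norm is three. -/
lemma H_sq_le (hg : v.g.PosDef) : v.H ^ 2 ≤ 3 * v.kSq := by
  obtain ⟨D, B, h, h1⟩ := v.frame_of_posDef hg
  rw [← frame_kSq v h, ← frame_H v h, kSq_of_g_eq_one h1, H_of_g_eq_one h1]
  simp only [Fin.sum_univ_three]
  generalize (v.frame D B).k = k
  nlinarith [sq_nonneg (k 0 0 - k 1 1), sq_nonneg (k 1 1 - k 2 2), sq_nonneg (k 0 0 - k 2 2),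
    sq_nonneg (k 0 1), sq_nonneg (k 0 2), sq_nonneg (k 1 0), sq_nonneg (k 1 2), sq_nonneg (k 2 0),
    sq_nonneg (k 2 1)]

/-- A positive definite form dominates a multiple of the Euclidean one. -/
lemma exists_coercive (hg : v.g.PosDef) :
    ∃ c > 0, ∀ x : Fin 3 → ℝ, c * (x ⬝ᵥ x) ≤ x ⬝ᵥ v.g *ᵥ x := by
  obtain ⟨D, B, h, h1⟩ := v.frame_of_posDef hg
  set S := ∑ i, ∑ j, D i j ^ 2 with hS
  have hS0 : 0 ≤ S := by positivity
  -- With `x = D y` and `|y|² = g(x,x)` one has `|x|² ≤ S |y|²`; the added one only guarantees a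
  -- positive denominator.
  refine ⟨1 / (S + 1), by positivity, fun x => ?_⟩
  rw [← quad_frame h v.g x x, ← frame_g v (B := B), h1, one_mulVec]
  have hx : x = D *ᵥ (B *ᵥ x) := by rw [mulVec_mulVec, h, one_mulVec]
  set y := B *ᵥ x
  have key : x ⬝ᵥ x ≤ S * (y ⬝ᵥ y) := by
    rw [hx]
    simp only [dotProduct, ← pow_two, hS, Finset.sum_mul]
    refine Finset.sum_le_sum fun i _ => ?_
    rw [← Finset.sum_mul]
    exact Finset.sum_mul_sq_le_sq_mul_sq Finset.univ (fun j => D i j) y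
  have hy : 0 ≤ y ⬝ᵥ y := by simp only [dotProduct, ← pow_two]; positivity
  rw [div_mul_eq_mul_div, one_mul, div_le_iff₀ (by positivity)]
  nlinarith

end State

/-! ### Solutions on a bounded interval and their constraints -/

/-- `v` solves the evolution system on `[0, T]`. -/
structure IsSolutionOn (C : Fin 3 → Fin 3 → Fin 3 → ℝ) (Λ m : ℝ) (v : ℝ → State) (T : ℝ) : Prop where
  admissible : ∀ t ∈ Set.Icc 0 T, (v t).Admissible
  evolves : ∀ t ∈ Set.Icc 0 T, EvolvesAt C Λ m v (Set.Icc 0 T) t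

namespace IsSolutionOn

variable {C : Fin 3 → Fin 3 → Fin 3 → ℝ} {Λ m : ℝ} {v : ℝ → State} {T : ℝ}

lemma continuousOn_H (hv : IsSolutionOn C Λ m v T) (hC : IsAntisymm C) :
    ContinuousOn (fun t => (v t).H) (Set.Icc 0 T) := fun t ht =>
  ((hv.evolves t ht).H hC (hv.admissible t ht).g_posDef
    (hv.admissible t ht).k_symm).continuousWithinAt

/-- The constraints are propagated. -/
lemma constraints (hv : IsSolutionOn C Λ m v T) (hC : IsAntisymm C) (hJ : IsJacobi C)
    (h0 : (v 0).Constraints C Λ m) : ∀ t ∈ Set.Icc 0 T, (v t).Constraints C Λ m := by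
  rw [State.constraints_iff] at h0
  obtain ⟨hham, hmom, hmag, hgauss⟩ := h0
  have hH := hv.continuousOn_H hC
  -- The order matters: the momentum equation is homogeneous only where the Maxwell constraints
  -- hold, and the Hamiltonian one only where the momentum constraint holds.
  have mag : ∀ t ∈ Set.Icc 0 T, ∀ i j k, (v t).magneticDefect C i j k = 0 := fun t ht i j k =>
    eq_zero_of_linear (c := fun _ => 0) (y := fun t => (v t).magneticDefect C i j k)
      continuousOn_const
      (fun r hr => by simpa using (hv.evolves r hr).magneticDefect hC hJ i j k) (hmag i j k) t ht
  have gauss : ∀ t ∈ Set.Icc 0 T, (v t).gaussDefect C = 0 :=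
    eq_zero_of_linear hH (fun r hr => (hv.evolves r hr).gaussDefect hC hJ
      (hv.admissible r hr).g_posDef (hv.admissible r hr).F_antisymm (hv.admissible r hr).ρ_pos) hgauss
  have mom : ∀ t ∈ Set.Icc 0 T, ∀ j, (v t).momentumDefect C j = 0 := fun t ht j =>
    eq_zero_of_linear (y := fun t => (v t).momentumDefect C j) hH
      (fun r hr => (hv.evolves r hr).momentumDefect hC hJ hr
        (fun q hq => ⟨(hv.admissible q hq).g_posDef, (hv.admissible q hq).k_symm⟩)
        (hv.admissible r hr).F_antisymm (hv.admissible r hr).ρ_pos (mag r hr) (gauss r hr) j)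
      (hmom j) t ht
  have ham : ∀ t ∈ Set.Icc 0 T, (v t).hamiltonianDefect C Λ m = 0 :=
    eq_zero_of_linear (c := fun t => 2 * (v t).H) (continuousOn_const.mul hH)
      (fun r hr => (hv.evolves r hr).hamiltonianDefect hC (hv.admissible r hr).g_posDef
        (hv.admissible r hr).k_symm (hv.admissible r hr).F_antisymm (hv.admissible r hr).ρ_pos
        (mom r hr)) hham
  intro t ht
  rw [State.constraints_iff]
  exact ⟨ham t ht, mom t ht, mag t ht, gauss t ht⟩

lemma Φ_le (hv : IsSolutionOn C Λ m v T) : ∀ t ∈ Set.Icc 0 T, (v 0).Φ ≤ (v t).Φ :=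
  le_of_deriv_nonneg (fun r hr => (hv.evolves r hr).Φ_eq) fun _ _ => Real.sqrt_nonneg _

end IsSolutionOn


/-! ### Trapping of the mean curvature and energy bounds -/

/-- Admissible initial data satisfying the constraints that are expanding, have `Φ > 0`, and whose
cosmological constant exceeds `-4 π m² Φ²`, in a frame whose left invariant metrics all have
nonpositive scalar curvature. -/
structure IsExpandingData (C : Fin 3 → Fin 3 → Fin 3 → ℝ) (Λ m : ℝ) (v₀ : State) : Prop where
  antisymm : IsAntisymm C
  jacobi : IsJacobi C
  R_nonpos : ∀ w : State, w.g.PosDef → w.R C ≤ 0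
  m_pos : 0 < m
  admissible : v₀.Admissible
  constraints : v₀.Constraints C Λ m
  Φ_pos : 0 < v₀.Φ
  lt_Λ : -4 * Real.pi * m ^ 2 * v₀.Φ ^ 2 < Λ
  H_neg : v₀.H < 0

namespace State

/-- The quantity that bounds the energy densities of a solution issued from `v₀`. -/
def energyBound (v₀ : State) (Λ : ℝ) : ℝ := v₀.H ^ 2 + 2 * |Λ|

lemma energyBound_nonneg (v₀ : State) (Λ : ℝ) : 0 ≤ v₀.energyBound Λ := by
  rw [energyBound]; positivity

end State

namespace IsSolutionOn

variable {C : Fin 3 → Fin 3 → Fin 3 → ℝ} {Λ m : ℝ} {v : ℝ → State} {T : ℝ}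

lemma matter_nonneg (hv : IsSolutionOn C Λ m v T) {t : ℝ} (ht : t ∈ Set.Icc 0 T) :
    0 ≤ (v t).U ∧ 0 ≤ (v t).τ00 ∧ (v t).ρ ≤ (v t).ρ * (v t).uZero ^ 2 := by
  have ha := hv.admissible t ht
  refine ⟨ha.U_nonneg, State.τ00_nonneg ha.g_posDef, ?_⟩
  exact le_mul_of_one_le_right ha.ρ_pos.le (one_le_pow₀ (State.one_le_uZero _ ha.g_posDef))

section

variable (hv : IsSolutionOn C Λ m v T) (h0 : IsExpandingData C Λ m (v 0)) {t : ℝ}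
  (ht : t ∈ Set.Icc 0 T)
include hv h0 ht

/-- The Hamiltonian constraint with the nonpositive scalar curvature discarded. -/
lemma energy_le_H_sq : (v t).kSq + 16 * Real.pi * ((v t).U + (v t).τ00
    + (v t).ρ * (v t).uZero ^ 2) + 8 * Real.pi * m ^ 2 * (v t).Φ ^ 2 + 2 * Λ ≤ (v t).H ^ 2 := by
  have h := (hv.constraints h0.antisymm h0.jacobi h0.constraints t ht).hamiltonian
  have hR := h0.R_nonpos _ (hv.admissible t ht).g_posDef
  rw [State.T00] at h
  linarith

lemma mass_le : (v 0).Φ ^ 2 ≤ (v t).Φ ^ 2 :=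
  pow_le_pow_left₀ h0.Φ_pos.le (hv.Φ_le t ht) 2

/-- Omitting the matter leaves `kSq + 2 (Λ + 4π m² Φ²) ≤ H²`. Combined with `H² ≤ 3 kSq`,
eliminating `H²` gives the first bound and eliminating `kSq` the second. -/
lemma potential_le : Λ + 4 * Real.pi * m ^ 2 * (v t).Φ ^ 2 ≤ (v t).kSq ∧
    3 * (Λ + 4 * Real.pi * m ^ 2 * (v t).Φ ^ 2) ≤ (v t).H ^ 2 := by
  have ha := hv.admissible t ht
  have h1 := hv.energy_le_H_sq h0 ht
  obtain ⟨h2, h3, h4⟩ := hv.matter_nonneg ht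
  have h5 := State.H_sq_le ha.g_posDef
  have h6 : 0 ≤ 16 * Real.pi * ((v t).U + (v t).τ00 + (v t).ρ * (v t).uZero ^ 2) :=
    mul_nonneg (by positivity) (by linarith [ha.ρ_pos])
  constructor <;> linarith

/-- Because `Φ` does not decrease, the initial strict inequality on `Λ` keeps the lower bound for
`H²` positive. -/
lemma H_ne_zero : (v t).H ≠ 0 := by
  intro h
  have h1 := (hv.potential_le h0 ht).2
  have h2 := mul_le_mul_of_nonneg_left (hv.mass_le h0 ht)
    (show 0 ≤ 4 * Real.pi * m ^ 2 by positivity)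
  have h3 := h0.lt_Λ
  rw [h] at h1
  linarith

lemma H_neg : (v t).H < 0 := by
  by_contra! h
  have hcont := (hv.continuousOn_H h0.antisymm).mono (Set.Icc_subset_Icc_right ht.2)
  obtain ⟨r, hr, hr'⟩ := intermediate_value_Icc ht.1 hcont ⟨h0.H_neg.le, h⟩
  exact hv.H_ne_zero h0 (t := r) ⟨hr.1, hr.2.trans ht.2⟩ hr'

/-- Substituting the constraint for `R` gives `H' = kSq - (Λ + 4π m² Φ²) + 16πU + 8πτ00 + 8πρ(u⁰)² -
4πρ`. The first difference is nonnegative by `potential_le`, and `(u⁰)² ≥ 1` handles the last term.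
-/
lemma H_zero_le : (v 0).H ≤ (v t).H := by
  refine le_of_deriv_nonneg (fun r hr => (hv.evolves r hr).H h0.antisymm
    (hv.admissible r hr).g_posDef (hv.admissible r hr).k_symm) (fun r hr => ?_) t ht
  have h := (hv.constraints h0.antisymm h0.jacobi h0.constraints r hr).hamiltonian
  rw [State.T00] at h
  have h1 := (hv.potential_le h0 hr).1
  obtain ⟨h2, h3, h4⟩ := hv.matter_nonneg hr
  have h2' := mul_nonneg Real.pi_pos.le h2
  have h3' := mul_nonneg Real.pi_pos.le h3
  have h4' := mul_le_mul_of_nonneg_left h4 Real.pi_pos.le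
  have h5' := mul_nonneg Real.pi_pos.le (hv.admissible r hr).ρ_pos.le
  linarith

lemma energy_le : (v t).kSq + 16 * Real.pi * ((v t).U + (v t).τ00
    + (v t).ρ * (v t).uZero ^ 2) + 8 * Real.pi * m ^ 2 * (v t).Φ ^ 2
    ≤ (v 0).energyBound Λ := by
  have h1 := hv.energy_le_H_sq h0 ht
  have h2 : (v t).H ^ 2 ≤ (v 0).H ^ 2 := by
    have := hv.H_neg h0 ht
    have := hv.H_zero_le h0 ht
    nlinarith
  rw [State.energyBound]
  linarith [neg_abs_le Λ]

lemma kSq_le : (v t).kSq ≤ (v 0).energyBound Λ := by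
  have h1 := hv.energy_le h0 ht
  obtain ⟨h2, h3, h4⟩ := hv.matter_nonneg ht
  have h5 : 0 ≤ 16 * Real.pi * ((v t).U + (v t).τ00 + (v t).ρ * (v t).uZero ^ 2) :=
    mul_nonneg (by positivity) (by linarith [(hv.admissible t ht).ρ_pos])
  have h6 : 0 ≤ 8 * Real.pi * m ^ 2 * (v t).Φ ^ 2 := by positivity
  linarith

/-- The energy estimate bounds a sum of nonnegative terms; the numerical factors are discarded using
`π ≥ 1`. -/
lemma matter_le : (v t).U ≤ (v 0).energyBound Λ ∧ (v t).ESq ≤ (v 0).energyBound Λ ∧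
    (v t).FSq ≤ (v 0).energyBound Λ ∧ (v t).ρ ≤ (v 0).energyBound Λ ∧
    (m * (v t).Φ) ^ 2 ≤ (v 0).energyBound Λ := by
  have ha := hv.admissible t ht
  have h1 := hv.energy_le h0 ht
  obtain ⟨h2, h3, h4⟩ := hv.matter_nonneg ht
  have hk := State.kSq_nonneg ha.g_posDef
  have hE := State.ESq_nonneg ha.g_posDef
  have hF := State.FSq_nonneg ha.g_posDef
  have hρ := ha.ρ_pos
  have hτ : (v t).τ00 = (v t).ESq / 2 + (v t).FSq / 4 := rfl
  have hπ : (1 : ℝ) ≤ Real.pi := by linarith [Real.two_le_pi]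
  have scale : ∀ x : ℝ, 0 ≤ x → x ≤ Real.pi * x := fun x hx => le_mul_of_one_le_left hx hπ
  have s1 := scale _ h2
  have s2 := scale _ hE
  have s3 := scale _ hF
  have s4 := scale _ (show 0 ≤ (v t).ρ * (v t).uZero ^ 2 by positivity)
  have s5 := scale _ (show 0 ≤ m ^ 2 * (v t).Φ ^ 2 by positivity)
  have e5 : (m * (v t).Φ) ^ 2 = m ^ 2 * (v t).Φ ^ 2 := mul_pow _ _ _
  have p5 : 0 ≤ m ^ 2 * (v t).Φ ^ 2 := by positivity
  refine ⟨?_, ?_, ?_, ?_, ?_⟩ <;> nlinarith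

end

end IsSolutionOn


/-! ### A priori bounds for all components -/

lemma single_dotProduct_mulVec_single (X : Matrix (Fin 3) (Fin 3) ℝ) (i j : Fin 3) :
    Pi.single i 1 ⬝ᵥ X *ᵥ Pi.single j 1 = X i j := by simp

lemma sq_le_dotProduct_self (x : Fin 3 → ℝ) (i : Fin 3) : x i ^ 2 ≤ x ⬝ᵥ x := by
  simp only [dotProduct, ← pow_two]
  exact Finset.single_le_sum (f := fun i => x i ^ 2) (fun j _ => sq_nonneg (x j)) (Finset.mem_univ i)

lemma abs_dotProduct_le {M : ℝ} (a x : Fin 3 → ℝ) (hx : ∀ i, |x i| ≤ M) :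
    |a ⬝ᵥ x| ≤ (∑ i, |a i|) * M := by
  rw [dotProduct, Finset.sum_mul]
  refine (Finset.abs_sum_le_sum_abs _ _).trans (Finset.sum_le_sum fun i _ => ?_)
  rw [abs_mul]
  exact mul_le_mul_of_nonneg_left (hx i) (abs_nonneg _)

/-- All components of `v` are at most `M` in absolute value, and `g` and `ρ` are bounded below. -/
structure State.IsBounded (v : State) (M c : ℝ) : Prop where
  g_le : ∀ i j, |v.g i j| ≤ M
  k_le : ∀ i j, |v.k i j| ≤ M
  E_le : ∀ i, |v.E i| ≤ M
  F_le : ∀ i j, |v.F i j| ≤ M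
  u_le : ∀ i, |v.u i| ≤ M
  Φ_le : |v.Φ| ≤ M
  ρ_le : |v.ρ| ≤ M
  e_le : |v.e| ≤ M
  H_le : |v.H| ≤ M
  le_g : ∀ x, c * (x ⬝ᵥ x) ≤ x ⬝ᵥ v.g *ᵥ x
  le_ρ : c ≤ v.ρ

namespace IsSolutionOn

variable {C : Fin 3 → Fin 3 → Fin 3 → ℝ} {Λ m : ℝ} {v : ℝ → State} {T : ℝ}

lemma e_div_ρ_eq (hv : IsSolutionOn C Λ m v T) {t : ℝ} (ht : t ∈ Set.Icc 0 T) :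
    (v t).e / (v t).ρ = (v 0).e / (v 0).ρ := by
  have := eq_zero_of_linear (c := fun _ => 0) (y := fun t => (v t).e / (v t).ρ - (v 0).e / (v 0).ρ)
    continuousOn_const (fun r hr => by
      simpa using (hv.evolves r hr).e_div_ρ (hv.admissible r hr).ρ_pos)
    (sub_self _) t ht
  linarith

lemma hasDerivWithinAt_quad (hv : IsSolutionOn C Λ m v T) {t : ℝ} (ht : t ∈ Set.Icc 0 T)
    (x : Fin 3 → ℝ) : HasDerivWithinAt (fun s => x ⬝ᵥ (v s).g *ᵥ x)
    (-2 * (x ⬝ᵥ (v t).k *ᵥ x)) (Set.Icc 0 T) t := by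
  simp only [← State.quad_eq, Finset.mul_sum]
  refine (HasDerivWithinAt.fun_sum fun i _ => HasDerivWithinAt.fun_sum fun j _ =>
    (((hv.evolves t ht).g_eq i j).mul_const _).mul_const _).congr_deriv ?_
  exact Finset.sum_congr rfl fun _ _ => Finset.sum_congr rfl fun _ _ => by ring

section

variable (hv : IsSolutionOn C Λ m v T) (h0 : IsExpandingData C Λ m (v 0)) {t : ℝ}
  (ht : t ∈ Set.Icc 0 T)
include hv h0 ht

/-- Cauchy–Schwarz relative to `g`. Since `g' = -2 k`, this bounds the logarithmic derivative of
`g(x,x)` for fixed `x`, and so yields both bounds on the metric. -/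
lemma abs_quad_k_le (x : Fin 3 → ℝ) :
    |x ⬝ᵥ (v t).k *ᵥ x| ≤ √((v 0).energyBound Λ) * (x ⬝ᵥ (v t).g *ᵥ x) := by
  have hg := (hv.admissible t ht).g_posDef
  have hN := State.energyBound_nonneg (v 0) Λ
  have hx := State.quad_nonneg hg x
  apply abs_le_of_sq_le_sq _ (by positivity)
  rw [mul_pow, Real.sq_sqrt hN, pow_two (x ⬝ᵥ (v t).g *ᵥ x)]
  exact (State.quad_sq_le hg (v t).k x x).trans
    (mul_le_mul_of_nonneg_right (hv.kSq_le h0 ht) (by positivity))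

lemma quad_le (x : Fin 3 → ℝ) : x ⬝ᵥ (v t).g *ᵥ x
    ≤ (x ⬝ᵥ (v 0).g *ᵥ x) * Real.exp (2 * √((v 0).energyBound Λ) * t) := by
  refine le_mul_exp_of_deriv_le (fun r hr => hv.hasDerivWithinAt_quad hr x) (fun r hr => ?_) t ht
  have := (abs_le.mp (hv.abs_quad_k_le h0 hr x)).1
  linarith

lemma le_quad (x : Fin 3 → ℝ) :
    (x ⬝ᵥ (v 0).g *ᵥ x) * Real.exp (-(2 * √((v 0).energyBound Λ)) * t) ≤ x ⬝ᵥ (v t).g *ᵥ x := by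
  refine mul_exp_le_of_le_deriv (fun r hr => hv.hasDerivWithinAt_quad hr x) (fun r hr => ?_) t ht
  have := (abs_le.mp (hv.abs_quad_k_le h0 hr x)).2
  linarith

/-- The constant ratio `e/ρ` makes the electric force term in `uQuad` controllable: `|g(u,E)| ≤ √N
(1 + g(u,u))`, where `N` is the energy bound. This accounts for the `8π e/ρ` in the rate, and
`k(u,u)` for the `2`. -/
lemma uZero_sq_le : (v t).uZero ^ 2 ≤ (v 0).uZero ^ 2 * Real.exp
    ((2 + 8 * Real.pi * ((v 0).e / (v 0).ρ)) * √((v 0).energyBound Λ) * t) := by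
  have h00 : (0 : ℝ) ∈ Set.Icc 0 T := ⟨le_rfl, ht.1.trans ht.2⟩
  rw [State.uZero_sq _ (hv.admissible t ht).g_posDef,
    State.uZero_sq _ (hv.admissible 0 h00).g_posDef]
  refine le_mul_exp_of_deriv_le (fun r hr => (hv.evolves r hr).uQuad h0.antisymm
    (hv.admissible r hr).g_posDef (hv.admissible r hr).F_antisymm) (fun r hr => ?_) t ht
  have hg := (hv.admissible r hr).g_posDef
  have hN := State.energyBound_nonneg (v 0) Λ
  have hq : 0 ≤ (v 0).e / (v 0).ρ :=
    div_nonneg (hv.admissible 0 h00).e_nonneg (hv.admissible 0 h00).ρ_pos.le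
  have hu := State.quad_nonneg hg (v r).u
  have h1 := (abs_le.mp (hv.abs_quad_k_le h0 hr (v r).u)).2
  have h2 : |(v r).u ⬝ᵥ (v r).g *ᵥ (v r).E|
      ≤ √((v 0).energyBound Λ) * (1 + (v r).u ⬝ᵥ (v r).g *ᵥ (v r).u) := by
    apply abs_le_of_sq_le_sq _ (by positivity)
    rw [mul_pow, Real.sq_sqrt hN]
    have hE := (hv.matter_le h0 hr).2.1
    have hE0 := State.ESq_nonneg hg
    rw [State.ESq, State.quad_eq] at hE hE0
    calc _ ≤ _ := State.inner_sq_le hg (v r).u (v r).E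
      _ ≤ (1 + (v r).u ⬝ᵥ (v r).g *ᵥ (v r).u) ^ 2 * (v 0).energyBound Λ := by
        apply mul_le_mul _ hE hE0 (by positivity)
        nlinarith
      _ = _ := by ring
  have h3 := (abs_le.mp h2).1
  have hK := Real.sqrt_nonneg ((v 0).energyBound Λ)
  rw [hv.e_div_ρ_eq hr]
  have h4 := mul_le_mul_of_nonneg_left h3 (show 0 ≤ 8 * Real.pi * ((v 0).e / (v 0).ρ) by positivity)
  linarith

/-- Particle conservation contains no work term, so `ρ u⁰` decays at most at the rate of the initial
mean curvature plus the trace term. A bound on `u⁰` then keeps `ρ` away from zero. -/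
lemma le_ρ_mul_uZero {A : ℝ} (hA : ∀ r ∈ Set.Icc 0 T, |trConst C ⬝ᵥ (v r).u| ≤ A) :
    (v 0).ρ * Real.exp (-(|(v 0).H| + A) * t) ≤ (v t).ρ * (v t).uZero := by
  have h00 : (0 : ℝ) ∈ Set.Icc 0 T := ⟨le_rfl, ht.1.trans ht.2⟩
  have key := mul_exp_le_of_le_deriv (K := -(|(v 0).H| + A)) (fun r hr =>
    (hv.evolves r hr).ρ_mul_uZero h0.antisymm
    (hv.admissible r hr).g_posDef (hv.admissible r hr).F_antisymm (hv.admissible r hr).ρ_pos)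
    (fun r hr => ?_) t ht
  · refine le_trans (mul_le_mul_of_nonneg_right ?_ (Real.exp_pos _).le) key
    exact le_mul_of_one_le_right (hv.admissible 0 h00).ρ_pos.le
      (State.one_le_uZero _ (hv.admissible 0 h00).g_posDef)
  · have hρ := (hv.admissible r hr).ρ_pos
    have hu := State.one_le_uZero _ (hv.admissible r hr).g_posDef
    have h1 := (abs_le.mp (hA r hr)).2
    have h2 := hv.H_zero_le h0 hr
    have h3 := neg_abs_le (v 0).H
    have h4 : 0 ≤ A := (abs_nonneg _).trans (hA r hr)
    have h5 : (v r).ρ ≤ (v r).ρ * (v r).uZero := le_mul_of_one_le_right hρ.le hu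
    have h6 := mul_le_mul_of_nonneg_left h1 hρ.le
    have h7 := mul_le_mul_of_nonneg_right h5 h4
    have h8 := mul_le_mul_of_nonneg_right (h3.trans h2) (hρ.le.trans h5)
    linarith

end

end IsSolutionOn

/-- A priori bounds for all solutions with given expanding data on bounded time intervals. -/
lemma IsExpandingData.exists_isBounded {C : Fin 3 → Fin 3 → Fin 3 → ℝ} {Λ m : ℝ} {v₀ : State}
    (h0 : IsExpandingData C Λ m v₀) (T₀ : ℝ) :
    ∃ M, ∃ c > 0, ∀ (v : ℝ → State) (T : ℝ), T ≤ T₀ → v 0 = v₀ → IsSolutionOn C Λ m v T →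
      ∀ t ∈ Set.Icc 0 T, (v t).IsBounded M c := by
  obtain ⟨c₀, hc₀, hcoer⟩ := State.exists_coercive h0.admissible.g_posDef
  set N := v₀.energyBound Λ with hNdef
  have hN : 0 ≤ N := State.energyBound_nonneg _ _
  set K := √N with hKdef
  have hK : 0 ≤ K := Real.sqrt_nonneg _
  have hKsq : K ^ 2 = N := Real.sq_sqrt hN
  set q := v₀.e / v₀.ρ with hqdef
  have hq : 0 ≤ q := div_nonneg h0.admissible.e_nonneg h0.admissible.ρ_pos.le
  have hg0 : ∀ i, 0 ≤ v₀.g i i := fun i => by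
    simpa only [single_dotProduct_mulVec_single] using
      State.quad_nonneg h0.admissible.g_posDef (Pi.single i 1)
  -- `G` bounds the diagonal of `g` and hence, by Cauchy–Schwarz, all its entries. Below, `c₁` is
  -- the coercivity constant of `g`, `P` bounds `(u⁰)²` and `A` bounds the trace covector on `u`.
  set G := (∑ i, v₀.g i i) * Real.exp (2 * K * T₀) with hGdef
  have hG : 0 ≤ G := mul_nonneg (Finset.sum_nonneg fun i _ => hg0 i) (Real.exp_pos _).le
  set c₁ := c₀ * Real.exp (-(2 * K) * T₀) with hc₁def
  have hc₁ : 0 < c₁ := mul_pos hc₀ (Real.exp_pos _)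
  set P := v₀.uZero ^ 2 * Real.exp ((2 + 8 * Real.pi * q) * K * T₀) with hPdef
  have hP : 0 ≤ P := by positivity
  set A := (∑ i, |trConst C i|) * √(P / c₁) with hAdef
  have hA : 0 ≤ A := by positivity
  have hρ0 := h0.admissible.ρ_pos
  -- The lower bound for `ρ u⁰` divided by `1 + P`, which exceeds `u⁰` because `1 ≤ u⁰` and `(u⁰)² ≤
  -- P`.
  set r₀ := v₀.ρ * Real.exp (-(|v₀.H| + A) * T₀) / (1 + P) with hr₀def
  have hr₀ : 0 < r₀ := by positivity
  have hm := h0.m_pos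
  -- The summands bound `g`; `k` and `F`; `E`; `u`; `Φ`; `ρ`; `e`; `H`, in this order. All are
  -- nonnegative, so the sum dominates each.
  refine ⟨G + K * G + √(N / c₁) + √(P / c₁) + K / m + N + q * N + |v₀.H|, min c₁ r₀,
    lt_min hc₁ hr₀, ?_⟩
  rintro v T hT rfl hv t ht
  have ht₀ : t ≤ T₀ := ht.2.trans hT
  have s0 := abs_nonneg (v 0).H
  have s1 : 0 ≤ K * G := by positivity
  have s2 := Real.sqrt_nonneg (N / c₁)
  have s3 := Real.sqrt_nonneg (P / c₁)
  have s4 : 0 ≤ K / m := by positivity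
  have s5 : 0 ≤ q * N := by positivity
  have hdiag : ∀ i, (v t).g i i ≤ G := fun i => by
    have h1 := hv.quad_le h0 ht (Pi.single i 1)
    simp only [single_dotProduct_mulVec_single] at h1
    refine h1.trans (mul_le_mul (Finset.single_le_sum (f := fun i => (v 0).g i i)
      (fun i _ => hg0 i) (Finset.mem_univ i)) ?_ (Real.exp_pos _).le
      (Finset.sum_nonneg fun i _ => hg0 i))
    exact Real.exp_le_exp.mpr (mul_le_mul_of_nonneg_left ht₀ (by positivity))
  have hg := (hv.admissible t ht).g_posDef
  have hdiag0 : ∀ i, 0 ≤ (v t).g i i := fun i => by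
    simpa only [single_dotProduct_mulVec_single] using State.quad_nonneg hg (Pi.single i 1)
  have hdd : ∀ i j, (v t).g i i * (v t).g j j ≤ G ^ 2 := fun i j => by
    rw [pow_two]; exact mul_le_mul (hdiag i) (hdiag j) (hdiag0 j) hG
  obtain ⟨hU, hE, hF, hρ, hΦ⟩ := hv.matter_le h0 ht
  have hcoer' : ∀ r ∈ Set.Icc 0 T, ∀ x : Fin 3 → ℝ, c₁ * (x ⬝ᵥ x) ≤ x ⬝ᵥ (v r).g *ᵥ x := by
    intro r hr x
    refine le_trans ?_ (hv.le_quad h0 hr x)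
    rw [hc₁def, mul_right_comm]
    refine mul_le_mul (hcoer x) (Real.exp_le_exp.mpr ?_) (Real.exp_pos _).le
      (State.quad_nonneg h0.admissible.g_posDef x)
    exact mul_le_mul_of_nonpos_left (hr.2.trans hT) (by linarith)
  have vec : ∀ r ∈ Set.Icc 0 T, ∀ (x : Fin 3 → ℝ) (B : ℝ), x ⬝ᵥ (v r).g *ᵥ x ≤ B →
      ∀ i, |x i| ≤ √(B / c₁) := by
    intro r hr x B hB i
    apply Real.abs_le_sqrt
    rw [le_div_iff₀ hc₁]
    have := mul_le_mul_of_nonneg_left (sq_le_dotProduct_self x i) hc₁.le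
    linarith [hcoer' r hr x]
  have hu0 : ∀ r ∈ Set.Icc 0 T, (v r).uZero ^ 2 ≤ P := by
    intro r hr
    refine (hv.uZero_sq_le h0 hr).trans (mul_le_mul_of_nonneg_left ?_ (sq_nonneg _))
    exact Real.exp_le_exp.mpr (mul_le_mul_of_nonneg_left (hr.2.trans hT) (by positivity))
  have hu : ∀ r ∈ Set.Icc 0 T, ∀ i, |(v r).u i| ≤ √(P / c₁) := by
    intro r hr
    apply vec r hr
    have := State.uZero_sq _ (hv.admissible r hr).g_posDef
    linarith [hu0 r hr]
  have hep : (v t).e = q * (v t).ρ := by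
    rw [hqdef, ← hv.e_div_ρ_eq ht, div_mul_cancel₀ _ (hv.admissible t ht).ρ_pos.ne']
  have hρt := (hv.admissible t ht).ρ_pos
  have hGi : ∀ X : Matrix (Fin 3) (Fin 3) ℝ,
      (∑ i, ∑ j, ∑ l, ∑ p, (v t).gInv i l * (v t).gInv j p * X i j * X l p) ≤ N →
      ∀ i j, |X i j| ≤ K * G := by
    intro X hX i j
    apply abs_le_of_sq_le_sq _ s1
    have h1 := State.quad_sq_le hg X (Pi.single i 1) (Pi.single j 1)
    simp only [single_dotProduct_mulVec_single] at h1
    rw [mul_pow, hKsq]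
    exact h1.trans (mul_le_mul hX (hdd i j) (mul_nonneg (hdiag0 i) (hdiag0 j)) hN)
  constructor
  · intro i j
    have h1 := State.inner_sq_le hg (Pi.single i 1) (Pi.single j 1)
    simp only [single_dotProduct_mulVec_single] at h1
    have := abs_le_of_sq_le_sq (h1.trans (hdd i j)) hG
    linarith
  · intro i j
    have := hGi _ (hv.kSq_le h0 ht) i j
    linarith
  · intro i
    have := vec t ht (v t).E N (by rw [← State.quad_eq]; exact hE) i
    linarith
  · intro i j
    have := hGi _ hF i j
    linarith
  · intro i
    have := hu t ht i
    linarith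
  · have h1 := Real.abs_le_sqrt hΦ
    rw [abs_mul, abs_of_pos hm, mul_comm, ← le_div_iff₀ hm] at h1
    linarith
  · rw [abs_of_pos hρt]
    linarith
  · rw [abs_of_nonneg (hv.admissible t ht).e_nonneg, hep]
    have := mul_le_mul_of_nonneg_left hρ hq
    linarith
  · have h1 := hv.H_neg h0 ht
    have h2 := hv.H_zero_le h0 ht
    have h3 : |(v t).H| ≤ |(v 0).H| := by
      rw [abs_of_neg h1, abs_of_neg h0.H_neg]; linarith
    linarith
  · intro x
    refine le_trans (mul_le_mul_of_nonneg_right (min_le_left _ _) ?_) (hcoer' t ht x)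
    simpa using dotProduct_star_self_nonneg x
  · refine (min_le_right _ _).trans ?_
    have h1 := hv.le_ρ_mul_uZero h0 ht (A := A)
      (fun r hr => abs_dotProduct_le _ _ (hu r hr))
    have h2 := State.one_le_uZero _ hg
    have h3 : (v t).uZero ≤ 1 + P := by nlinarith [hu0 t ht]
    rw [hr₀def, div_le_iff₀ (by positivity)]
    calc _ ≤ (v 0).ρ * Real.exp (-(|(v 0).H| + A) * t) := by
          refine mul_le_mul_of_nonneg_left (Real.exp_le_exp.mpr ?_) hρ0.le
          exact mul_le_mul_of_nonpos_left ht₀ (by linarith)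
      _ ≤ _ := h1
      _ ≤ _ := mul_le_mul_of_nonneg_left h3 hρt.le


/-! ### Continuation of integral curves that stay in compact sets -/

section ODE

open Set Filter Topology

variable {ι : Type*} [Fintype ι] {f : (ι → ℝ) → ι → ℝ} {Ω K : Set (ι → ℝ)} {x₀ : ι → ℝ}
  {x y : ℝ → ι → ℝ} {T : ℝ}

/-- `x` is an integral curve of `f` in `Ω` over `[0, T]`. -/
def IsCurveOn (f : (ι → ℝ) → ι → ℝ) (Ω : Set (ι → ℝ)) (x : ℝ → ι → ℝ) (T : ℝ) : Prop :=
  ∀ t ∈ Icc 0 T, x t ∈ Ω ∧ HasDerivWithinAt x (f (x t)) (Icc 0 T) t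

lemma IsCurveOn.continuousOn (hx : IsCurveOn f Ω x T) : ContinuousOn x (Icc 0 T) :=
  fun t ht => (hx t ht).2.continuousWithinAt

lemma IsCurveOn.mono (hx : IsCurveOn f Ω x T) {S : ℝ} (hS : S ≤ T) : IsCurveOn f Ω x S :=
  fun t ht => ⟨(hx t ⟨ht.1, ht.2.trans hS⟩).1,
    (hx t ⟨ht.1, ht.2.trans hS⟩).2.mono (Icc_subset_Icc_right hS)⟩

lemma hasDerivWithinAt_Ici_of_Icc {E : Type*} [NormedAddCommGroup E] [NormedSpace ℝ E]
    {x : ℝ → E} {x' : E} {t : ℝ} (h : HasDerivWithinAt x x' (Icc 0 T) t)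
    (hT : t < T) : HasDerivWithinAt x x' (Ici 0) t := by
  refine h.mono_of_mem_nhdsWithin ?_
  filter_upwards [self_mem_nhdsWithin, mem_nhdsWithin_of_mem_nhds (Iio_mem_nhds hT)] with s h1 h2
  exact ⟨h1, le_of_lt h2⟩

/-- Integral curves of a locally Lipschitz vector field are determined by their initial value. -/
theorem IsCurveOn.eqOn (hf : LocallyLipschitzOn Ω f) (hx : IsCurveOn f Ω x T)
    (hy : IsCurveOn f Ω y T) (h0 : x 0 = y 0) : EqOn x y (Icc 0 T) := by
  have hcomp : IsCompact (x '' Icc 0 T ∪ y '' Icc 0 T) :=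
    (isCompact_Icc.image_of_continuousOn hx.continuousOn).union
      (isCompact_Icc.image_of_continuousOn hy.continuousOn)
  have hsub : x '' Icc 0 T ∪ y '' Icc 0 T ⊆ Ω := by
    rintro _ (⟨t, ht, rfl⟩ | ⟨t, ht, rfl⟩)
    exacts [(hx t ht).1, (hy t ht).1]
  obtain ⟨κ, hκ⟩ := (hf.mono hsub).exists_lipschitzOnWith_of_compact hcomp
  refine ODE_solution_unique_of_mem_Icc_right (v := fun _ => f)
    (s := fun _ => x '' Icc 0 T ∪ y '' Icc 0 T) (K := κ) (fun _ _ => hκ) hx.continuousOn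
    (fun t ht => ?_) (fun t ht => Or.inl ⟨t, Ico_subset_Icc_self ht, rfl⟩) hy.continuousOn
    (fun t ht => ?_) (fun t ht => Or.inr ⟨t, Ico_subset_Icc_self ht, rfl⟩) h0
  · exact (hasDerivWithinAt_Ici_of_Icc (hx t (Ico_subset_Icc_self ht)).2 ht.2).mono (Ici_subset_Ici.mpr ht.1)
  · exact (hasDerivWithinAt_Ici_of_Icc (hy t (Ico_subset_Icc_self ht)).2 ht.2).mono (Ici_subset_Ici.mpr ht.1)

/-- A bounded globally Lipschitz vector field has integral curves over any interval `[0, T]`. -/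
lemma exists_curve_of_bounded {κ : NNReal} {M : ℝ} (hf : LipschitzWith κ f) (hM : 0 ≤ M)
    (hfM : ∀ z, ‖f z‖ ≤ M) (hT : 0 ≤ T) (x₀ : ι → ℝ) :
    ∃ x : ℝ → ι → ℝ, x 0 = x₀ ∧ ∀ t ∈ Icc 0 T, HasDerivWithinAt x (f (x t)) (Icc 0 T) t := by
  -- A curve of speed at most `M` moves at most `M T` in time `T`, so the ball of that radius
  -- suffices.
  have h : IsPicardLindelof (fun _ => f) (⟨0, left_mem_Icc.mpr hT⟩ : Icc 0 T) x₀
      (⟨M, hM⟩ * ⟨T, hT⟩) 0 ⟨M, hM⟩ κ :=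
    { lipschitzOnWith := fun _ _ => hf.lipschitzOnWith
      continuousOn := fun _ _ => continuousOn_const
      norm_le := fun _ _ z _ => hfM z
      mul_max_le := by
        rw [sub_zero, sub_self, max_eq_left hT, NNReal.coe_zero, sub_zero]
        exact le_rfl }
  exact h.exists_eq_forall_mem_Icc_hasDerivWithinAt₀

/-- A Lipschitz vector field on a compact set extends to a bounded globally Lipschitz one. -/
lemma exists_bounded_extension {κ : NNReal} (hK : IsCompact K) (hf : LipschitzOnWith κ f K) :
    ∃ (h : (ι → ℝ) → ι → ℝ) (κ' : NNReal) (M : ℝ), 0 ≤ M ∧ LipschitzWith κ' h ∧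
      (∀ z, ‖h z‖ ≤ M) ∧ EqOn f h K := by
  obtain ⟨g, hg, hfg⟩ := hf.extend_pi
  obtain ⟨M, hM⟩ := hK.exists_bound_of_continuousOn hf.continuousOn
  have hM' : ∀ z ∈ K, ∀ i, |f z i| ≤ |M| := fun z hz i =>
    ((norm_le_pi_norm (f z) i).trans (hM z hz)).trans (le_abs_self M)
  -- Clamping each coordinate of a Lipschitz extension makes it bounded, keeps the Lipschitz
  -- constant, and changes nothing on `K`.
  refine ⟨fun z i => max (-|M|) (min |M| (g z i)), κ, |M|, abs_nonneg M, ?_, ?_, ?_⟩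
  · refine LipschitzWith.of_dist_le_mul fun z w => ?_
    rw [dist_pi_le_iff (by positivity)]
    intro i
    refine le_trans ?_ ((dist_le_pi_dist (g z) (g w) i).trans (hg.dist_le_mul z w))
    have h1 : LipschitzWith 1 fun r : ℝ => max (-|M|) (min |M| r) :=
      (LipschitzWith.id.const_min _).const_max _
    simpa using h1.dist_le_mul (g z i) (g w i)
  · intro z
    rw [pi_norm_le_iff_of_nonneg (abs_nonneg M)]
    intro i
    rw [Real.norm_eq_abs, abs_le]
    exact ⟨le_max_left _ _, max_le (by linarith [abs_nonneg M]) (min_le_left _ _)⟩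
  · intro z hz
    ext i
    have h1 := abs_le.mp (hM' z hz i)
    rw [hfg hz] at h1 ⊢
    change g z i = max (-|M|) (min |M| (g z i))
    rw [min_eq_right h1.2, max_eq_right h1.1]

/-- An integral curve exists over `[0, T]` if all integral curves with the given initial value stay
in a compact set. -/
theorem exists_curve_of_apriori (hΩ : IsOpen Ω) (hf : LocallyLipschitzOn Ω f) (hK : IsCompact K)
    (hKΩ : K ⊆ Ω) (hx₀ : x₀ ∈ Ω) (hT : 0 ≤ T)
    (hap : ∀ (x : ℝ → ι → ℝ), x 0 = x₀ → ∀ t ∈ Icc 0 T, IsCurveOn f Ω x t → x t ∈ K) :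
    ∃ x : ℝ → ι → ℝ, x 0 = x₀ ∧ IsCurveOn f Ω x T := by
  -- The field is modified outside a compact neighbourhood of `K`. The modified equation has a curve
  -- on the whole interval, and it remains to show that this curve never leaves the interior of
  -- `K'`.
  obtain ⟨K', hK', hKK', hK'Ω⟩ := exists_compact_between hK hΩ hKΩ
  obtain ⟨κ, hκ⟩ := (hf.mono hK'Ω).exists_lipschitzOnWith_of_compact hK'
  obtain ⟨h, κ', M, hM, hh, hhM, hfh⟩ := exists_bounded_extension hK' hκ
  obtain ⟨x, hx0, hx⟩ := exists_curve_of_bounded hh hM hhM hT x₀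
  have hcont : ContinuousOn x (Icc 0 T) := fun t ht => (hx t ht).continuousWithinAt
  have step : ∀ t ∈ Icc 0 T, (∀ s ∈ Icc 0 t, x s ∈ K') → IsCurveOn f Ω x t := by
    intro t ht hs s hs'
    refine ⟨hK'Ω (hs s hs'), ?_⟩
    rw [hfh (hs s hs')]
    exact (hx s ⟨hs'.1, hs'.2.trans ht.2⟩).mono (Icc_subset_Icc_right ht.2)
  -- The a priori hypothesis applies to the interval `[0, 0]`, where the derivative within a single
  -- point is no condition.
  have hstart : x 0 ∈ K := by
    refine hap x hx0 0 ⟨le_rfl, hT⟩ fun s hs => ?_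
    obtain rfl : s = 0 := le_antisymm hs.2 hs.1
    refine ⟨hx0 ▸ hx₀, ?_⟩
    rw [Icc_self]
    exact HasFDerivWithinAt.singleton
  have hall : ∀ t ∈ Icc 0 T, x t ∈ interior K' := by
    by_contra! hne
    set B := Icc 0 T ∩ x ⁻¹' (interior K')ᶜ with hB
    have hBc : IsCompact B := isCompact_Icc.of_isClosed_subset
      (hcont.preimage_isClosed_of_isClosed isClosed_Icc isOpen_interior.isClosed_compl)
      inter_subset_left
    obtain ⟨r, ⟨hr, hrK⟩, hmin⟩ := hBc.exists_isLeast (by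
      obtain ⟨t, ht, ht'⟩ := hne
      exact ⟨t, ht, ht'⟩)
    have hbefore : ∀ s ∈ Ico 0 r, x s ∈ interior K' := by
      intro s hs
      by_contra hcon
      exact absurd (hmin ⟨⟨hs.1, hs.2.le.trans hr.2⟩, hcon⟩) (not_le.mpr hs.2)
    -- Before the first exit time `r` the curve solves the original equation, so it lies in `K`; as
    -- `K` is closed, so does `x r`, which contradicts exit from the interior of `K'`.
    have hinK : ∀ s ∈ Ico 0 r, x s ∈ K := fun s hs =>
      hap x hx0 s ⟨hs.1, hs.2.le.trans hr.2⟩ (step s ⟨hs.1, hs.2.le.trans hr.2⟩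
        fun q hq => interior_subset (hbefore q ⟨hq.1, hq.2.trans_lt hs.2⟩))
    apply hrK
    apply hKK'
    rcases hr.1.eq_or_lt with h0 | h0
    · rw [← h0]; exact hstart
    · have hcl : r ∈ closure (Ico 0 r) := by
        rw [closure_Ico h0.ne]; exact ⟨h0.le, le_rfl⟩
      have := ((hcont r hr).mono (Ico_subset_Icc_self.trans (Icc_subset_Icc_right hr.2))).mem_closure
        hcl hinK
      rwa [hK.isClosed.closure_eq] at this
  exact ⟨x, hx0, step T ⟨hT, le_rfl⟩ fun s hs => interior_subset (hall s hs)⟩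

/-- A global integral curve exists if, over bounded time intervals, all integral curves with the
given initial value stay in a compact set. -/
theorem exists_global_curve (hΩ : IsOpen Ω) (hf : LocallyLipschitzOn Ω f) (hx₀ : x₀ ∈ Ω)
    (hap : ∀ T : ℝ, 0 ≤ T → ∃ K, IsCompact K ∧ K ⊆ Ω ∧ ∀ (x : ℝ → ι → ℝ), x 0 = x₀ →
      ∀ t ∈ Icc 0 T, IsCurveOn f Ω x t → x t ∈ K) :
    ∃ x : ℝ → ι → ℝ, x 0 = x₀ ∧
      ∀ t, 0 ≤ t → x t ∈ Ω ∧ HasDerivWithinAt x (f (x t)) (Ici 0) t := by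
  have hsol : ∀ T : ℝ, 0 ≤ T → ∃ x : ℝ → ι → ℝ, x 0 = x₀ ∧ IsCurveOn f Ω x T := by
    intro T hT
    obtain ⟨K, hK, hKΩ, h⟩ := hap T hT
    exact exists_curve_of_apriori hΩ hf hK hKΩ hx₀ hT h
  choose! z hz0 hz using hsol
  have hag : ∀ S T t : ℝ, t ∈ Icc 0 S → t ∈ Icc 0 T → z S t = z T t := by
    intro S T t hS hT
    have h0 : 0 ≤ t := hS.1
    refine ((hz S (h0.trans hS.2)).mono hS.2).eqOn hf ((hz T (h0.trans hT.2)).mono hT.2) ?_ ⟨h0, le_rfl⟩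
    rw [hz0 S (h0.trans hS.2), hz0 T (h0.trans hT.2)]
  -- Using the solution on `[0, t + 1]` makes `t` an interior time on the right, so that the
  -- derivative within `[0, +∞)` can be taken there.
  refine ⟨fun t => z (t + 1) t, hz0 (0 + 1) (by norm_num), fun t ht => ?_⟩
  have hmem : t ∈ Icc 0 (t + 1) := ⟨ht, by linarith⟩
  refine ⟨(hz (t + 1) (by linarith) t hmem).1, ?_⟩
  have hd := hasDerivWithinAt_Ici_of_Icc (hz (t + 1) (by linarith) t hmem).2 (lt_add_one t)
  refine hd.congr_of_eventuallyEq ?_ rfl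
  filter_upwards [self_mem_nhdsWithin, mem_nhdsWithin_of_mem_nhds (Iio_mem_nhds (lt_add_one t))]
    with s h1 h2
  exact hag _ _ s ⟨h1, by linarith⟩ ⟨h1, le_of_lt h2⟩

end ODE


/-! ### Regularity of the right-hand sides -/

/-- A family of states whose components are continuously differentiable at a point where the metric
and the densities are nondegenerate. -/
structure ContDiffState {E : Type*} [NormedAddCommGroup E] [NormedSpace ℝ E] (S : E → State)
    (x : E) : Prop where
  g : ∀ i j, ContDiffAt ℝ 1 (fun y => (S y).g i j) x
  k : ∀ i j, ContDiffAt ℝ 1 (fun y => (S y).k i j) x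
  E : ∀ i, ContDiffAt ℝ 1 (fun y => (S y).E i) x
  F : ∀ i j, ContDiffAt ℝ 1 (fun y => (S y).F i j) x
  u : ∀ i, ContDiffAt ℝ 1 (fun y => (S y).u i) x
  Φ : ContDiffAt ℝ 1 (fun y => (S y).Φ) x
  U : ContDiffAt ℝ 1 (fun y => (S y).U) x
  ρ : ContDiffAt ℝ 1 (fun y => (S y).ρ) x
  e : ContDiffAt ℝ 1 (fun y => (S y).e) x
  g_posDef : (S x).g.PosDef
  ρ_pos : 0 < (S x).ρ

namespace ContDiffState

variable {X : Type*} [NormedAddCommGroup X] [NormedSpace ℝ X] {S : X → State} {x : X}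
  (h : ContDiffState S x) (C : Fin 3 → Fin 3 → Fin 3 → ℝ) (Λ m : ℝ)
include h

lemma gInv (i j : Fin 3) : ContDiffAt ℝ 1 (fun y => (S y).gInv i j) x := by
  simp only [State.gInv, inv_fin_three_apply, adjugate_fin_three_apply]
  refine ContDiffAt.mul (ContDiffAt.inv ?_ h.g_posDef.det_pos.ne')
    (((h.g _ _).mul (h.g _ _)).sub ((h.g _ _).mul (h.g _ _)))
  simp only [det_fin_three]
  have := h.g
  fun_prop

lemma H : ContDiffAt ℝ 1 (fun y => (S y).H) x :=
  ContDiffAt.sum fun i _ => ContDiffAt.sum fun j _ => (h.gInv i j).mul (h.k i j)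

lemma kMixed (i j : Fin 3) : ContDiffAt ℝ 1 (fun y => (S y).kMixed i j) x :=
  ContDiffAt.sum fun l _ => (h.gInv i l).mul (h.k l j)

lemma uLow (i : Fin 3) : ContDiffAt ℝ 1 (fun y => (S y).uLow i) x :=
  ContDiffAt.sum fun j _ => (h.g i j).mul (h.u j)

lemma uZero : ContDiffAt ℝ 1 (fun y => (S y).uZero) x := by
  refine ContDiffAt.sqrt (contDiffAt_const.add (ContDiffAt.sum fun i _ =>
    ContDiffAt.sum fun j _ => ((h.g i j).mul (h.u i)).mul (h.u j))) ?_
  rw [State.quad_eq]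
  linarith [State.quad_nonneg h.g_posDef (S x).u]

lemma ESq : ContDiffAt ℝ 1 (fun y => (S y).ESq) x :=
  ContDiffAt.sum fun i _ => ContDiffAt.sum fun j _ => ((h.g i j).mul (h.E i)).mul (h.E j)

lemma FSq : ContDiffAt ℝ 1 (fun y => (S y).FSq) x :=
  ContDiffAt.sum fun i _ => ContDiffAt.sum fun j _ => ContDiffAt.sum fun k _ =>
    ContDiffAt.sum fun l _ => (((h.gInv i k).mul (h.gInv j l)).mul (h.F i j)).mul (h.F k l)

lemma T00 : ContDiffAt ℝ 1 (fun y => (S y).T00 m) x :=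
  h.U.add ((contDiffAt_const.mul (h.Φ.pow 2)).div_const 2)

lemma T (i j : Fin 3) : ContDiffAt ℝ 1 (fun y => (S y).T m i j) x :=
  ((h.g i j).mul ((contDiffAt_const.mul h.U).sub (contDiffAt_const.mul (h.Φ.pow 2)))).div_const 2

lemma τ (i j : Fin 3) : ContDiffAt ℝ 1 (fun y => (S y).τ i j) x := by
  refine ContDiffAt.add (ContDiffAt.sub (ContDiffAt.sub (((h.g i j).mul h.ESq).div_const 2) ?_)
    (((h.g i j).mul h.FSq).div_const 4)) ?_
  · exact (ContDiffAt.sum fun k _ => (h.g i k).mul (h.E k)).mul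
      (ContDiffAt.sum fun k _ => (h.g j k).mul (h.E k))
  · exact ContDiffAt.sum fun k _ => ContDiffAt.sum fun l _ =>
      ((h.gInv k l).mul (h.F i k)).mul (h.F j l)

lemma γ (l i j : Fin 3) : ContDiffAt ℝ 1 (fun y => (S y).γ C l i j) x :=
  contDiffAt_const.mul (ContDiffAt.sum fun k _ => (h.gInv l k).mul (ContDiffAt.sum fun p _ =>
    ((contDiffAt_const.mul (h.g i p)).add (contDiffAt_const.mul (h.g j p))).add
      (contDiffAt_const.mul (h.g k p))))

lemma Ric (i j : Fin 3) : ContDiffAt ℝ 1 (fun y => (S y).Ric C i j) x :=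
  ContDiffAt.sum fun l _ => ContDiffAt.sum fun p _ =>
    (((h.γ C l l p).mul (h.γ C p j i)).sub ((h.γ C p j l).mul (h.γ C l p i))).sub
      (contDiffAt_const.mul (h.γ C p l i))

lemma kRhs (i j : Fin 3) : ContDiffAt ℝ 1 (fun y => (S y).kRhs C Λ m i j) x := by
  refine ((((((h.Ric C i j).add (h.H.mul (h.k i j))).sub (contDiffAt_const.mul ?_)).sub
    (contDiffAt_const.mul (((h.T m i j).add (h.τ i j)).add
      ((h.ρ.mul (h.uLow i)).mul (h.uLow j))))).add
    ((contDiffAt_const.mul (((h.T00 m).neg.sub (h.ρ.mul (h.uZero.pow 2))).add ?_)).mul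
      (h.g i j))).sub (contDiffAt_const.mul (h.g i j)))
  · exact ContDiffAt.sum fun l _ => (h.kMixed l j).mul (h.k i l)
  · exact ContDiffAt.sum fun l _ => ContDiffAt.sum fun p _ =>
      (h.gInv l p).mul ((h.T m l p).add ((h.ρ.mul (h.uLow l)).mul (h.uLow p)))

lemma ERhs (i : Fin 3) : ContDiffAt ℝ 1 (fun y => (S y).ERhs C i) x := by
  refine ((h.H.mul (h.E i)).sub ?_).add ((contDiffAt_const.mul h.e).mul (h.u i))
  exact ContDiffAt.sum fun j _ => ContDiffAt.sum fun k _ => ContDiffAt.sum fun l _ =>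
    ContDiffAt.sum fun p _ => (((contDiffAt_const.mul (h.gInv k l)).mul (h.gInv i p)).add
      ((contDiffAt_const.mul (h.gInv j l)).mul (h.gInv k p))).mul (h.F l p)

lemma FRhs (i j : Fin 3) : ContDiffAt ℝ 1 (fun y => (S y).FRhs C i j) x :=
  ContDiffAt.sum fun k _ => ContDiffAt.sum fun l _ => (contDiffAt_const.mul (h.g k l)).mul (h.E l)

lemma uRhs (i : Fin 3) : ContDiffAt ℝ 1 (fun y => (S y).uRhs C i) x := by
  have h0 : (S x).uZero ≠ 0 := (State.uZero_pos _ h.g_posDef).ne'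
  have hq : ContDiffAt ℝ 1 (fun y => 4 * Real.pi * ((S y).e / (S y).ρ)) x :=
    contDiffAt_const.mul (h.e.div h.ρ h.ρ_pos.ne')
  refine (((contDiffAt_const.mul ?_).sub (ContDiffAt.div ?_ h.uZero h0)).sub
    (hq.mul (h.E i))).add ((hq.mul ?_).div h.uZero h0)
  · exact ContDiffAt.sum fun j _ => (h.kMixed i j).mul (h.u j)
  · exact ContDiffAt.sum fun j _ => ContDiffAt.sum fun k _ =>
      ((h.γ C i j k).mul (h.u j)).mul (h.u k)
  · exact ContDiffAt.sum fun j _ => ContDiffAt.sum fun l _ =>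
      ((h.gInv i l).mul (h.F j l)).mul (h.u j)

lemma expansion : ContDiffAt ℝ 1 (fun y => (S y).expansion C) x := by
  have h0 : (S x).uZero ≠ 0 := (State.uZero_pos _ h.g_posDef).ne'
  refine ((ContDiffAt.div ?_ (h.uZero.pow 2) (pow_ne_zero 2 h0)).add
    (ContDiffAt.div ?_ h.uZero h0)).sub h.H
  · exact ContDiffAt.sum fun i _ => ContDiffAt.sum fun j _ => ((h.k i j).mul (h.u i)).mul (h.u j)
  · exact ContDiffAt.sum fun i _ => ContDiffAt.sum fun j _ => contDiffAt_const.mul (h.u j)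

lemma work : ContDiffAt ℝ 1 (fun y => (S y).work) x :=
  ContDiffAt.div (ContDiffAt.sum fun i _ => ContDiffAt.sum fun j _ =>
    ((h.g i j).mul (h.E j)).mul (h.u i)) (h.uZero.pow 2)
    (pow_ne_zero 2 (State.uZero_pos _ h.g_posDef).ne')

lemma ρRhs : ContDiffAt ℝ 1
    (fun y => -(S y).expansion C * (S y).ρ + 4 * Real.pi * (S y).e * (S y).work) x :=
  ((h.expansion C).neg.mul h.ρ).add ((contDiffAt_const.mul h.e).mul h.work)

lemma eRhs : ContDiffAt ℝ 1 (fun y => -(S y).expansion C * (S y).e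
    + 4 * Real.pi * (S y).work * ((S y).e ^ 2 / (S y).ρ)) x :=
  ((h.expansion C).neg.mul h.e).add
    ((contDiffAt_const.mul h.work).mul ((h.e.pow 2).div h.ρ h.ρ_pos.ne'))

end ContDiffState


/-! ### The evolution system as a vector field -/

/-- Labels of the real coordinates of a state: the entries of `g`, `k` and `F`, those of `E` and
`u`, and the numbers `Φ`, `ψ`, `ρ`, `e`, where `ψ` is a signed variable with `√(2 U) = max ψ 0`. -/
abbrev Coord : Type :=
  (Fin 3 × Fin 3) ⊕ (Fin 3 × Fin 3) ⊕ (Fin 3 × Fin 3) ⊕ Fin 3 ⊕ Fin 3 ⊕ Fin 4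

namespace Coord

abbrev g (i j : Fin 3) : Coord := .inl (i, j)
abbrev k (i j : Fin 3) : Coord := .inr (.inl (i, j))
abbrev F (i j : Fin 3) : Coord := .inr (.inr (.inl (i, j)))
abbrev E (i : Fin 3) : Coord := .inr (.inr (.inr (.inl i)))
abbrev u (i : Fin 3) : Coord := .inr (.inr (.inr (.inr (.inl i))))
abbrev Φ : Coord := .inr (.inr (.inr (.inr (.inr 0))))
abbrev ψ : Coord := .inr (.inr (.inr (.inr (.inr 1))))
abbrev ρ : Coord := .inr (.inr (.inr (.inr (.inr 2))))
abbrev e : Coord := .inr (.inr (.inr (.inr (.inr 3))))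

lemma forall_iff {p : Coord → Prop} : (∀ a, p a) ↔ (∀ i j, p (g i j)) ∧ (∀ i j, p (k i j)) ∧
    (∀ i j, p (F i j)) ∧ (∀ i, p (E i)) ∧ (∀ i, p (u i)) ∧ p Φ ∧ p ψ ∧ p ρ ∧ p e := by
  simp only [Sum.forall, Prod.forall, Fin.forall_fin_succ (n := 3), Fin.forall_fin_succ (n := 2),
    Fin.forall_fin_succ (n := 1), Fin.forall_fin_succ (n := 0), IsEmpty.forall_iff, and_true]
  rfl

end Coord

/-- The state with coordinates `x`, with `√(2 U)` replaced by `r`. The components of `g` and `k`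
are symmetrized and those of `F` antisymmetrized. -/
def decode (x : Coord → ℝ) (r : ℝ) : State where
  g := of fun i j => (x (.g i j) + x (.g j i)) / 2
  k := of fun i j => (x (.k i j) + x (.k j i)) / 2
  E i := x (.E i)
  F := of fun i j => (x (.F i j) - x (.F j i)) / 2
  u i := x (.u i)
  Φ := x .Φ
  U := r ^ 2 / 2
  ρ := x .ρ
  e := x .e

/-- The vector with the given coordinates. -/
def pack (g k F : Fin 3 → Fin 3 → ℝ) (E u : Fin 3 → ℝ) (Φ ψ ρ e : ℝ) : Coord → ℝ :=
  Sum.elim (fun p => g p.1 p.2) (Sum.elim (fun p => k p.1 p.2) (Sum.elim (fun p => F p.1 p.2)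
    (Sum.elim E (Sum.elim u ![Φ, ψ, ρ, e]))))

/-- The coordinates of a state. -/
def encode (v : State) (ψ : ℝ) : Coord → ℝ := pack v.g v.k v.F v.E v.u v.Φ ψ v.ρ v.e

lemma decode_encode {v : State} (hv : v.Admissible) {ψ r : ℝ} (hr : v.U = r ^ 2 / 2) :
    decode (encode v ψ) r = v := by
  have hg : ∀ i j, v.g i j = v.g j i := fun i j => by
    simpa using (hv.g_posDef.isHermitian.apply i j).symm
  ext
  · rename_i i j
    change (v.g i j + v.g j i) / 2 = v.g i j
    rw [hg j i]; ring
  · rename_i i j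
    change (v.k i j + v.k j i) / 2 = v.k i j
    rw [hv.k_symm j i]; ring
  · rfl
  · rename_i i j
    change (v.F i j - v.F j i) / 2 = v.F i j
    rw [hv.F_antisymm j i]; ring
  · rfl
  · rfl
  · exact hr.symm
  · rfl
  · rfl

variable (C : Fin 3 → Fin 3 → Fin 3 → ℝ) (Λ m : ℝ)

/-- The right-hand sides of the evolution equations in coordinates, with `√(2 U)` replaced
by `r`. -/
def evolutionAux (x : Coord → ℝ) (r : ℝ) : Coord → ℝ :=
  pack (fun i j => -2 * (decode x r).k i j) ((decode x r).kRhs C Λ m) ((decode x r).FRhs C)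
    ((decode x r).ERhs C) ((decode x r).uRhs C) r ((decode x r).H * x .ψ - m ^ 2 * (decode x r).Φ)
    (-(decode x r).expansion C * (decode x r).ρ + 4 * Real.pi * (decode x r).e * (decode x r).work)
    (-(decode x r).expansion C * (decode x r).e
      + 4 * Real.pi * (decode x r).work * ((decode x r).e ^ 2 / (decode x r).ρ))

/-- The state with coordinates `x`. -/
def toState (x : Coord → ℝ) : State := decode x (max (x .ψ) 0)

/-- The evolution system as a vector field. -/
def evolution (x : Coord → ℝ) : Coord → ℝ := evolutionAux C Λ m x (max (x .ψ) 0)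

/-- The coordinates of the states with positive definite metric and positive density. -/
def phaseSpace : Set (Coord → ℝ) := {x | (toState x).g.PosDef ∧ 0 < (toState x).ρ}

/-- With `r` an independent variable the right-hand sides are rational in the components and `u⁰`,
whose radicand is at least one. All lack of smoothness is confined to the substitution `r =
max(ψ,0)`. -/
lemma contDiffAt_evolutionAux {z : (Coord → ℝ) × ℝ} (hz : (decode z.1 z.2).g.PosDef)
    (hρ : 0 < (decode z.1 z.2).ρ) :
    ContDiffAt ℝ 1 (fun z : (Coord → ℝ) × ℝ => evolutionAux C Λ m z.1 z.2) z := by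
  have hx : ∀ a : Coord, ContDiffAt ℝ 1 (fun z : (Coord → ℝ) × ℝ => z.1 a) z := fun a => by
    fun_prop
  have h : ContDiffState (fun z : (Coord → ℝ) × ℝ => decode z.1 z.2) z :=
    { g := fun i j => ((hx _).add (hx _)).div_const 2
      k := fun i j => ((hx _).add (hx _)).div_const 2
      E := fun i => hx _
      F := fun i j => ((hx _).sub (hx _)).div_const 2
      u := fun i => hx _
      Φ := hx _
      U := (contDiffAt_snd.pow 2).div_const 2
      ρ := hx _
      e := hx _
      g_posDef := hz
      ρ_pos := hρ }
  rw [contDiffAt_pi, Coord.forall_iff]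
  exact ⟨fun i j => contDiffAt_const.mul (h.k i j), fun i j => h.kRhs C Λ m i j,
    fun i j => h.FRhs C i j, fun i => h.ERhs C i, fun i => h.uRhs C i, contDiffAt_snd,
    (h.H.mul (hx _)).sub (contDiffAt_const.mul h.Φ), h.ρRhs C, h.eRhs C⟩

/-- In the variable `ψ` the root `√(2U)` is a positive part, hence Lipschitz even where `U`
vanishes. -/
lemma lipschitzWith_signed_root :
    LipschitzWith 1 fun y : Coord → ℝ => (y, max (y .ψ) 0) := by
  have h1 : LipschitzWith 1 fun y : Coord → ℝ => y .ψ := LipschitzWith.eval Coord.ψ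
  simpa using LipschitzWith.id.prodMk (h1.max_const 0)

lemma locallyLipschitzOn_evolution : LocallyLipschitzOn phaseSpace (evolution C Λ m) := by
  rintro x ⟨hg, hρ⟩
  obtain ⟨κ, t, ht, hκ⟩ := (contDiffAt_evolutionAux C Λ m (z := (x, max (x .ψ) 0)) hg
    hρ).exists_lipschitzOnWith
  have hcomp : evolution C Λ m = (fun z : (Coord → ℝ) × ℝ => evolutionAux C Λ m z.1 z.2) ∘
    fun y : Coord → ℝ => (y, max (y .ψ) 0) := rfl
  rw [hcomp]
  exact ⟨κ * 1, (fun y : Coord → ℝ => (y, max (y .ψ) 0)) ⁻¹' t, mem_nhdsWithin_of_mem_nhds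
    (lipschitzWith_signed_root.continuous.continuousAt.preimage_mem_nhds ht),
    hκ.comp lipschitzWith_signed_root.lipschitzOnWith (Set.mapsTo_preimage _ _)⟩

lemma posDef_of_coercive {A : Matrix (Fin 3) (Fin 3) ℝ} (hA : ∀ i j, A i j = A j i) {c : ℝ}
    (hc : 0 < c) (h : ∀ y, c * (y ⬝ᵥ y) ≤ y ⬝ᵥ A *ᵥ y) : A.PosDef := by
  refine PosDef.of_dotProduct_mulVec_pos (by ext i j; simpa using hA j i) fun y hy => ?_
  have : 0 < y ⬝ᵥ y := by simpa using (dotProduct_star_self_pos_iff (v := y)).mpr hy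
  simpa using lt_of_lt_of_le (mul_pos hc this) (h y)

lemma toState_g_symm (x : Coord → ℝ) (i j : Fin 3) : (toState x).g i j = (toState x).g j i := by
  simp only [toState, decode, of_apply, add_comm]

lemma toState_k_symm (x : Coord → ℝ) (i j : Fin 3) : (toState x).k i j = (toState x).k j i := by
  simp only [toState, decode, of_apply, add_comm]

lemma toState_F_antisymm (x : Coord → ℝ) (i j : Fin 3) :
    (toState x).F i j = -(toState x).F j i := by
  simp only [toState, decode, of_apply]; ring

lemma continuous_toState_g (i j : Fin 3) : Continuous fun x => (toState x).g i j := by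
  simp only [toState, decode, of_apply]
  fun_prop

lemma isOpen_phaseSpace : IsOpen phaseSpace := by
  have h1 : IsOpen {x | 0 < (toState x).ρ} := isOpen_lt continuous_const (continuous_apply _)
  suffices h : IsOpen {x | (toState x).g.PosDef} from h.inter h1
  rw [isOpen_iff_mem_nhds]
  intro x (hx : (toState x).g.PosDef)
  obtain ⟨c, hc, hcoer⟩ := State.exists_coercive hx
  -- Perturbing the nine entries by less than `c / 6` changes the form by at most `(c / 2)|z|²`,
  -- which leaves half of the coercivity.
  have hev : ∀ᶠ y in nhds x, ∀ i j, |(toState y).g i j - (toState x).g i j| < c / 6 := by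
    rw [Filter.eventually_all]
    intro i
    rw [Filter.eventually_all]
    intro j
    have := (continuous_toState_g i j).tendsto x
    exact Metric.tendsto_nhds.mp this (c / 6) (by positivity)
  filter_upwards [hev] with y hy
  refine posDef_of_coercive (toState_g_symm y) (half_pos hc) fun z => ?_
  have key : |z ⬝ᵥ ((toState y).g - (toState x).g) *ᵥ z| ≤ c / 2 * (z ⬝ᵥ z) := by
    rw [← State.quad_eq]
    have hterm : ∀ i j, |((toState y).g - (toState x).g) i j * z i * z j|
        ≤ c / 6 * ((z i ^ 2 + z j ^ 2) / 2) := by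
      intro i j
      rw [mul_assoc, abs_mul]
      refine mul_le_mul (hy i j).le ?_ (abs_nonneg _) (by positivity)
      rw [abs_le]
      constructor <;> nlinarith [sq_nonneg (z i + z j), sq_nonneg (z i - z j)]
    calc _ ≤ ∑ i, ∑ j, c / 6 * ((z i ^ 2 + z j ^ 2) / 2) :=
          (Finset.abs_sum_le_sum_abs _ _).trans (Finset.sum_le_sum fun i _ =>
            (Finset.abs_sum_le_sum_abs _ _).trans (Finset.sum_le_sum fun j _ => hterm i j))
      _ = c / 2 * (z ⬝ᵥ z) := by
          simp only [dotProduct, Fin.sum_univ_three]; ring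
  rw [sub_mulVec, dotProduct_sub] at key
  have := (abs_le.mp key).1
  linarith [hcoer z]


/-! ### Correspondence between integral curves and solutions -/

lemma hasDerivAt_max_zero_sq (y : ℝ) : HasDerivAt (fun z : ℝ => max z 0 ^ 2) (2 * max y 0) y := by
  rcases lt_trichotomy y 0 with h | rfl | h
  · rw [max_eq_right h.le, mul_zero]
    refine (hasDerivAt_const y (0 : ℝ)).congr_of_eventuallyEq ?_
    filter_upwards [Iio_mem_nhds h] with z hz
    rw [max_eq_right (le_of_lt hz), zero_pow two_ne_zero]
  -- At the origin the squared positive part is dominated by `z²`, so its derivative is zero.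
  · rw [max_self, mul_zero, hasDerivAt_iff_isLittleO_nhds_zero]
    simp only [zero_add, max_self, smul_zero, sub_zero, ne_eq, two_ne_zero, not_false_eq_true,
      zero_pow]
    refine Asymptotics.IsBigO.trans_isLittleO (g := fun h : ℝ => h ^ 2) ?_ ?_
    · refine Asymptotics.isBigO_of_le _ fun z => ?_
      rw [norm_pow, norm_pow]
      refine pow_le_pow_left₀ (norm_nonneg _) ?_ 2
      rw [Real.norm_eq_abs, Real.norm_eq_abs, abs_of_nonneg (le_max_right z 0)]
      exact max_le (le_abs_self z) (abs_nonneg z)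
    · exact Asymptotics.isLittleO_pow_id one_lt_two
  · rw [max_eq_left h.le]
    have h2 : HasDerivAt (fun z : ℝ => z ^ 2) (2 * y) y := by simpa using hasDerivAt_pow 2 y
    refine h2.congr_of_eventuallyEq ?_
    filter_upwards [Ioi_mem_nhds h] with z hz
    rw [max_eq_left (le_of_lt hz)]

/-- The evolution of `U = (ψ⁺)² / 2` when `ψ` solves a linear equation. -/
lemma hasDerivWithinAt_half_max_sq {ψ : ℝ → ℝ} {h b : ℝ} {s : Set ℝ} {t : ℝ}
    (hψ : HasDerivWithinAt ψ (h * ψ t - b) s t) :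
    HasDerivWithinAt (fun r => max (ψ r) 0 ^ 2 / 2)
      (2 * h * (max (ψ t) 0 ^ 2 / 2) - b * max (ψ t) 0) s t := by
  refine (((hasDerivAt_max_zero_sq (ψ t)).comp_hasDerivWithinAt t hψ).div_const 2).congr_deriv ?_
  -- This identity also holds for negative `ψ`; hence the linear equation for `ψ` gives the equation
  -- for `U` on both sides of zero.
  have h1 : max (ψ t) 0 * ψ t = max (ψ t) 0 ^ 2 := by
    rcases le_total (ψ t) 0 with h | h
    · rw [max_eq_right h]; ring
    · rw [max_eq_left h]; ring
  linear_combination h * h1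

variable {C : Fin 3 → Fin 3 → Fin 3 → ℝ} {Λ m : ℝ}

lemma sqrt_two_mul_toState_U (x : Coord → ℝ) : √(2 * (toState x).U) = max (x .ψ) 0 := by
  have : 2 * (toState x).U = max (x .ψ) 0 ^ 2 := by simp only [toState, decode]; ring
  rw [this, Real.sqrt_sq (le_max_right _ _)]

lemma FRhs_antisymm (hC : IsAntisymm C) (v : State) (i j : Fin 3) :
    v.FRhs C i j = -v.FRhs C j i := by
  simp only [State.FRhs, ← Finset.sum_neg_distrib]
  refine Finset.sum_congr rfl fun k _ => Finset.sum_congr rfl fun l _ => ?_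
  rw [hC k i j]; ring

/-- Integral curves of the vector field are solutions of the evolution system. -/
lemma evolvesAt_toState (hC : IsAntisymm C) (hJ : IsJacobi C) {x : ℝ → Coord → ℝ} {s : Set ℝ}
    {t : ℝ} (hx : x t ∈ phaseSpace) (h : HasDerivWithinAt x (evolution C Λ m (x t)) s t) :
    EvolvesAt C Λ m (fun r => toState (x r)) s t := by
  have hc := hasDerivWithinAt_pi.mp h
  have hU := hasDerivWithinAt_half_max_sq (ψ := fun r => x r .ψ) (hc .ψ)
  constructor
  · intro i j
    refine (((hc (.g i j)).add (hc (.g j i))).div_const 2).congr_deriv ?_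
    change (-2 * (toState (x t)).k i j + -2 * (toState (x t)).k j i) / 2 = _
    rw [toState_k_symm (x t) j i]; ring
  · intro i j
    refine (((hc (.k i j)).add (hc (.k j i))).div_const 2).congr_deriv ?_
    change ((toState (x t)).kRhs C Λ m i j + (toState (x t)).kRhs C Λ m j i) / 2 = _
    rw [State.kRhs_symm hC hJ hx.1 (toState_k_symm _) Λ m j i]; ring
  · exact fun i => hc (.E i)
  · intro i j
    refine (((hc (.F i j)).sub (hc (.F j i))).div_const 2).congr_deriv ?_
    change ((toState (x t)).FRhs C i j - (toState (x t)).FRhs C j i) / 2 = _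
    rw [FRhs_antisymm hC _ j i]; ring
  · exact fun i => hc (.u i)
  · rw [sqrt_two_mul_toState_U]
    exact hc .Φ
  · rw [sqrt_two_mul_toState_U]
    exact hU
  · exact hc .ρ
  · exact hc .e

/-- Nonnegativity of `e` need not be built into the phase space: `e/ρ` is constant along the curve
and `ρ > 0`, so the initial sign persists. -/
lemma isSolutionOn_toState (hC : IsAntisymm C) (hJ : IsJacobi C) {x : ℝ → Coord → ℝ} {T : ℝ}
    (hx : IsCurveOn (evolution C Λ m) phaseSpace x T) (he : 0 ≤ (toState (x 0)).e) :
    IsSolutionOn C Λ m (fun r => toState (x r)) T := by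
  have hev : ∀ t ∈ Set.Icc 0 T, EvolvesAt C Λ m (fun r => toState (x r)) (Set.Icc 0 T) t :=
    fun t ht => evolvesAt_toState hC hJ (hx t ht).1 (hx t ht).2
  refine ⟨fun t ht => ⟨(hx t ht).1.1, toState_k_symm _, toState_F_antisymm _, ?_, (hx t ht).1.2, ?_⟩,
    hev⟩
  · simp only [toState, decode]; positivity
  · have hρ := (hx t ht).1.2
    have h00 : (0 : ℝ) ∈ Set.Icc 0 T := ⟨le_rfl, ht.1.trans ht.2⟩
    have hq := eq_zero_of_linear (c := fun _ => 0)
      (y := fun t => (toState (x t)).e / (toState (x t)).ρ - (toState (x 0)).e / (toState (x 0)).ρ)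
      continuousOn_const (fun r hr => by simpa using (hev r hr).e_div_ρ (hx r hr).1.2)
      (sub_self _) t ht
    have h1 : (toState (x t)).e / (toState (x t)).ρ = (toState (x 0)).e / (toState (x 0)).ρ := by
      simpa [sub_eq_zero] using hq
    rw [div_eq_iff hρ.ne'] at h1
    rw [h1]
    exact mul_nonneg (div_nonneg he (hx 0 h00).1.2.le) hρ.le

/-- Solutions of the evolution system, together with a root of `2 U`, are integral curves of the
vector field. -/
lemma hasDerivWithinAt_encode {v : ℝ → State} {ψ : ℝ → ℝ} {s : Set ℝ} {t : ℝ}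
    (hv : EvolvesAt C Λ m v s t) (hadm : (v t).Admissible)
    (hU : (v t).U = max (ψ t) 0 ^ 2 / 2)
    (hψ : HasDerivWithinAt ψ ((v t).H * ψ t - m ^ 2 * (v t).Φ) s t) :
    HasDerivWithinAt (fun r => encode (v r) (ψ r)) (evolution C Λ m (encode (v t) (ψ t))) s t := by
  have hd : decode (encode (v t) (ψ t)) (max (encode (v t) (ψ t) .ψ) 0) = v t :=
    decode_encode hadm hU
  have hsq : √(2 * (v t).U) = max (ψ t) 0 := by
    rw [hU, mul_div_cancel₀ _ two_ne_zero, Real.sqrt_sq (le_max_right _ _)]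
  have hΦ := hv.Φ_eq
  rw [hsq] at hΦ
  rw [hasDerivWithinAt_pi, Coord.forall_iff, evolution, evolutionAux, hd]
  exact ⟨hv.g_eq, hv.k_eq, hv.F_eq, hv.E_eq, hv.u_eq, hΦ, hψ, hv.ρ_eq, hv.e_eq⟩


/-! ### Compactness, global existence and uniqueness -/

variable {C : Fin 3 → Fin 3 → Fin 3 → ℝ} {Λ m : ℝ}

/-- The coordinates bounded by `M` of the states whose metric and density are bounded below
by `c`. -/
def boundedRegion (M c : ℝ) : Set (Coord → ℝ) :=
  {x | (∀ a, |x a| ≤ M) ∧ c ≤ (toState x).ρ ∧ ∀ y, c * (y ⬝ᵥ y) ≤ y ⬝ᵥ (toState x).g *ᵥ y}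

/-- Coercivity with a fixed constant is a closed condition, unlike positive definiteness, so
boundedness of the coordinates suffices. -/
lemma isCompact_boundedRegion (M c : ℝ) : IsCompact (boundedRegion M c) := by
  refine (isCompact_univ_pi fun _ : Coord => isCompact_Icc (a := -M) (b := M)).of_isClosed_subset
    ?_ fun x hx a _ => abs_le.mp (hx.1 a)
  have h1 : IsClosed {x : Coord → ℝ | ∀ a, |x a| ≤ M} := by
    simp only [Set.ofPred_forall]
    exact isClosed_iInter fun a => isClosed_le (continuous_apply a).abs continuous_const
  have h2 : IsClosed {x : Coord → ℝ | c ≤ (toState x).ρ} :=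
    isClosed_le continuous_const (continuous_apply _)
  have h3 : IsClosed {x : Coord → ℝ | ∀ y, c * (y ⬝ᵥ y) ≤ y ⬝ᵥ (toState x).g *ᵥ y} := by
    simp only [Set.ofPred_forall, ← State.quad_eq]
    exact isClosed_iInter fun y => isClosed_le continuous_const
      (continuous_finsetSum _ fun i _ => continuous_finsetSum _ fun j _ =>
        ((continuous_toState_g i j).mul continuous_const).mul continuous_const)
  exact h1.inter (h2.inter h3)

lemma boundedRegion_subset {M c : ℝ} (hc : 0 < c) : boundedRegion M c ⊆ phaseSpace :=
  fun x hx => ⟨posDef_of_coercive (toState_g_symm x) hc hx.2.2, hc.trans_le hx.2.1⟩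

/-- Along integral curves starting from the coordinates of an admissible state, the coordinates
of `g` and `k` stay symmetric and those of `F` antisymmetric. -/
lemma coord_eq_of_isCurveOn (hC : IsAntisymm C) (hJ : IsJacobi C) {x : ℝ → Coord → ℝ} {T : ℝ}
    (hx : IsCurveOn (evolution C Λ m) phaseSpace x T) {v₀ : State} (hv₀ : v₀.Admissible) {ψ₀ : ℝ}
    (h0 : x 0 = encode v₀ ψ₀) {t : ℝ} (ht : t ∈ Set.Icc 0 T) (i j : Fin 3) :
    x t (.g i j) = (toState (x t)).g i j ∧ x t (.k i j) = (toState (x t)).k i j ∧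
      x t (.F i j) = (toState (x t)).F i j := by
  have hc : ∀ r ∈ Set.Icc 0 T, ∀ a, HasDerivWithinAt (fun r => x r a)
      (evolution C Λ m (x r) a) (Set.Icc 0 T) r := fun r hr => hasDerivWithinAt_pi.mp (hx r hr).2
  have zero : ∀ y : ℝ → ℝ, y 0 = 0 →
      (∀ r ∈ Set.Icc 0 T, HasDerivWithinAt y 0 (Set.Icc 0 T) r) → y t = 0 := fun y hy hd =>
    eq_zero_of_linear (c := fun _ => 0) continuousOn_const (by simpa using hd) hy t ht
  have hg := zero (fun r => x r (.g i j) - x r (.g j i)) (by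
      have : v₀.g i j = v₀.g j i := by simpa using (hv₀.g_posDef.isHermitian.apply i j).symm
      rw [h0]; exact sub_eq_zero.mpr this) fun r hr => by
    refine ((hc r hr (.g i j)).fun_sub (hc r hr (.g j i))).congr_deriv ?_
    change -2 * (toState (x r)).k i j - -2 * (toState (x r)).k j i = 0
    rw [toState_k_symm, sub_self]
  have hk := zero (fun r => x r (.k i j) - x r (.k j i)) (by
      rw [h0]; exact sub_eq_zero.mpr (hv₀.k_symm i j)) fun r hr => by
    refine ((hc r hr (.k i j)).fun_sub (hc r hr (.k j i))).congr_deriv ?_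
    change (toState (x r)).kRhs C Λ m i j - (toState (x r)).kRhs C Λ m j i = 0
    rw [State.kRhs_symm hC hJ (hx r hr).1.1 (toState_k_symm _), sub_self]
  have hF := zero (fun r => x r (.F i j) + x r (.F j i)) (by
      rw [h0]; exact add_eq_zero_iff_eq_neg.mpr (hv₀.F_antisymm i j)) fun r hr => by
    refine ((hc r hr (.F i j)).fun_add (hc r hr (.F j i))).congr_deriv ?_
    change (toState (x r)).FRhs C i j + (toState (x r)).FRhs C j i = 0
    rw [FRhs_antisymm hC, neg_add_cancel]
  simp only [toState, decode, of_apply]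
  refine ⟨?_, ?_, ?_⟩ <;> linarith

/-- A linear equation with bounded coefficients has bounded solutions. -/
lemma sq_le_of_linear {ψ h b : ℝ → ℝ} {T M B : ℝ}
    (hψ : ∀ t ∈ Set.Icc 0 T, HasDerivWithinAt ψ (h t * ψ t - b t) (Set.Icc 0 T) t)
    (hh : ∀ t ∈ Set.Icc 0 T, |h t| ≤ M) (hb : ∀ t ∈ Set.Icc 0 T, |b t| ≤ B) :
    ∀ t ∈ Set.Icc 0 T, ψ t ^ 2 ≤ (1 + ψ 0 ^ 2) * Real.exp ((2 * M + B) * t) := by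
  intro t ht
  -- The added one lets the source be absorbed through `2|b ψ| ≤ B (1 + ψ²)`.
  have key := le_mul_exp_of_deriv_le (y := fun r => 1 + ψ r ^ 2) (K := 2 * M + B)
    (fun r hr => ((hψ r hr).fun_pow 2).const_add 1) (fun r hr => ?_) t ht
  · linarith
  · have h1 := abs_le.mp (hh r hr)
    have h2 := abs_le.mp (hb r hr)
    have e : (2 : ℕ) * ψ r ^ (2 - 1) * (h r * ψ r - b r) = 2 * h r * ψ r ^ 2 - 2 * b r * ψ r := by
      norm_num; ring
    rw [e]
    have hM : 0 ≤ M := (abs_nonneg _).trans (hh r hr)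
    have h3 : 2 * h r * ψ r ^ 2 ≤ 2 * M * ψ r ^ 2 := by nlinarith [sq_nonneg (ψ r)]
    have h4 : -(2 * b r * ψ r) ≤ B * (1 + ψ r ^ 2) := by
      nlinarith [mul_nonneg (show 0 ≤ B - b r by linarith) (sq_nonneg (1 - ψ r)),
        mul_nonneg (show 0 ≤ B + b r by linarith) (sq_nonneg (1 + ψ r)),
        mul_nonneg (show 0 ≤ B - b r by linarith) (sq_nonneg (1 + ψ r)),
        mul_nonneg (show 0 ≤ B + b r by linarith) (sq_nonneg (1 - ψ r))]
    linarith

/-- Over bounded time intervals, integral curves with expanding initial data stay in a compact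
set. -/
lemma IsExpandingData.exists_boundedRegion {v₀ : State} (h0 : IsExpandingData C Λ m v₀) {ψ₀ : ℝ}
    (hψ₀ : v₀.U = max ψ₀ 0 ^ 2 / 2) (T : ℝ) :
    ∃ K, IsCompact K ∧ K ⊆ phaseSpace ∧ ∀ x : ℝ → Coord → ℝ, x 0 = encode v₀ ψ₀ →
      ∀ t ∈ Set.Icc 0 T, IsCurveOn (evolution C Λ m) phaseSpace x t → x t ∈ K := by
  obtain ⟨M, c, hc, hbound⟩ := h0.exists_isBounded T
  -- The energy controls only the positive part of `ψ`; this separate bound covers negative values.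
  set Q := √((1 + ψ₀ ^ 2) * Real.exp ((2 * M + m ^ 2 * M) * T)) with hQ
  refine ⟨boundedRegion (max M Q) c, isCompact_boundedRegion _ _, boundedRegion_subset hc, ?_⟩
  intro x hx0 t ht hx
  have hs0 : toState (x 0) = v₀ := by
    rw [hx0]; exact decode_encode h0.admissible hψ₀
  have hsol := isSolutionOn_toState h0.antisymm h0.jacobi hx (by
    rw [hs0]; exact h0.admissible.e_nonneg)
  have hb : ∀ r ∈ Set.Icc 0 t, (toState (x r)).IsBounded M c := hbound _ t ht.2 hs0 hsol
  have htt : t ∈ Set.Icc 0 t := ⟨ht.1, le_rfl⟩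
  have hbt := hb t htt
  have hM : 0 ≤ M := (abs_nonneg _).trans hbt.Φ_le
  -- Bounds on the state see only the symmetrized coordinates, so the coordinates themselves must be
  -- shown to keep their symmetries.
  have hcoord := coord_eq_of_isCurveOn h0.antisymm h0.jacobi hx h0.admissible hx0 htt
  have hψ : |x t .ψ| ≤ Q := by
    apply Real.abs_le_sqrt
    refine (sq_le_of_linear (ψ := fun r => x r .ψ) (h := fun r => (toState (x r)).H)
      (b := fun r => m ^ 2 * (toState (x r)).Φ) (M := M) (B := m ^ 2 * M)
      (fun r hr => hasDerivWithinAt_pi.mp (hx r hr).2 .ψ) (fun r hr => (hb r hr).H_le)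
      (fun r hr => ?_) t htt).trans ?_
    · rw [abs_mul, abs_of_nonneg (sq_nonneg m)]
      exact mul_le_mul_of_nonneg_left (hb r hr).Φ_le (sq_nonneg m)
    · have : x 0 .ψ = ψ₀ := by rw [hx0]; rfl
      simp only [this]
      refine mul_le_mul_of_nonneg_left (Real.exp_le_exp.mpr ?_) (by positivity)
      exact mul_le_mul_of_nonneg_left ht.2 (by positivity)
  refine ⟨?_, hbt.le_ρ, hbt.le_g⟩
  rw [Coord.forall_iff]
  have hMQ := le_max_left M Q
  refine ⟨fun i j => ?_, fun i j => ?_, fun i j => ?_, fun i => (hbt.E_le i).trans hMQ,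
    fun i => (hbt.u_le i).trans hMQ, hbt.Φ_le.trans hMQ, hψ.trans (le_max_right M Q),
    hbt.ρ_le.trans hMQ, hbt.e_le.trans hMQ⟩
  · rw [(hcoord i j).1]; exact (hbt.g_le i j).trans hMQ
  · rw [(hcoord i j).2.1]; exact (hbt.k_le i j).trans hMQ
  · rw [(hcoord i j).2.2]; exact (hbt.F_le i j).trans hMQ

/-- Solutions of an inhomogeneous linear equation on `[0, +∞)`. -/
lemma exists_linear_solution {h b : ℝ → ℝ} (hh : ContinuousOn h (Set.Ici 0))
    (hb : ContinuousOn b (Set.Ici 0)) (ψ₀ : ℝ) :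
    ∃ ψ : ℝ → ℝ, ψ 0 = ψ₀ ∧
      ∀ t, 0 ≤ t → HasDerivWithinAt ψ (h t * ψ t - b t) (Set.Ici 0) t := by
  -- The coefficients are frozen at their initial values for negative times, which gives continuity
  -- on the whole line and two-sided derivatives of the integrals.
  have hext : ∀ f : ℝ → ℝ, ContinuousOn f (Set.Ici 0) → Continuous fun t => f (max t 0) :=
    fun f hf => hf.comp_continuous (by fun_prop) fun t => le_max_right t 0
  have ch := hext h hh
  have cb := hext b hb
  set A : ℝ → ℝ := fun t => ∫ s in (0 : ℝ)..t, h (max s 0) with hA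
  have dA : ∀ t, HasDerivAt A (h (max t 0)) t := fun t =>
    (ch.integral_hasStrictDerivAt 0 t).hasDerivAt
  have cA : Continuous A := continuous_iff_continuousAt.mpr fun t => (dA t).continuousAt
  have cI : Continuous fun s => Real.exp (-A s) * b (max s 0) :=
    (Real.continuous_exp.comp cA.neg).mul cb
  set I : ℝ → ℝ := fun t => ∫ s in (0 : ℝ)..t, Real.exp (-A s) * b (max s 0) with hI
  have dI : ∀ t, HasDerivAt I (Real.exp (-A t) * b (max t 0)) t := fun t =>
    (cI.integral_hasStrictDerivAt 0 t).hasDerivAt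
  -- Variation of constants.
  refine ⟨fun t => Real.exp (A t) * (ψ₀ - I t), by simp [hA, hI], fun t ht => ?_⟩
  refine ((dA t).exp.fun_mul ((dI t).const_sub ψ₀)).hasDerivWithinAt.congr_deriv ?_
  rw [max_eq_left ht]
  have : Real.exp (A t) * Real.exp (-A t) = 1 := by rw [← Real.exp_add]; simp
  linear_combination (-b t) * this

lemma IsGlobalSolution.evolvesAt {v₀ : State} {v : ℝ → State} (hv : IsGlobalSolution C Λ m v₀ v)
    {t : ℝ} (ht : 0 ≤ t) : EvolvesAt C Λ m v (Set.Ici 0) t :=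
  ⟨hv.g_eq t ht, hv.k_eq t ht, hv.E_eq t ht, hv.F_eq t ht, hv.u_eq t ht, hv.Φ_eq t ht,
    hv.U_eq t ht, hv.ρ_eq t ht, hv.e_eq t ht⟩

lemma EvolvesAt.mono {v : ℝ → State} {s s' : Set ℝ} {t : ℝ} (hv : EvolvesAt C Λ m v s t)
    (h : s' ⊆ s) : EvolvesAt C Λ m v s' t :=
  ⟨fun i j => (hv.g_eq i j).mono h, fun i j => (hv.k_eq i j).mono h, fun i => (hv.E_eq i).mono h,
    fun i j => (hv.F_eq i j).mono h, fun i => (hv.u_eq i).mono h, hv.Φ_eq.mono h, hv.U_eq.mono h,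
    hv.ρ_eq.mono h, hv.e_eq.mono h⟩

lemma IsGlobalSolution.isSolutionOn {v₀ : State} {v : ℝ → State}
    (hv : IsGlobalSolution C Λ m v₀ v) (T : ℝ) : IsSolutionOn C Λ m v T :=
  ⟨fun t ht => hv.admissible t ht.1, fun _ ht => (hv.evolvesAt ht.1).mono Set.Icc_subset_Ici_self⟩

lemma isGlobalSolution_of_evolvesAt {v₀ : State} {v : ℝ → State} (h0 : v 0 = v₀)
    (hadm : ∀ t, 0 ≤ t → (v t).Admissible) (hv : ∀ t, 0 ≤ t → EvolvesAt C Λ m v (Set.Ici 0) t) :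
    IsGlobalSolution C Λ m v₀ v :=
  ⟨h0, hadm, fun t ht => (hv t ht).g_eq, fun t ht => (hv t ht).k_eq, fun t ht => (hv t ht).E_eq,
    fun t ht => (hv t ht).F_eq, fun t ht => (hv t ht).u_eq, fun t ht => (hv t ht).Φ_eq,
    fun t ht => (hv t ht).U_eq, fun t ht => (hv t ht).ρ_eq, fun t ht => (hv t ht).e_eq⟩

/-- Since `Φ` stays positive, `U` is determined by the linear equation for its signed root. -/
lemma IsSolutionOn.U_eq_half_max_sq {v : ℝ → State} {T : ℝ} (hv : IsSolutionOn C Λ m v T)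
    (hC : IsAntisymm C) (hΦ : 0 < (v 0).Φ) {ψ : ℝ → ℝ} (hψ0 : (v 0).U = max (ψ 0) 0 ^ 2 / 2)
    (hψ : ∀ t ∈ Set.Icc 0 T,
      HasDerivWithinAt ψ ((v t).H * ψ t - m ^ 2 * (v t).Φ) (Set.Icc 0 T) t) :
    ∀ t ∈ Set.Icc 0 T, (v t).U = max (ψ t) 0 ^ 2 / 2 := by
  obtain ⟨M, hM⟩ := isCompact_Icc.exists_bound_of_continuousOn (hv.continuousOn_H hC)
  intro t ht
  have key := le_mul_exp_of_deriv_le (y := fun r => ((v r).U - max (ψ r) 0 ^ 2 / 2) ^ 2)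
    (K := 4 * M)
    (fun r hr => ((hv.evolves r hr).U_eq.fun_sub (hasDerivWithinAt_half_max_sq (hψ r hr))).fun_pow 2)
    (fun r hr => ?_) t ht
  · simp only [hψ0, sub_self, ne_eq, two_ne_zero, not_false_eq_true, zero_pow, zero_mul] at key
    exact sub_eq_zero.mp (pow_eq_zero_iff two_ne_zero |>.mp (le_antisymm key (sq_nonneg _)))
  · have hΦr := hΦ.le.trans (hv.Φ_le r hr)
    have hs := Real.sqrt_nonneg (2 * (v r).U)
    have hs2 := Real.sq_sqrt (mul_nonneg two_pos.le (hv.admissible r hr).U_nonneg)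
    have hp : 0 ≤ max (ψ r) 0 := le_max_right _ _
    have hH := (le_abs_self _).trans (hM r hr)
    have hUr : (v r).U = √(2 * (v r).U) ^ 2 / 2 := by rw [hs2]; ring
    generalize √(2 * (v r).U) = s at *
    generalize max (ψ r) 0 = p at *
    rw [hUr]
    -- Here `s = √(2U)` and `p = max(ψ,0)`. The non-Lipschitz terms combine into `-m² Φ (s - p)² (s
    -- + p)`, which is nonpositive because `Φ > 0`, so Gronwall needs only the linear part.
    have e : (2 : ℕ) * (s ^ 2 / 2 - p ^ 2 / 2) ^ (2 - 1)
        * (2 * (v r).H * (s ^ 2 / 2) - m ^ 2 * (v r).Φ * s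
          - (2 * (v r).H * (p ^ 2 / 2) - m ^ 2 * (v r).Φ * p))
        = 4 * (v r).H * (s ^ 2 / 2 - p ^ 2 / 2) ^ 2
          - m ^ 2 * (v r).Φ * ((s - p) ^ 2 * (s + p)) := by
      norm_num; ring
    rw [e]
    have h1 : 0 ≤ m ^ 2 * (v r).Φ * ((s - p) ^ 2 * (s + p)) := by positivity
    have h2 := mul_le_mul_of_nonneg_right hH (sq_nonneg (s ^ 2 / 2 - p ^ 2 / 2))
    linarith

/-- Global solutions with `Φ > 0` initially are curves in the phase space. -/
lemma IsGlobalSolution.exists_curve {v₀ : State} {v : ℝ → State}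
    (hv : IsGlobalSolution C Λ m v₀ v) (hC : IsAntisymm C) (hΦ : 0 < v₀.Φ) {ψ₀ : ℝ}
    (hψ₀ : v₀.U = max ψ₀ 0 ^ 2 / 2) :
    ∃ x : ℝ → Coord → ℝ, x 0 = encode v₀ ψ₀ ∧ (∀ t, 0 ≤ t → toState (x t) = v t) ∧
      ∀ T, IsCurveOn (evolution C Λ m) phaseSpace x T := by
  have cH : ContinuousOn (fun t => (v t).H) (Set.Ici 0) := fun t ht =>
    ((hv.evolvesAt ht).H hC (hv.admissible t ht).g_posDef
      (hv.admissible t ht).k_symm).continuousWithinAt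
  have cΦ : ContinuousOn (fun t => m ^ 2 * (v t).Φ) (Set.Ici 0) := fun t ht =>
    ((hv.Φ_eq t ht).continuousWithinAt).const_mul _
  obtain ⟨ψ, hψ0, hψ⟩ := exists_linear_solution cH cΦ ψ₀
  have hU : ∀ t, 0 ≤ t → (v t).U = max (ψ t) 0 ^ 2 / 2 := fun t ht =>
    (hv.isSolutionOn t).U_eq_half_max_sq hC (by rw [hv.init]; exact hΦ)
      (by rw [hv.init, hψ0]; exact hψ₀)
      (fun r hr => (hψ r hr.1).mono Set.Icc_subset_Ici_self) t ⟨ht, le_rfl⟩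
  have hs : ∀ t, 0 ≤ t → toState (encode (v t) (ψ t)) = v t := fun t ht =>
    decode_encode (hv.admissible t ht) (hU t ht)
  refine ⟨fun t => encode (v t) (ψ t), by simp only [hv.init, hψ0], hs, fun T t ht => ⟨?_, ?_⟩⟩
  · change (toState _).g.PosDef ∧ 0 < (toState _).ρ
    rw [hs t ht.1]
    exact ⟨(hv.admissible t ht.1).g_posDef, (hv.admissible t ht.1).ρ_pos⟩
  · exact (hasDerivWithinAt_encode (hv.evolvesAt ht.1) (hv.admissible t ht.1) (hU t ht.1)
      (hψ t ht.1)).mono Set.Icc_subset_Ici_self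

/-- Expanding data have a unique global solution, and it satisfies the constraints. -/
theorem IsExpandingData.exists_unique_globalSolution {v₀ : State}
    (h0 : IsExpandingData C Λ m v₀) :
    ∃ v : ℝ → State, IsGlobalSolution C Λ m v₀ v ∧
      (∀ t, 0 ≤ t → (v t).Constraints C Λ m) ∧
      ∀ w : ℝ → State, IsGlobalSolution C Λ m v₀ w → ∀ t, 0 ≤ t → w t = v t := by
  -- The nonnegative root serves as common initial value of `ψ` for all solutions.
  set ψ₀ := √(2 * v₀.U) with hψdef
  have hψ₀ : v₀.U = max ψ₀ 0 ^ 2 / 2 := by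
    rw [hψdef, max_eq_left (Real.sqrt_nonneg _),
      Real.sq_sqrt (mul_nonneg two_pos.le h0.admissible.U_nonneg)]
    ring
  have hs0 : toState (encode v₀ ψ₀) = v₀ := decode_encode h0.admissible hψ₀
  have hmem : encode v₀ ψ₀ ∈ phaseSpace := by
    change (toState _).g.PosDef ∧ 0 < (toState _).ρ
    rw [hs0]
    exact ⟨h0.admissible.g_posDef, h0.admissible.ρ_pos⟩
  obtain ⟨x, hx0, hx⟩ := exists_global_curve isOpen_phaseSpace (locallyLipschitzOn_evolution C Λ m)
    hmem (fun T _ => h0.exists_boundedRegion hψ₀ T)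
  have hcurve : ∀ T, IsCurveOn (evolution C Λ m) phaseSpace x T := fun T t ht =>
    ⟨(hx t ht.1).1, (hx t ht.1).2.mono Set.Icc_subset_Ici_self⟩
  have hsol : ∀ T, IsSolutionOn C Λ m (fun r => toState (x r)) T := fun T =>
    isSolutionOn_toState h0.antisymm h0.jacobi (hcurve T) (by
      rw [hx0, hs0]; exact h0.admissible.e_nonneg)
  have hinit : toState (x 0) = v₀ := by rw [hx0, hs0]
  refine ⟨fun r => toState (x r), isGlobalSolution_of_evolvesAt hinit
    (fun t ht => (hsol t).admissible t ⟨ht, le_rfl⟩)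
    (fun t ht => evolvesAt_toState h0.antisymm h0.jacobi (hx t ht).1 (hx t ht).2), ?_, ?_⟩
  · intro t ht
    exact (hsol t).constraints h0.antisymm h0.jacobi (by rw [hinit]; exact h0.constraints) t
      ⟨ht, le_rfl⟩
  · intro w hw t ht
    -- Any competing solution lifts to an integral curve with the same initial point, so uniqueness
    -- for the locally Lipschitz field applies.
    obtain ⟨y, hy0, hyw, hy⟩ := hw.exists_curve h0.antisymm h0.Φ_pos hψ₀
    rw [← hyw t ht]
    exact congrArg toState ((hy t).eqOn (locallyLipschitzOn_evolution C Λ m) (hcurve t)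
      (by rw [hy0, hx0]) ⟨ht, le_rfl⟩)

end EinsteinMaxwellScalar

end

theorem theorem3 {L : Type*} [LieRing L] [LieAlgebra ℝ L] (hL : IsBianchiIToVIII L)
    (b : Module.Basis (Fin 3) ℝ L) (Λ m : ℝ) (hm : 0 < m)
    (v₀ : State) (hadm : v₀.Admissible) (hΦ : 0 < v₀.Φ) (hU : 0 < v₀.U)
    (hconstr : v₀.Constraints (structConst b) Λ m)
    (hΛ : -4 * Real.pi * m ^ 2 * v₀.Φ ^ 2 < Λ) (hH : v₀.H < 0) :
    ∃ v : ℝ → State, IsGlobalSolution (structConst b) Λ m v₀ v ∧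
      (∀ t, 0 ≤ t → (v t).Constraints (structConst b) Λ m) ∧
      ∀ w : ℝ → State, IsGlobalSolution (structConst b) Λ m v₀ w →
        ∀ t, 0 ≤ t → w t = v t := by
  exact IsExpandingData.exists_unique_globalSolution
    { antisymm := isAntisymm_structConst b
      jacobi := isJacobi_structConst b
      R_nonpos := fun w hw => State.R_nonpos hL b hw
      m_pos := hm
      admissible := hadm
      constraints := hconstr
      Φ_pos := hΦ
      lt_Λ := hΛ
      H_neg := hH }
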